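/- **Setting.** Let $X\in\mathbb R^p$ ($p\ge 1$) and $Y\in\{-1,1\}$ be random, $\tilde X=(1,X^\top)^\top\in\mathbb R^{p+1}$ (coordinates indexed $0,1,\dots,p$), and let $(X_i,Y_i)_{i=1}^n$ be i.i.d. copies of $(X,Y)$. Let $l(u)=\max\{1-u,0\}$, let $\beta^*\in\arg\min_{\beta\in\mathbb R^{p+1}}E\{l(Y\tilde X^\top\beta)\}$, and let $s=\|\beta^*\|_0$ be its number of nonzero entries. For a kernel $K$ and a bandwidth $h>0$ let $l_h(u)=\int_{\mathbb R} l(t)\,h^{-1}K((t-u)/h)\,dt$, and let $$\hat\beta^{\mathrm{off}}\in\arg\min_{\beta\in\mathbb R^{p+1}}\Big\{\frac1n\sum_{i=1}^n l_h(Y_i\tilde X_i^\top\beta)+\lambda\sum_{j=1}^p|\beta_j|\Big\}.$$ **Assumptions.** 1. $K\ge 0$ is symmetric, $\int K=1$, $\int tK(t)\,dt=0$; $K$ is twice differentiable; $K$, $K'$, $K''$ are bounded; $\min_{|t|\le 1}K(t)\ge\kappa_l>0$; $\int|t|K(t)\,dt<\infty$ and $\int t^2K(t)\,dt\le\kappa_2<\infty$.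 2. Conditionally on $Y=1$, $X$ has a density $f$ on $\mathbb R^p$ that is continuous, bounded and has finite second moments. For almost every value of $X_{-1}=(X_2,\dots,X_p)$, the conditional density $f(\cdot\mid X_{-1})$ of $X_1$ given $X_{-1}$ is differentiable, $\sup_{x}\max\{|f|,|f'|,|x^2f|,|xf'|,|x^2f'|\}\le C_f$ holds for it, and $\int|x|f(x\mid X_{-1})\,dx<\infty$. The same holds for the density $g$ of $X$ given $Y=-1$. 3. With $\Sigma=E[\tilde X\tilde X^\top]$: (i) $P(|u^\top\Sigma^{-1/2}\tilde X|\ge v_0\|u\|_2t)\le 2e^{-t^2/2}$ for all $u\ne0$ and $t>0$; (ii) the eigenvalues of $\Sigma$ lie in $[c_1,c_2]$, $c_1>0$; (iii) $\max_i\sum_j|(\Sigma^{-1})_{ij}|\le M$. 4. $|\beta^*_1|\ge c>0$ and $\|\beta^*\|_2\le C$. 5. The eigenvalues of $D=E[\delta(1-Y\tilde X^\top\beta^*)\tilde X\tilde X^\top]$ ($\delta$ the Dirac delta, i.e. $D$ is the derivative at $r=1$ of $r\mapsto E[1\{Y\tilde X^\top\beta^*\le r\}\tilde X\tilde X^\top]$)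 lie in $[a_1,a_2]$, $a_1>0$. **Theorem.** There are positive constants $C_1,C_2$, depending only on $c_1,c_2,C_f,c,\kappa_2,\kappa_l,a_1,a_2$, such that the following holds. Fix a kernel $K$ as in Assumption 1, positive $v_0$, $M$, $C$, and $0<b_1\le b_2$. There is $A_0>0$, depending on these and the preceding constants only, such that for all $A_0\le A_1\le A_2$ there is $N_0>0$, depending on $A_1$, $A_2$ and the preceding constants only, with the following property: for all $n,p,s$ with $n\ge N_0\,s\log p$, all laws of $(X,Y)$ that satisfy Assumptions 2–5, and all $\lambda$, $h$ with $$A_1\sqrt{\tfrac{\log p}{n}}\le\lambda\le A_2\sqrt{\tfrac{\log p}{n}},\qquad b_1\Big(\tfrac{s\log p}{n}\Big)^{1/4}\le h\le b_2\Big(\tfrac{s\log p}{n}\Big)^{1/4},$$ there is an event of probability greater than $1-4/p$ on which $\hat\beta^{\mathrm{off}}$ exists and every such minimizer satisfies $$\|\hat\beta^{\mathrm{off}}-\beta^*\|_2\le C_2s^{1/2}\lambda,\qquad \|\hat\beta^{\mathrm{off}}-\beta^*\|_1\le C_1s\lambda .$$ -/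

import Mathlib

open MeasureTheory ProbabilityTheory Set
open scoped Matrix MatrixOrder

noncomputable section

namespace SmoothedSVM

/-! ### Vectors -/

/-- The augmented feature vector `(1, x₁, …, x_p)`; index `0` is the intercept, and index `j + 1`
is the feature whose index in `Fin p` is `j`. -/
def aug {p : ℕ} (x : Fin p → ℝ) : Fin (p + 1) → ℝ := Fin.cons 1 x

/-- The `l₁` norm. -/
def l1Norm {k : ℕ} (v : Fin k → ℝ) : ℝ := ∑ j, |v j|

/-- The Euclidean norm. -/
def l2Norm {k : ℕ} (v : Fin k → ℝ) : ℝ := ‖(WithLp.toLp 2 v : EuclideanSpace ℝ (Fin k))‖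

/-- The number of nonzero entries. -/
def l0Norm {k : ℕ} (v : Fin k → ℝ) : ℕ := {j : Fin k | v j ≠ 0}.ncard

/-! ### Losses and the estimator -/

/-- The hinge loss. -/
def hinge (u : ℝ) : ℝ := max (1 - u) 0

/-- The margin `y * x̃ᵀβ` of an observation `z = (x, y)`. -/
def margin {p : ℕ} (β : Fin (p + 1) → ℝ) (z : (Fin p → ℝ) × ℝ) : ℝ := z.2 * (aug z.1 ⬝ᵥ β)

/-- The scaled kernel `K_h(u) = h⁻¹ K(u / h)`. -/
def scaledKernel (K : ℝ → ℝ) (h u : ℝ) : ℝ := h⁻¹ * K (u / h)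

/-- The convolution-smoothed hinge loss. -/
def smoothedHinge (K : ℝ → ℝ) (h u : ℝ) : ℝ := ∫ t, hinge t * scaledKernel K h (t - u)

/-- The empirical smoothed hinge loss of the data set `D`. -/
def empiricalLoss {p n : ℕ} (K : ℝ → ℝ) (h : ℝ) (D : Fin n → (Fin p → ℝ) × ℝ)
    (β : Fin (p + 1) → ℝ) : ℝ :=
  (n : ℝ)⁻¹ * ∑ i, smoothedHinge K h (margin β (D i))

/-- `β` minimizes the empirical smoothed hinge loss plus `lam` times the `l₁` norm of `β` without
its intercept. -/
def IsSmoothedLasso {p n : ℕ} (K : ℝ → ℝ) (h lam : ℝ) (D : Fin n → (Fin p → ℝ) × ℝ)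
    (β : Fin (p + 1) → ℝ) : Prop :=
  IsMinOn (fun b : Fin (p + 1) → ℝ => empiricalLoss K h D b + lam * l1Norm (Fin.tail b)) univ β

/-! ### Population quantities; `P` is the law of `(X, Y)` -/

/-- `β` minimizes the population hinge risk. -/
def IsRiskMinimizer {p : ℕ} (P : Measure ((Fin p → ℝ) × ℝ)) (β : Fin (p + 1) → ℝ) : Prop :=
  IsMinOn (fun b : Fin (p + 1) → ℝ => ∫ z, hinge (margin b z) ∂P) univ β

/-- The conditional law of `X` given `Y = y`. -/
def classLaw {p : ℕ} (P : Measure ((Fin p → ℝ) × ℝ)) (y : ℝ) : Measure (Fin p → ℝ) :=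
  (cond P {z | z.2 = y}).map Prod.fst

/-- The second moment matrix `E[X̃ X̃ᵀ]`. -/
def secondMoment {p : ℕ} (P : Measure ((Fin p → ℝ) × ℝ)) : Matrix (Fin (p + 1)) (Fin (p + 1)) ℝ :=
  Matrix.of fun j k => ∫ z, aug z.1 j * aug z.1 k ∂P

/-- The whitened vector `Σ^{-1/2} x̃`. -/
def whitened {p : ℕ} (P : Measure ((Fin p → ℝ) × ℝ)) (x : Fin p → ℝ) : Fin (p + 1) → ℝ :=
  (CFC.sqrt (secondMoment P))⁻¹ *ᵥ aug x

/-- The matrix `E[δ(1 - Y X̃ᵀβ) X̃ X̃ᵀ]` with the Dirac delta `δ`. Since `δ` is the derivative of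
the Heaviside function, `E[δ(r - V) W]` is the derivative of `r ↦ E[1{V ≤ r} W]`, that is, the
Lebesgue density at `r` of the signed measure `A ↦ E[1{V ∈ A} W]`. -/
def diracHessian {p : ℕ} (P : Measure ((Fin p → ℝ) × ℝ)) (β : Fin (p + 1) → ℝ) :
    Matrix (Fin (p + 1)) (Fin (p + 1)) ℝ :=
  Matrix.of fun j k =>
    deriv (fun r : ℝ => ∫ z in {z | margin β z ≤ r}, aug z.1 j * aug z.1 k ∂P) 1

/-- The marginal density of the features other than the first one. -/
def marginalDensity {d : ℕ} (f : (Fin (d + 1) → ℝ) → ℝ) (w : Fin d → ℝ) : ℝ :=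
  ∫ x : ℝ, f (Fin.cons x w)

/-- The conditional density at `x` of the first feature given that the others are `w`. -/
def condDensity {d : ℕ} (f : (Fin (d + 1) → ℝ) → ℝ) (w : Fin d → ℝ) (x : ℝ) : ℝ :=
  f (Fin.cons x w) / marginalDensity f w

/-! ### Assumptions -/

/-- Kernel conditions; `κl` is a lower bound of `K` on `[-1, 1]` and `κ₂` an upper bound of the
second moment of `K`. -/
structure KernelAssumption (K : ℝ → ℝ) (κl κ₂ : ℝ) : Prop where
  nonneg : ∀ t, 0 ≤ K t
  symm : ∀ t, K (-t) = K t
  integral_eq_one : ∫ t, K t = 1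
  first_moment_eq_zero : ∫ t, t * K t = 0
  differentiable : Differentiable ℝ K
  differentiable_deriv : Differentiable ℝ (deriv K)
  deriv_bdd : ∃ B, ∀ t, |deriv K t| ≤ B
  deriv2_bdd : ∃ B, ∀ t, |deriv (deriv K) t| ≤ B
  bdd : ∃ B, ∀ t, K t ≤ B
  lower : ∀ t, |t| ≤ 1 → κl ≤ K t
  integrable_one : Integrable fun t => |t| * K t
  integrable_two : Integrable fun t => |t| ^ 2 * K t
  second_moment_le : ∫ t, |t| ^ 2 * K t ≤ κ₂

/-- The law `ν` on `ℝ^{d+1}` has the density `f`, which is continuous, bounded, has finite second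
moments, and whose conditional density of the first coordinate given the others satisfies uniform
bounds with the constant `Cf`. -/
structure DensityAssumption {d : ℕ} (ν : Measure (Fin (d + 1) → ℝ)) (f : (Fin (d + 1) → ℝ) → ℝ)
    (Cf : ℝ) : Prop where
  nonneg : ∀ x, 0 ≤ f x
  law : ν = volume.withDensity fun x => ENNReal.ofReal (f x)
  continuous : Continuous f
  bdd : ∃ B, ∀ x, f x ≤ B
  second_moment : ∀ j, Integrable fun x => x j ^ 2 * f x
  differentiable : ∀ᵐ w : Fin d → ℝ, 0 < marginalDensity f w → Differentiable ℝ (condDensity f w)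
  bounds : ∀ᵐ w : Fin d → ℝ, 0 < marginalDensity f w → ∀ x : ℝ,
    |condDensity f w x| ≤ Cf ∧
    |deriv (condDensity f w) x| ≤ Cf ∧
    |x ^ 2 * condDensity f w x| ≤ Cf ∧
    |x * deriv (condDensity f w) x| ≤ Cf ∧
    |x ^ 2 * deriv (condDensity f w) x| ≤ Cf
  first_moment : ∀ᵐ w : Fin d → ℝ, 0 < marginalDensity f w →
    Integrable fun x => |x| * condDensity f w x

/-- Conditions on the second moment matrix `Σ`: sub-Gaussian whitened features with parameter `v₀`,
eigenvalues of `Σ` in `[c₁, c₂]`, absolute row sums of `Σ⁻¹` at most `M`. -/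
structure DesignAssumption {p : ℕ} (P : Measure ((Fin p → ℝ) × ℝ)) (v₀ c₁ c₂ M : ℝ) : Prop where
  subGaussian : ∀ u : Fin (p + 1) → ℝ, u ≠ 0 → ∀ t : ℝ, 0 < t →
    P.real {z | v₀ * l2Norm u * t ≤ |u ⬝ᵥ whitened P z.1|} ≤ 2 * Real.exp (-t ^ 2 / 2)
  eigenvalues : spectrum ℝ (secondMoment P) ⊆ Icc c₁ c₂
  inv_row_sum : ∀ i, ∑ j, |(secondMoment P)⁻¹ i j| ≤ M

/-- The coefficient of the first feature is at least `c` in absolute value, and the Euclidean norm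
is at most `C`. -/
structure ParameterAssumption {d : ℕ} (β : Fin (d + 1 + 1) → ℝ) (c C : ℝ) : Prop where
  first_coeff : c ≤ |β 1|
  norm_le : l2Norm β ≤ C

/-- The eigenvalues of the population Hessian lie in `[a₁, a₂]`. -/
def HessianAssumption {p : ℕ} (P : Measure ((Fin p → ℝ) × ℝ)) (β : Fin (p + 1) → ℝ)
    (a₁ a₂ : ℝ) : Prop :=
  spectrum ℝ (diracHessian P β) ⊆ Icc a₁ a₂

end SmoothedSVM

end

/-!
The penalized objective is convex, so it suffices to show that it exceeds its value at `β*` on the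
sphere of radius `r = C₂ √s λ` about `β*`: then a minimizer exists, and every minimizer lies in the
ball of radius `r`. The `l₁` bound follows since a point that does at least as well as `β*` differs
from it by a vector `v` with `‖v‖₁ ≤ 8 √s ‖v‖₂`. This deterministic part is
`exists_lasso_and_bounds`. It asks for two properties of the sample: a bound of the score at `β*`,
and a quadratic lower bound of the loss over the part of the sphere in that cone.

The score splits into noise and bias. The noise is at most `λ / 2` times the `l₁` norm of the
direction (`Model.exists_score_event`). The bias is at most a multiple of `h²` times the Euclidean
norm (`Model.abs_integral_smoothed_score_le`), that is, of order `√s λ`, and a large `A₀` makes it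
at most `√s λ`. It is quadratic in `h` because `β*` is stationary for the hinge risk
(`Model.integral_score_eq_zero`), the kernel has mean zero, and the integral of a linear form over
`{margin ≤ r}` has a second order expansion in the level `r`. Such expansions
(`Model.exists_expansion`) come from slicing along the first feature: its coefficient is bounded
away from zero, so a half-space is a half-line in each slice, and the assumptions bound the
conditional density and its derivative. The same expansion for quadratic forms identifies the
Dirac Hessian with the curvature of the hinge risk (`Model.le_integral_dot_sq_band`).

For the quadratic lower bound, the smoothed hinge loss gains at least `κₗ v² / (4 h)` over its
linearization when the margin is within `h / 2` of the kink and `|v| ≤ h / 2`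
(`smoothedHinge_rem_ge`). Replacing `v²` by a truncated square, which is Lipschitz with constant
`h / 2`, gives for each observation a lower bound `bandCurv` that is a contraction of a linear form.
On the sphere its mean is at least `(3 / 4) a₁ r²`: the error of the expansion costs a multiple of
`h r²`, and the truncation, by a fourth moment bound, a multiple of `r⁴ / h³`
(`Model.le_integral_bandCurv`). As `r²` and `h⁴` are both of the order of `s log p / n`, both are
negligible against `r²` once `N₀` is large.

Both noise bounds hold uniformly in the direction. They follow from a single estimate of the
exponential moment of the supremum of a centred empirical process which is dominated, together with
its increments, by linear forms (`lintegral_exp_iSup_sum_centered_le`). Symmetrization and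
contraction are carried out one coordinate at a time inside the exponential moment, which reduces
the supremum to the `p + 1` coordinates of a sum of symmetrized features, and no concentration
inequality for suprema is needed. Chernoff's bound then gives failure probabilities of order `p⁻²`.
-/

namespace SmoothedSVM

/-! ### Symmetrization and contraction for exponential moments -/

/-- Weak majorization of pairs, for the exponential function. -/
lemma exp_add_exp_le_of_majorized {p q u w : ℝ} (hp : p ≤ max u w) (hq : q ≤ max u w)
    (h : p + q ≤ u + w) : Real.exp p + Real.exp q ≤ Real.exp u + Real.exp w := by
  wlog huw : w ≤ u generalizing u w
  · rw [add_comm (Real.exp u)]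
    exact this (by rwa [max_comm]) (by rwa [max_comm]) (by linarith) (le_of_not_ge huw)
  wlog hpq : q ≤ p generalizing p q
  · rw [add_comm (Real.exp p)]
    exact this hq hp (by linarith) (le_of_not_ge hpq)
  rw [max_eq_left huw] at hp hq
  rcases le_total w p with hwp | hpw
  · have hpos := Real.exp_pos p
    have h1 : Real.exp q ≤ Real.exp (u + w - p) := Real.exp_le_exp.2 (by linarith)
    have h2 : Real.exp (u + w - p) * Real.exp p = Real.exp u * Real.exp w := by
      rw [← Real.exp_add, ← Real.exp_add]; ring_nf
    have h3 : 0 ≤ (Real.exp u - Real.exp p) * (Real.exp p - Real.exp w) :=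
      mul_nonneg (sub_nonneg.2 (Real.exp_le_exp.2 hp)) (sub_nonneg.2 (Real.exp_le_exp.2 hwp))
    have h4 : (Real.exp p + Real.exp (u + w - p)) * Real.exp p
        ≤ (Real.exp u + Real.exp w) * Real.exp p := by nlinarith
    linarith [le_of_mul_le_mul_right h4 hpos]
  · linarith [Real.exp_le_exp.2 hp, Real.exp_le_exp.2 (hpq.trans hpw)]

lemma le_iSup_of_finite {ι : Type*} [Finite ι] (b : ι → ℝ) (k : ι) : b k ≤ ⨆ l, b l :=
  le_ciSup (Set.finite_range b).bddAbove k

lemma lintegral_exp_iSup_pi_succ {ι W : Type*} [MeasurableSpace W] (ν : Measure W) [IsFiniteMeasure ν]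
    (d : ι → W → ℝ) (n : ℕ) (a : ι → ℝ) :
    ∫⁻ z, ENNReal.ofReal (Real.exp (⨆ k, (a k + ∑ i, d k (z i))))
      ∂Measure.pi (fun _ : Fin (n + 1) => ν) =
    ∫⁻ q : W × (Fin n → W), ENNReal.ofReal
      (Real.exp (⨆ k, (a k + d k q.1 + ∑ i, d k (q.2 i)))) ∂ν.prod (Measure.pi fun _ => ν) := by
  rw [← ((measurePreserving_piFinSuccAbove (fun _ : Fin (n + 1) => ν) 0).symm).lintegral_comp_emb
    (MeasurableEquiv.measurableEmbedding _)]
  refine lintegral_congr fun q => ?_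
  simp only [Fin.sum_univ_succ, MeasurableEquiv.piFinSuccAbove, MeasurableEquiv.symm_mk,
    MeasurableEquiv.coe_mk, Fin.insertNthEquiv]
  simp [add_assoc]

section Finite

variable {ι : Type*} [Finite ι]

/-- The two-point contraction principle: among all processes `φ` dominated by `x`, the random sign
moment of `exp ∘ sup` is largest for `x` itself. -/
lemma exp_iSup_contraction [Nonempty ι] (a φ x : ι → ℝ) (hφ : ∀ k, |φ k| ≤ |x k|)
    (hφ' : ∀ k l, |φ k - φ l| ≤ |x k - x l|) :
    Real.exp (⨆ k, (a k + φ k)) + Real.exp (⨆ k, (a k - φ k))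
      ≤ Real.exp (⨆ k, (a k + x k)) + Real.exp (⨆ k, (a k - x k)) := by
  obtain ⟨k, hk⟩ := exists_eq_ciSup_of_finite (f := fun k => a k + φ k)
  obtain ⟨l, hl⟩ := exists_eq_ciSup_of_finite (f := fun k => a k - φ k)
  rw [← hk, ← hl]
  have hp := le_iSup_of_finite (fun k => a k + x k)
  have hm := le_iSup_of_finite (fun k => a k - x k)
  have key : ∀ j, a j + |x j| ≤ max (⨆ k, (a k + x k)) (⨆ k, (a k - x k)) := by
    intro j
    rcases abs_cases (x j) with ⟨h, -⟩ | ⟨h, -⟩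
    · exact le_max_of_le_left (by rw [h]; exact hp j)
    · exact le_max_of_le_right (by rw [h]; exact hm j)
  refine exp_add_exp_le_of_majorized ?_ ?_ ?_
  · linarith [key k, le_abs_self (φ k), hφ k]
  · linarith [key l, neg_abs_le (φ l), hφ l]
  · have h1 := le_abs_self (φ k - φ l)
    have h2 := hφ' k l
    have := hp k; have := hp l; have := hm k; have := hm l
    rcases abs_cases (x k - x l) with ⟨h, -⟩ | ⟨h, -⟩ <;> linarith

/-- One coordinate of symmetrization: centring by the mean is exchanged, by Jensen's inequality and
convexity, for a random sign and a factor two, and the process is then contracted. -/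
lemma lintegral_exp_iSup_centered_le [Nonempty ι] {Z : Type*} [MeasurableSpace Z] (P : Measure Z)
    [IsProbabilityMeasure P] (φ x : ι → Z → ℝ) (hint : ∀ k, Integrable (φ k) P)
    (hmeas : ∀ k, Measurable (φ k))
    (hφ : ∀ k z, |φ k z| ≤ |x k z|) (hφ' : ∀ k l z, |φ k z - φ l z| ≤ |x k z - x l z|)
    (a : ι → ℝ) :
    ∫⁻ z, ENNReal.ofReal (Real.exp (⨆ k, (a k + (∫ z', φ k z' ∂P - φ k z)))) ∂P ≤
      ∫⁻ z, (ENNReal.ofReal (Real.exp (⨆ k, (a k + 2 * x k z))) +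
        ENNReal.ofReal (Real.exp (⨆ k, (a k - 2 * x k z)))) / 2 ∂P := by
  have jensen : ∀ z, ENNReal.ofReal (Real.exp (⨆ k, (a k + (∫ z', φ k z' ∂P - φ k z)))) ≤
      ∫⁻ z', ENNReal.ofReal (Real.exp (⨆ k, (a k + (φ k z' - φ k z)))) ∂P := by
    intro z
    set Y : Z → ℝ := fun z' => ⨆ k, (a k + (φ k z' - φ k z)) with hY
    have hYm : Measurable Y := Measurable.iSup fun k => by
      have := hmeas k; fun_prop
    have hYint : Integrable Y P := by
      have : Fintype ι := Fintype.ofFinite ι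
      refine Integrable.mono' (g := fun z' => ∑ k, |a k + (φ k z' - φ k z)|) ?_
        hYm.aestronglyMeasurable (ae_of_all _ fun z' => ?_)
      · refine integrable_finsetSum _ fun k _ => ?_
        exact ((integrable_const _).add ((hint k).sub (integrable_const _))).abs
      · obtain ⟨k, hk⟩ := exists_eq_ciSup_of_finite (f := fun k => a k + (φ k z' - φ k z))
        rw [hY]
        simp only
        rw [← hk, Real.norm_eq_abs]
        exact Finset.single_le_sum (f := fun k => |a k + (φ k z' - φ k z)|)
          (fun _ _ => abs_nonneg _) (Finset.mem_univ k)
    have hle : (⨆ k, (a k + (∫ z', φ k z' ∂P - φ k z))) ≤ ∫ z', Y z' ∂P := by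
      refine ciSup_le fun k => ?_
      have h1 : a k + (∫ z', φ k z' ∂P - φ k z) = ∫ z', (a k + (φ k z' - φ k z)) ∂P := by
        rw [integral_add (integrable_const _) (by exact (hint k).sub (integrable_const _)),
          integral_sub (hint k) (integrable_const _)]
        simp
      rw [h1]
      refine integral_mono ((integrable_const _).add ((hint k).sub (integrable_const _))) hYint ?_
      intro z'
      exact le_iSup_of_finite (fun k => a k + (φ k z' - φ k z)) k
    by_cases hexp : Integrable (fun z' => Real.exp (Y z')) P
    · rw [← ofReal_integral_eq_lintegral_ofReal hexp (ae_of_all _ fun _ => (Real.exp_pos _).le)]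
      refine ENNReal.ofReal_le_ofReal ((Real.exp_le_exp.2 hle).trans ?_)
      exact convexOn_exp.map_integral_le Real.continuous_exp.continuousOn isClosed_univ
        (ae_of_all _ fun _ => mem_univ _) hYint hexp
    · -- a nonnegative function that is not integrable has infinite lower integral
      have : ∫⁻ z', ENNReal.ofReal (Real.exp (Y z')) ∂P = ⊤ := by
        by_contra hne
        refine hexp ⟨(Real.continuous_exp.measurable.comp hYm).aestronglyMeasurable, ?_⟩
        rw [hasFiniteIntegral_iff_ofReal (ae_of_all _ fun _ => (Real.exp_pos _).le)]
        exact lt_of_le_of_ne le_top hne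
      rw [this]; exact le_top
  have hmp : Measurable fun z => ENNReal.ofReal (Real.exp (⨆ k, (a k + 2 * φ k z))) :=
    (Real.measurable_exp.comp (Measurable.iSup fun k => by
      have := hmeas k; fun_prop)).ennreal_ofReal
  have hmm : Measurable fun z => ENNReal.ofReal (Real.exp (⨆ k, (a k - 2 * φ k z))) :=
    (Real.measurable_exp.comp (Measurable.iSup fun k => by
      have := hmeas k; fun_prop)).ennreal_ofReal
  have split : ∀ z z', ENNReal.ofReal (Real.exp (⨆ k, (a k + (φ k z' - φ k z)))) ≤
      ENNReal.ofReal (Real.exp (⨆ k, (a k + 2 * φ k z'))) / 2 +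
        ENNReal.ofReal (Real.exp (⨆ k, (a k - 2 * φ k z))) / 2 := by
    intro z z'
    set u := ⨆ k, (a k + 2 * φ k z')
    set w := ⨆ k, (a k - 2 * φ k z)
    have h1 : (⨆ k, (a k + (φ k z' - φ k z))) ≤ (1 / 2 : ℝ) * u + (1 / 2 : ℝ) * w := by
      refine ciSup_le fun k => ?_
      have := le_iSup_of_finite (fun k => a k + 2 * φ k z') k
      have := le_iSup_of_finite (fun k => a k - 2 * φ k z) k
      linarith
    have h2 : Real.exp ((1 / 2 : ℝ) * u + (1 / 2 : ℝ) * w) ≤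
        (1 / 2 : ℝ) * Real.exp u + (1 / 2 : ℝ) * Real.exp w :=
      convexOn_exp.2 (mem_univ u) (mem_univ w) (by norm_num) (by norm_num) (by norm_num)
    rw [ENNReal.div_eq_inv_mul, ENNReal.div_eq_inv_mul]
    have h3 : (2 : ENNReal)⁻¹ = ENNReal.ofReal (1 / 2) := by
      rw [one_div, ENNReal.ofReal_inv_of_pos (by norm_num)]; simp
    rw [h3, ← ENNReal.ofReal_mul (by norm_num), ← ENNReal.ofReal_mul (by norm_num),
      ← ENNReal.ofReal_add (by positivity) (by positivity)]
    exact ENNReal.ofReal_le_ofReal ((Real.exp_le_exp.2 h1).trans h2)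
  calc ∫⁻ z, ENNReal.ofReal (Real.exp (⨆ k, (a k + (∫ z', φ k z' ∂P - φ k z)))) ∂P
      ≤ ∫⁻ z, (∫⁻ z', (ENNReal.ofReal (Real.exp (⨆ k, (a k + 2 * φ k z'))) / 2 +
        ENNReal.ofReal (Real.exp (⨆ k, (a k - 2 * φ k z))) / 2) ∂P) ∂P :=
        lintegral_mono fun z => (jensen z).trans (lintegral_mono fun z' => split z z')
    _ = ∫⁻ z, (ENNReal.ofReal (Real.exp (⨆ k, (a k + 2 * φ k z))) +
        ENNReal.ofReal (Real.exp (⨆ k, (a k - 2 * φ k z)))) / 2 ∂P := by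
        have : ∀ z, (∫⁻ z', (ENNReal.ofReal (Real.exp (⨆ k, (a k + 2 * φ k z'))) / 2 +
          ENNReal.ofReal (Real.exp (⨆ k, (a k - 2 * φ k z))) / 2) ∂P) =
          (∫⁻ z', ENNReal.ofReal (Real.exp (⨆ k, (a k + 2 * φ k z'))) / 2 ∂P) +
          ENNReal.ofReal (Real.exp (⨆ k, (a k - 2 * φ k z))) / 2 := by
          intro z
          rw [lintegral_add_right _ measurable_const]
          simp
        simp_rw [this]
        rw [lintegral_add_left measurable_const]
        simp_rw [ENNReal.add_div]
        rw [lintegral_add_left (hmp.div_const 2)]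
        simp
    _ ≤ _ := by
        refine lintegral_mono fun z => ?_
        refine ENNReal.div_le_div_right ?_ _
        rw [← ENNReal.ofReal_add (by positivity) (by positivity),
          ← ENNReal.ofReal_add (by positivity) (by positivity)]
        refine ENNReal.ofReal_le_ofReal (exp_iSup_contraction a (fun k => 2 * φ k z)
          (fun k => 2 * x k z) (fun k => ?_) fun k l => ?_)
        · rw [abs_mul, abs_mul]; exact mul_le_mul_of_nonneg_left (hφ k z) (abs_nonneg _)
        · rw [← mul_sub, ← mul_sub, abs_mul, abs_mul]
          exact mul_le_mul_of_nonneg_left (hφ' k l z) (abs_nonneg _)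

lemma measurable_exp_iSup_prod {W V : Type*} [MeasurableSpace W] [MeasurableSpace V]
    (d : ι → W → ℝ) (hd : ∀ k, Measurable (d k)) (e : ι → V → ℝ) (he : ∀ k, Measurable (e k))
    (n : ℕ) (a : ι → ℝ) : Measurable fun q : V × (Fin n → W) => ENNReal.ofReal
      (Real.exp (⨆ k, (a k + e k q.1 + ∑ i, d k (q.2 i)))) := by
  refine (Real.measurable_exp.comp (Measurable.iSup fun k => ?_)).ennreal_ofReal
  refine (measurable_const.add ((he k).comp measurable_fst)).add ?_
  exact Finset.measurable_sum _ fun i _ =>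
    (hd k).comp ((measurable_pi_apply i).comp measurable_snd)

/-- A comparison of exponential moments of suprema that holds for one observation, whatever the
offsets, holds for independent samples. -/
lemma lintegral_exp_iSup_pi_le {Z E : Type*} [MeasurableSpace Z] [MeasurableSpace E]
    (P : Measure Z) (ρ : Measure E) [IsFiniteMeasure P] [IsFiniteMeasure ρ]
    (c : ι → Z → ℝ) (y : ι → E → ℝ) (hc : ∀ k, Measurable (c k)) (hy : ∀ k, Measurable (y k))
    (step : ∀ a : ι → ℝ, ∫⁻ z, ENNReal.ofReal (Real.exp (⨆ k, (a k + c k z))) ∂P ≤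
      ∫⁻ e, ENNReal.ofReal (Real.exp (⨆ k, (a k + y k e))) ∂ρ) (n : ℕ) (a : ι → ℝ) :
    ∫⁻ z, ENNReal.ofReal (Real.exp (⨆ k, (a k + ∑ i, c k (z i)))) ∂Measure.pi (fun _ : Fin n => P) ≤
      ∫⁻ e, ENNReal.ofReal (Real.exp (⨆ k, (a k + ∑ i, y k (e i))))
        ∂Measure.pi (fun _ : Fin n => ρ) := by
  induction n generalizing a with
  | zero => simp
  | succ n ih =>
    rw [lintegral_exp_iSup_pi_succ P c, lintegral_exp_iSup_pi_succ ρ y,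
      lintegral_prod _ (measurable_exp_iSup_prod c hc c hc n a).aemeasurable,
      lintegral_prod_symm _ (measurable_exp_iSup_prod y hy y hy n a).aemeasurable]
    calc _ ≤ ∫⁻ z, ∫⁻ e, ENNReal.ofReal (Real.exp (⨆ k, (a k + c k z + ∑ i, y k (e i))))
          ∂Measure.pi (fun _ : Fin n => ρ) ∂P := lintegral_mono fun z => ih _
      _ = ∫⁻ e, ∫⁻ z, ENNReal.ofReal (Real.exp (⨆ k, (a k + c k z + ∑ i, y k (e i)))) ∂P
          ∂Measure.pi (fun _ : Fin n => ρ) :=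
          lintegral_lintegral_swap (measurable_exp_iSup_prod y hy c hc n a).aemeasurable
      _ ≤ _ := by
          refine lintegral_mono fun e => ?_
          have := step fun k => a k + ∑ i, y k (e i)
          simpa only [add_right_comm] using this

end Finite

/-- The law of `X` multiplied by an independent random sign. -/
noncomputable def symmLaw {Z : Type*} [MeasurableSpace Z] (P : Measure Z) {m : ℕ}
    (X : Z → Fin m → ℝ) : Measure (Fin m → ℝ) :=
  (2⁻¹ : ENNReal) • (P.map X + P.map fun z => -X z)

instance {Z : Type*} [MeasurableSpace Z] (P : Measure Z) [IsFiniteMeasure P] {m : ℕ}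
    (X : Z → Fin m → ℝ) : IsFiniteMeasure (symmLaw P X) := by
  unfold symmLaw
  exact Measure.smul_finite _ (by simp)

lemma lintegral_symmLaw {Z : Type*} [MeasurableSpace Z] (P : Measure Z) {m : ℕ}
    {X : Z → Fin m → ℝ} (hX : Measurable X) {F : (Fin m → ℝ) → ENNReal} (hF : Measurable F) :
    ∫⁻ e, F e ∂symmLaw P X = ∫⁻ z, (F (X z) + F (-X z)) / 2 ∂P := by
  unfold symmLaw
  rw [lintegral_smul_measure, lintegral_add_measure, lintegral_map hF hX,
    lintegral_map (g := fun z => -X z) hF hX.neg,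
    ← lintegral_add_left (f := fun z => F (X z)) (hF.comp hX), smul_eq_mul, ← lintegral_const_mul]
  · simp_rw [ENNReal.div_eq_inv_mul]
  · exact (hF.comp hX).add (hF.comp hX.neg)

lemma half_ofReal_exp_add_exp (a b : ℝ) :
    (ENNReal.ofReal (Real.exp (a + b)) + ENNReal.ofReal (Real.exp (a - b))) / 2 =
      ENNReal.ofReal (Real.exp a) * ENNReal.ofReal (Real.cosh b) := by
  have h3 : (2 : ENNReal)⁻¹ = ENNReal.ofReal (1 / 2) := by
    rw [one_div, ENNReal.ofReal_inv_of_pos (by norm_num)]; simp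
  rw [ENNReal.div_eq_inv_mul, h3, ← ENNReal.ofReal_add (by positivity) (by positivity),
    ← ENNReal.ofReal_mul (by norm_num), ← ENNReal.ofReal_mul (by positivity), Real.cosh_eq,
    sub_eq_add_neg, Real.exp_add, Real.exp_add]
  congr 1; ring

/-- Exponential moment of a sum of symmetrized coordinates. -/
lemma lintegral_exp_sum_symmLaw_le {Z : Type*} [MeasurableSpace Z] (P : Measure Z)
    [IsFiniteMeasure P] {m : ℕ} {X : Z → Fin m → ℝ} (hX : Measurable X) (j : Fin m) (u B : ℝ)
    (hB : ∫⁻ z, ENNReal.ofReal (Real.cosh (u * X z j)) ∂P ≤ ENNReal.ofReal (Real.exp B)) (n : ℕ) :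
    ∫⁻ e, ENNReal.ofReal (Real.exp (∑ i, u * e i j)) ∂Measure.pi (fun _ : Fin n => symmLaw P X) ≤
      ENNReal.ofReal (Real.exp (n * B)) := by
  have key := lintegral_exp_iSup_pi_le (ι := Unit) (symmLaw P X) (Measure.dirac ())
    (fun _ e => u * e j) (fun _ _ => B) (fun _ => by fun_prop) (fun _ => measurable_const)
    (fun a => ?_) n 0
  · simpa using key
  · simp only [ciSup_unique, lintegral_dirac]
    rw [lintegral_symmLaw P hX]
    · simp only [Pi.neg_apply, mul_neg, ← sub_eq_add_neg, half_ofReal_exp_add_exp]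
      rw [lintegral_const_mul', Real.exp_add, ENNReal.ofReal_mul (Real.exp_pos _).le]
      · gcongr
      · exact ENNReal.ofReal_ne_top
    · exact (Real.measurable_exp.comp (by fun_prop)).ennreal_ofReal

lemma abs_dotProduct_le_l1Norm_mul {m : ℕ} (x v : Fin m → ℝ) {b : ℝ} (hb : ∀ j, |x j| ≤ b) :
    |x ⬝ᵥ v| ≤ l1Norm v * b := by
  unfold l1Norm dotProduct
  rw [Finset.sum_mul]
  refine (Finset.abs_sum_le_sum_abs _ _).trans (Finset.sum_le_sum fun j _ => ?_)
  rw [abs_mul, mul_comm]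
  exact mul_le_mul_of_nonneg_left (hb j) (abs_nonneg _)

/-- Exponential moment of the supremum of a centred empirical process which is dominated by the
linear process `x ↦ x ⬝ᵥ v k` indexed by vectors of bounded `l₁` norm. No boundedness of the
process and no concentration inequality for suprema is needed. -/
lemma lintegral_exp_iSup_sum_centered_le {Z : Type*} [MeasurableSpace Z] (P : Measure Z)
    [IsProbabilityMeasure P] {ι : Type*} [Finite ι] [Nonempty ι] {m n : ℕ}
    {X : Z → Fin (m + 1) → ℝ} (hX : Measurable X) (φ : ι → Z → ℝ) (v : ι → Fin (m + 1) → ℝ)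
    (hint : ∀ k, Integrable (φ k) P) (hmeas : ∀ k, Measurable (φ k))
    (hφ : ∀ k z, |φ k z| ≤ |X z ⬝ᵥ v k|)
    (hφ' : ∀ k l z, |φ k z - φ l z| ≤ |X z ⬝ᵥ v k - X z ⬝ᵥ v l|) {R B : ℝ}
    (hR : ∀ k, l1Norm (v k) ≤ R)
    (hB : ∀ j, ∫⁻ z, ENNReal.ofReal (Real.cosh (2 * R * X z j)) ∂P ≤ ENNReal.ofReal (Real.exp B)) :
    ∫⁻ z, ENNReal.ofReal (Real.exp (⨆ k, ∑ i, (∫ z', φ k z' ∂P - φ k (z i))))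
        ∂Measure.pi (fun _ : Fin n => P) ≤
      ENNReal.ofReal (2 * (m + 1) * Real.exp (n * B)) := by
  have hdot : ∀ k, Measurable fun e : Fin (m + 1) → ℝ => 2 * (e ⬝ᵥ v k) := fun k => by
    unfold dotProduct; fun_prop
  have key := lintegral_exp_iSup_pi_le P (symmLaw P X) (fun k z => ∫ z', φ k z' ∂P - φ k z)
    (fun k e => 2 * (e ⬝ᵥ v k)) (fun k => measurable_const.sub (hmeas k)) hdot (fun a => ?_) n 0
  · simp only [Pi.zero_apply, zero_add] at key
    refine key.trans ?_
    have point : ∀ e : Fin n → Fin (m + 1) → ℝ,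
        ENNReal.ofReal (Real.exp (⨆ k, ∑ i, 2 * (e i ⬝ᵥ v k))) ≤
        ∑ j, (ENNReal.ofReal (Real.exp (∑ i, (2 * R) * e i j)) +
          ENNReal.ofReal (Real.exp (∑ i, (-(2 * R)) * e i j))) := by
      intro e
      obtain ⟨j, -, hj⟩ := Finset.exists_max_image Finset.univ (fun j => |∑ i, e i j|)
        Finset.univ_nonempty
      refine le_trans ?_ (Finset.single_le_sum
        (f := fun j => ENNReal.ofReal (Real.exp (∑ i, (2 * R) * e i j)) +
          ENNReal.ofReal (Real.exp (∑ i, (-(2 * R)) * e i j)))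
        (fun _ _ => zero_le) (Finset.mem_univ j))
      have hle : (⨆ k, ∑ i, 2 * (e i ⬝ᵥ v k)) ≤ 2 * R * |∑ i, e i j| := by
        refine ciSup_le fun k => ?_
        have h1 : ∑ i, 2 * (e i ⬝ᵥ v k) = 2 * ((∑ i, e i) ⬝ᵥ v k) := by
          rw [← Finset.mul_sum, sum_dotProduct]
        have h2 := abs_dotProduct_le_l1Norm_mul (∑ i, e i) (v k) (b := |∑ i, e i j|) fun l => by
          simpa using hj l (Finset.mem_univ l)
        rw [h1, mul_assoc]
        have h3 := mul_le_mul_of_nonneg_right (hR k) (abs_nonneg (∑ i, e i j))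
        linarith [le_abs_self ((∑ i, e i) ⬝ᵥ v k)]
      rw [← ENNReal.ofReal_add (by positivity) (by positivity), ← Finset.mul_sum, ← Finset.mul_sum]
      refine ENNReal.ofReal_le_ofReal ((Real.exp_le_exp.2 hle).trans ?_)
      rcases abs_cases (∑ i, e i j) with ⟨h, -⟩ | ⟨h, -⟩
      · rw [h]; linarith [Real.exp_pos (-(2 * R) * ∑ i, e i j)]
      · rw [h, mul_neg, ← neg_mul]; linarith [Real.exp_pos (2 * R * ∑ i, e i j)]
    refine (lintegral_mono point).trans ?_
    have hm : ∀ (u : ℝ) (j : Fin (m + 1)), Measurable fun e : Fin n → Fin (m + 1) → ℝ =>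
        ENNReal.ofReal (Real.exp (∑ i, u * e i j)) := fun u j =>
      (Real.measurable_exp.comp (by fun_prop)).ennreal_ofReal
    rw [lintegral_finsetSum _ fun j _ => by exact (hm _ j).add (hm _ j)]
    calc _ ≤ ∑ _j : Fin (m + 1), (ENNReal.ofReal (Real.exp (n * B)) +
          ENNReal.ofReal (Real.exp (n * B))) := by
          refine Finset.sum_le_sum fun j _ => ?_
          rw [lintegral_add_left (hm _ j)]
          refine add_le_add (lintegral_exp_sum_symmLaw_le P hX j _ B (hB j) n)
            (lintegral_exp_sum_symmLaw_le P hX j _ B ?_ n)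
          simpa only [neg_mul, Real.cosh_neg] using hB j
      _ = _ := by
          rw [Finset.sum_const, Finset.card_univ, Fintype.card_fin, nsmul_eq_mul,
            ← ENNReal.ofReal_add (by positivity) (by positivity), ← ENNReal.ofReal_natCast,
            ← ENNReal.ofReal_mul (by positivity)]
          congr 1; push_cast; ring
  · rw [lintegral_symmLaw P hX]
    · refine (lintegral_exp_iSup_centered_le P φ (fun k z => X z ⬝ᵥ v k) hint hmeas hφ hφ' a).trans
        (lintegral_mono fun z => ?_)
      simp only [neg_dotProduct, mul_neg, sub_eq_add_neg]
      exact le_rfl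
    · exact (Real.measurable_exp.comp (Measurable.iSup fun k =>
        measurable_const.add (hdot k))).ennreal_ofReal

/-! ### Moments of sub-Gaussian variables -/

section SubGaussian

variable {Z : Type*} [MeasurableSpace Z] {P : Measure Z} [IsProbabilityMeasure P] {W : Z → ℝ}
  {σ : ℝ}

/-- Layer-cake integration of the tail bound. -/
lemma lintegral_exp_sq_le (hW : Measurable W) (hσ : 0 < σ)
    (tail : ∀ t : ℝ, 0 < t → P.real {z | σ * t ≤ |W z|} ≤ 2 * Real.exp (-t ^ 2 / 2)) :
    ∫⁻ z, ENNReal.ofReal (Real.exp (W z ^ 2 / (4 * σ ^ 2))) ∂P ≤ 3 := by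
  have hf : Measurable fun z => W z ^ 2 / (4 * σ ^ 2) := by fun_prop
  have cake := lintegral_comp_eq_lintegral_meas_le_mul P (f := fun z => W z ^ 2 / (4 * σ ^ 2))
    (g := Real.exp) (ae_of_all _ fun z => by positivity) hf.aemeasurable
    (fun t _ => Real.continuous_exp.intervalIntegrable _ _) (ae_of_all _ fun t => (Real.exp_pos t).le)
  simp only [integral_exp, Real.exp_zero] at cake
  have htail : ∫⁻ t in Ioi (0 : ℝ), P {z | t ≤ W z ^ 2 / (4 * σ ^ 2)} * ENNReal.ofReal (Real.exp t)
      ≤ 2 := by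
    calc _ ≤ ∫⁻ t in Ioi (0 : ℝ), ENNReal.ofReal (2 * Real.exp (-t)) := by
          refine setLIntegral_mono (by fun_prop) fun t ht => ?_
          have ht : 0 < t := ht
          have hset : {z | t ≤ W z ^ 2 / (4 * σ ^ 2)} ⊆ {z | σ * (2 * √t) ≤ |W z|} := by
            intro z hz
            simp only [mem_ofPred_eq] at hz ⊢
            rw [le_div_iff₀ (by positivity)] at hz
            refine abs_le_of_sq_le_sq' ?_ (abs_nonneg _) |>.2
            rw [sq_abs, mul_pow, mul_pow, Real.sq_sqrt ht.le]
            linarith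
          have h1 := tail (2 * √t) (by positivity)
          rw [mul_pow, Real.sq_sqrt ht.le] at h1
          have h2 : P {z | t ≤ W z ^ 2 / (4 * σ ^ 2)} ≤ ENNReal.ofReal (2 * Real.exp (-(2 * t))) := by
            refine (measure_mono hset).trans ?_
            rw [← ofReal_measureReal]
            refine ENNReal.ofReal_le_ofReal (h1.trans (le_of_eq ?_))
            congr 2; ring
          calc _ ≤ ENNReal.ofReal (2 * Real.exp (-(2 * t))) * ENNReal.ofReal (Real.exp t) := by
                gcongr
            _ = _ := by
                rw [← ENNReal.ofReal_mul (by positivity), mul_assoc, ← Real.exp_add]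
                congr 3; ring
      _ = ENNReal.ofReal (∫ t in Ioi (0 : ℝ), 2 * Real.exp (-t)) := by
          rw [ofReal_integral_eq_lintegral_ofReal ((integrableOn_exp_neg_Ioi 0).const_mul 2)
            (ae_of_all _ fun t => by positivity)]
      _ = 2 := by
          rw [integral_const_mul, integral_exp_neg_Ioi_zero]; simp
  calc _ = ∫⁻ z, (ENNReal.ofReal (Real.exp (W z ^ 2 / (4 * σ ^ 2)) - 1) + 1) ∂P := by
        refine lintegral_congr fun z => ?_
        rw [← ENNReal.ofReal_one, ← ENNReal.ofReal_add _ zero_le_one, sub_add_cancel]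
        rw [sub_nonneg]; exact Real.one_le_exp (by positivity)
    _ = (∫⁻ t in Ioi (0 : ℝ), P {z | t ≤ W z ^ 2 / (4 * σ ^ 2)} * ENNReal.ofReal (Real.exp t)) + 1 := by
        rw [lintegral_add_right _ measurable_const, cake]; simp
    _ ≤ 2 + 1 := by gcongr
    _ = 3 := by norm_num

lemma lintegral_cosh_le (hW : Measurable W) (hσ : 0 < σ)
    (tail : ∀ t : ℝ, 0 < t → P.real {z | σ * t ≤ |W z|} ≤ 2 * Real.exp (-t ^ 2 / 2)) (t : ℝ) :
    ∫⁻ z, ENNReal.ofReal (Real.cosh (t * W z)) ∂P ≤ ENNReal.ofReal (Real.exp (4 * σ ^ 2 * t ^ 2)) := by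
  have h3 := lintegral_exp_sq_le hW hσ tail
  set θ : ℝ := 2 * σ ^ 2 * t ^ 2 with hθ
  have hθ0 : 0 ≤ θ := by positivity
  rcases le_total θ 1 with h | h
  · -- small `t`: convexity of the exponential on the segment from `0` to `W ^ 2 / (4 σ ^ 2)`
    have point : ∀ z, Real.cosh (t * W z) ≤
        (1 - θ) + θ * Real.exp (W z ^ 2 / (4 * σ ^ 2)) := by
      intro z
      refine (Real.cosh_le_exp_half_sq _).trans ?_
      have := convexOn_exp.2 (mem_univ (W z ^ 2 / (4 * σ ^ 2))) (mem_univ 0) hθ0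
        (sub_nonneg.2 h) (by ring)
      simp only [smul_eq_mul, mul_zero, add_zero, Real.exp_zero, mul_one] at this
      have he : (t * W z) ^ 2 / 2 = θ * (W z ^ 2 / (4 * σ ^ 2)) := by
        rw [hθ]; field_simp; ring
      rw [he]; linarith
    calc _ ≤ ∫⁻ z, (ENNReal.ofReal (1 - θ) +
          ENNReal.ofReal θ * ENNReal.ofReal (Real.exp (W z ^ 2 / (4 * σ ^ 2)))) ∂P := by
          refine lintegral_mono fun z => ?_
          rw [← ENNReal.ofReal_mul hθ0, ← ENNReal.ofReal_add (sub_nonneg.2 h) (by positivity)]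
          exact ENNReal.ofReal_le_ofReal (point z)
      _ ≤ ENNReal.ofReal (1 - θ) + ENNReal.ofReal θ * 3 := by
          rw [lintegral_add_left measurable_const, lintegral_const_mul' _ _ ENNReal.ofReal_ne_top]
          simp only [lintegral_const, measure_univ, mul_one]
          gcongr
      _ = ENNReal.ofReal ((1 - θ) + θ * 3) := by
          rw [ENNReal.ofReal_add (sub_nonneg.2 h) (by positivity), ENNReal.ofReal_mul hθ0]
          simp
      _ ≤ _ := by
          refine ENNReal.ofReal_le_ofReal ?_
          have := Real.add_one_le_exp (4 * σ ^ 2 * t ^ 2)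
          linarith
  · have point : ∀ z, Real.cosh (t * W z) ≤
        Real.exp (σ ^ 2 * t ^ 2) * Real.exp (W z ^ 2 / (4 * σ ^ 2)) := by
      intro z
      rw [← Real.cosh_abs, ← Real.exp_add]
      have h1 : Real.cosh |t * W z| ≤ Real.exp |t * W z| := by
        rw [Real.cosh_eq]
        have : Real.exp (-|t * W z|) ≤ Real.exp |t * W z| :=
          Real.exp_le_exp.2 (by linarith [abs_nonneg (t * W z)])
        linarith
      refine h1.trans (Real.exp_le_exp.2 ?_)
      have h2 : 0 ≤ (σ * |t| - |W z| / (2 * σ)) ^ 2 := sq_nonneg _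
      have h4 : (σ * |t| - |W z| / (2 * σ)) ^ 2 =
          σ ^ 2 * t ^ 2 + W z ^ 2 / (4 * σ ^ 2) - |t * W z| := by
        rw [abs_mul, ← sq_abs t, ← sq_abs (W z)]; field_simp; ring
      linarith
    calc _ ≤ ∫⁻ z, ENNReal.ofReal (Real.exp (σ ^ 2 * t ^ 2)) *
          ENNReal.ofReal (Real.exp (W z ^ 2 / (4 * σ ^ 2))) ∂P := by
          refine lintegral_mono fun z => ?_
          rw [← ENNReal.ofReal_mul (by positivity)]
          exact ENNReal.ofReal_le_ofReal (point z)
      _ ≤ ENNReal.ofReal (Real.exp (σ ^ 2 * t ^ 2)) * 3 := by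
          rw [lintegral_const_mul' _ _ ENNReal.ofReal_ne_top]
          gcongr
      _ = ENNReal.ofReal (Real.exp (σ ^ 2 * t ^ 2) * 3) := by
          rw [ENNReal.ofReal_mul (by positivity)]; simp
      _ ≤ _ := by
          refine ENNReal.ofReal_le_ofReal ?_
          have h5 : (3 : ℝ) ≤ Real.exp (3 * (σ ^ 2 * t ^ 2)) := by
            have h6 := Real.quadratic_le_exp_of_nonneg (x := 3 * (σ ^ 2 * t ^ 2)) (by positivity)
            nlinarith
          calc _ ≤ Real.exp (σ ^ 2 * t ^ 2) * Real.exp (3 * (σ ^ 2 * t ^ 2)) := by gcongr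
            _ = _ := by rw [← Real.exp_add]; congr 1; ring

lemma lintegral_pow_four_le (hW : Measurable W) (hσ : 0 < σ)
    (tail : ∀ t : ℝ, 0 < t → P.real {z | σ * t ≤ |W z|} ≤ 2 * Real.exp (-t ^ 2 / 2)) :
    ∫⁻ z, ENNReal.ofReal (W z ^ 4) ∂P ≤ ENNReal.ofReal (96 * σ ^ 4) := by
  have h3 := lintegral_exp_sq_le hW hσ tail
  calc _ ≤ ∫⁻ z, ENNReal.ofReal (32 * σ ^ 4) *
        ENNReal.ofReal (Real.exp (W z ^ 2 / (4 * σ ^ 2))) ∂P := by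
        refine lintegral_mono fun z => ?_
        rw [← ENNReal.ofReal_mul (by positivity)]
        refine ENNReal.ofReal_le_ofReal ?_
        have h6 := Real.quadratic_le_exp_of_nonneg (x := W z ^ 2 / (4 * σ ^ 2)) (by positivity)
        have h7 : 0 ≤ W z ^ 2 / (4 * σ ^ 2) := by positivity
        have h8 : W z ^ 4 = 32 * σ ^ 4 * ((W z ^ 2 / (4 * σ ^ 2)) ^ 2 / 2) := by
          field_simp; ring
        rw [h8]
        gcongr
        linarith
    _ ≤ ENNReal.ofReal (32 * σ ^ 4) * 3 := by
        rw [lintegral_const_mul' _ _ ENNReal.ofReal_ne_top]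
        gcongr
    _ = _ := by
        rw [show (3 : ENNReal) = ENNReal.ofReal 3 by simp, ← ENNReal.ofReal_mul (by positivity)]
        congr 1; ring

lemma integrable_pow_four (hW : Measurable W) (hσ : 0 < σ)
    (tail : ∀ t : ℝ, 0 < t → P.real {z | σ * t ≤ |W z|} ≤ 2 * Real.exp (-t ^ 2 / 2)) :
    Integrable (fun z => W z ^ 4) P := by
  refine ⟨(hW.pow_const 4).aestronglyMeasurable, ?_⟩
  rw [hasFiniteIntegral_iff_ofReal (ae_of_all _ fun _ => by positivity)]
  exact (lintegral_pow_four_le hW hσ tail).trans_lt ENNReal.ofReal_lt_top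

lemma integral_pow_four_le (hW : Measurable W) (hσ : 0 < σ)
    (tail : ∀ t : ℝ, 0 < t → P.real {z | σ * t ≤ |W z|} ≤ 2 * Real.exp (-t ^ 2 / 2)) :
    ∫ z, W z ^ 4 ∂P ≤ 96 * σ ^ 4 := by
  rw [integral_eq_lintegral_of_nonneg_ae (ae_of_all _ fun _ => by positivity)
    (hW.pow_const 4).aestronglyMeasurable]
  exact ENNReal.toReal_le_of_le_ofReal (by positivity) (lintegral_pow_four_le hW hσ tail)

end SubGaussian

/-! ### Vectors -/

lemma l2Norm_sq {k : ℕ} (v : Fin k → ℝ) : l2Norm v ^ 2 = v ⬝ᵥ v := by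
  rw [l2Norm, EuclideanSpace.norm_sq_eq]
  simp [dotProduct, sq]

lemma l2Norm_nonneg {k : ℕ} (v : Fin k → ℝ) : 0 ≤ l2Norm v := norm_nonneg _

lemma l2Norm_smul {k : ℕ} (a : ℝ) (v : Fin k → ℝ) : l2Norm (a • v) = |a| * l2Norm v := by
  rw [l2Norm, WithLp.toLp_smul, norm_smul, Real.norm_eq_abs, l2Norm]

lemma l1Norm_smul {k : ℕ} (a : ℝ) (v : Fin k → ℝ) : l1Norm (a • v) = |a| * l1Norm v := by
  simp [l1Norm, abs_mul, Finset.mul_sum]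

lemma l1Norm_nonneg {k : ℕ} (v : Fin k → ℝ) : 0 ≤ l1Norm v :=
  Finset.sum_nonneg fun _ _ => abs_nonneg _

lemma continuous_l2Norm {k : ℕ} : Continuous (l2Norm : (Fin k → ℝ) → ℝ) := by
  unfold l2Norm
  exact continuous_norm.comp (PiLp.continuous_toLp 2 _)

lemma l2Norm_eq_zero {k : ℕ} {v : Fin k → ℝ} : l2Norm v = 0 ↔ v = 0 := by
  simp [l2Norm]

lemma measurable_aug {p : ℕ} : Measurable (aug : (Fin p → ℝ) → Fin (p + 1) → ℝ) := by
  refine measurable_pi_lambda _ fun j => ?_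
  refine Fin.cases ?_ (fun i => ?_) j
  · simp only [aug, Fin.cons_zero]; exact measurable_const
  · simp only [aug, Fin.cons_succ]; exact measurable_pi_apply i

lemma measurable_aug_dot {p : ℕ} (v : Fin (p + 1) → ℝ) :
    Measurable fun x : Fin p → ℝ => aug x ⬝ᵥ v := by
  unfold dotProduct
  exact Finset.measurable_sum _ fun j _ =>
    ((measurable_pi_apply j).comp measurable_aug).mul_const _

lemma measurable_margin {p : ℕ} (β : Fin (p + 1) → ℝ) : Measurable (margin β) := by
  unfold margin
  exact measurable_snd.mul ((measurable_aug_dot β).comp measurable_fst)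

/-! ### The second moment matrix -/

/-- A symmetric matrix whose spectrum is bounded above bounds its quadratic form. -/
lemma dotProduct_mulVec_le_of_spectrum {m : ℕ} {A : Matrix (Fin m) (Fin m) ℝ} (hA : A.IsHermitian)
    {b : ℝ} (h : ∀ x ∈ spectrum ℝ A, x ≤ b) (v : Fin m → ℝ) : v ⬝ᵥ A *ᵥ v ≤ b * (v ⬝ᵥ v) := by
  have hp : (algebraMap ℝ (Matrix (Fin m) (Fin m) ℝ) b - A).PosSemidef := by
    rw [Matrix.posSemidef_iff_isHermitian_and_spectrum_nonneg]
    refine ⟨?_, ?_⟩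
    · refine Matrix.IsHermitian.sub ?_ hA
      rw [Algebra.algebraMap_eq_smul_one]
      simp [Matrix.IsHermitian]
    · rw [← spectrum.singleton_sub_eq]
      rintro _ ⟨x, hx, y, hy, rfl⟩
      rw [mem_singleton_iff.1 hx]
      exact sub_nonneg.2 (h y hy)
  have := hp.dotProduct_mulVec_nonneg v
  rw [Matrix.sub_mulVec, dotProduct_sub, Algebra.algebraMap_eq_smul_one, Matrix.smul_mulVec,
    Matrix.one_mulVec, dotProduct_smul, smul_eq_mul] at this
  simpa using this

lemma le_dotProduct_mulVec_of_spectrum {m : ℕ} {A : Matrix (Fin m) (Fin m) ℝ} (hA : A.IsHermitian)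
    {b : ℝ} (h : ∀ x ∈ spectrum ℝ A, b ≤ x) (v : Fin m → ℝ) : b * (v ⬝ᵥ v) ≤ v ⬝ᵥ A *ᵥ v := by
  have := dotProduct_mulVec_le_of_spectrum (A := -A) hA.neg (b := -b) (fun x hx => ?_) v
  · rw [Matrix.neg_mulVec, dotProduct_neg] at this; linarith
  · rw [← spectrum.neg_eq] at hx
    have := h (-x) hx
    linarith

section Design

variable {p : ℕ} {P : Measure ((Fin p → ℝ) × ℝ)}

lemma secondMoment_isHermitian (P : Measure ((Fin p → ℝ) × ℝ)) : (secondMoment P).IsHermitian := by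
  ext j k
  simp [secondMoment, mul_comm]

/-- The quadratic form of a matrix of integrals of `x̃ⱼ x̃ₖ`. -/
lemma sum_sum_mul_eq_sq (x v : Fin (p + 1) → ℝ) :
    ∑ j, ∑ k, v j * v k * (x j * x k) = (x ⬝ᵥ v) ^ 2 := by
  rw [sq, dotProduct, Finset.sum_mul_sum]
  refine Finset.sum_congr rfl fun j _ => Finset.sum_congr rfl fun k _ => by ring

lemma dotProduct_secondMoment (hint : ∀ j k, Integrable (fun z => aug z.1 j * aug z.1 k) P)
    (v : Fin (p + 1) → ℝ) : v ⬝ᵥ secondMoment P *ᵥ v = ∫ z, (aug z.1 ⬝ᵥ v) ^ 2 ∂P := by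
  simp_rw [← sum_sum_mul_eq_sq]
  rw [integral_finsetSum _ fun j _ => integrable_finsetSum _ fun k _ => (hint j k).const_mul _]
  simp_rw [integral_finsetSum _ fun k (_ : k ∈ Finset.univ) => (hint _ k).const_mul _,
    integral_const_mul]
  simp only [dotProduct, Matrix.mulVec, secondMoment, Matrix.of_apply, Finset.mul_sum]
  refine Finset.sum_congr rfl fun j _ => Finset.sum_congr rfl fun k _ => by ring

lemma integral_aug_dot_sq_le {v₀ c₁ c₂ M : ℝ} (hd : DesignAssumption P v₀ c₁ c₂ M)
    (hint : ∀ j k, Integrable (fun z => aug z.1 j * aug z.1 k) P) (v : Fin (p + 1) → ℝ) :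
    ∫ z, (aug z.1 ⬝ᵥ v) ^ 2 ∂P ≤ c₂ * l2Norm v ^ 2 := by
  rw [← dotProduct_secondMoment hint, l2Norm_sq]
  exact dotProduct_mulVec_le_of_spectrum (secondMoment_isHermitian P)
    (fun x hx => (hd.eigenvalues hx).2) v

/-- Sub-Gaussian tails of all linear forms of the features: a linear form `v` of `x̃` is the linear
form `Σ^{1/2} v` of the whitened vector. -/
lemma subGaussian_aug_dot [IsProbabilityMeasure P] {v₀ c₁ c₂ M : ℝ} (hc₁ : 0 < c₁) (hv₀ : 0 < v₀)
    (hd : DesignAssumption P v₀ c₁ c₂ M)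
    (hint : ∀ j k, Integrable (fun z => aug z.1 j * aug z.1 k) P) (v : Fin (p + 1) → ℝ)
    (hv : v ≠ 0) (t : ℝ) (ht : 0 < t) :
    P.real {z | v₀ * √c₂ * l2Norm v * t ≤ |aug z.1 ⬝ᵥ v|} ≤ 2 * Real.exp (-t ^ 2 / 2) := by
  set S := secondMoment P with hS
  have hH : S.IsHermitian := secondMoment_isHermitian P
  have hpsd : S.PosSemidef := by
    rw [Matrix.posSemidef_iff_isHermitian_and_spectrum_nonneg]
    exact ⟨hH, fun x hx => hc₁.le.trans (hd.eigenvalues hx).1⟩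
  have hunit : IsUnit S := by
    by_contra hS0
    have : (0 : ℝ) ∈ spectrum ℝ S := by
      rw [spectrum.zero_mem_iff]; exact hS0
    exact absurd (hd.eigenvalues this).1 (not_le.2 hc₁)
  set T := CFC.sqrt S with hT
  have hTT : T * T = S := CFC.sqrt_mul_sqrt_self S (Matrix.nonneg_iff_posSemidef.2 hpsd)
  have hTpsd : T.PosSemidef := Matrix.nonneg_iff_posSemidef.1 (CFC.sqrt_nonneg S)
  have hTtr : Tᵀ = T := by simpa [Matrix.IsHermitian] using hTpsd.1
  have hTunit : IsUnit T.det := by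
    have h1 := (Matrix.isUnit_iff_isUnit_det S).1 hunit
    rw [← hTT, Matrix.det_mul] at h1
    exact isUnit_of_mul_isUnit_left h1
  have hdot : ∀ x : Fin p → ℝ, (T *ᵥ v) ⬝ᵥ whitened P x = aug x ⬝ᵥ v := by
    intro x
    rw [whitened, ← hS, ← hT, Matrix.dotProduct_mulVec, ← Matrix.mulVec_transpose,
      Matrix.mulVec_mulVec, Matrix.transpose_nonsing_inv, hTtr, Matrix.nonsing_inv_mul _ hTunit,
      Matrix.one_mulVec, dotProduct_comm]
  have hne : T *ᵥ v ≠ 0 := fun h0 => hv <| by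
    have : T⁻¹ *ᵥ (T *ᵥ v) = v := by
      rw [Matrix.mulVec_mulVec, Matrix.nonsing_inv_mul _ hTunit, Matrix.one_mulVec]
    rw [← this, h0, Matrix.mulVec_zero]
  have hnorm : l2Norm (T *ᵥ v) ≤ √c₂ * l2Norm v := by
    have h1 : l2Norm (T *ᵥ v) ^ 2 = v ⬝ᵥ S *ᵥ v := by
      rw [l2Norm_sq, Matrix.dotProduct_mulVec, ← Matrix.mulVec_transpose, hTtr,
        Matrix.mulVec_mulVec, hTT, dotProduct_comm]
    have h2 := integral_aug_dot_sq_le hd hint v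
    rw [← dotProduct_secondMoment hint, ← hS, ← h1] at h2
    calc l2Norm (T *ᵥ v) = √(l2Norm (T *ᵥ v) ^ 2) := (Real.sqrt_sq (l2Norm_nonneg _)).symm
      _ ≤ √(c₂ * l2Norm v ^ 2) := Real.sqrt_le_sqrt h2
      _ = √c₂ * l2Norm v := by
          rw [Real.sqrt_mul' _ (sq_nonneg _), Real.sqrt_sq (l2Norm_nonneg _)]
  refine le_trans (measureReal_mono ?_ (by finiteness)) (hd.subGaussian (T *ᵥ v) hne t ht)
  intro z hz
  simp only [mem_ofPred_eq, hdot] at hz ⊢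
  refine le_trans ?_ hz
  rw [mul_assoc v₀ (√c₂)]
  gcongr

end Design

/-! ### The smoothed hinge loss -/

/-- The mass that the kernel puts on `{t | u + h t ≤ 1}`; its negative is the slope of the smoothed
hinge loss at `u`. -/
noncomputable def smoothedStep (K : ℝ → ℝ) (h u : ℝ) : ℝ := ∫ t in {t | u + h * t ≤ 1}, K t

/-- The remainder of the hinge loss after linearization at `u`, with the slope `-1` chosen at the
kink. -/
noncomputable def hingeRem (u v : ℝ) : ℝ := hinge (u + v) - hinge u + (Iic (1 : ℝ)).indicator 1 u * v

lemma hinge_nonneg (u : ℝ) : 0 ≤ hinge u := le_max_right _ _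

lemma le_hinge (u : ℝ) : 1 - u ≤ hinge u := le_max_left _ _

lemma continuous_hinge : Continuous hinge := by unfold hinge; fun_prop

lemma abs_hinge_sub_le (u v : ℝ) : |hinge u - hinge v| ≤ |u - v| := by
  unfold hinge
  refine (abs_max_sub_max_le_abs _ _ _).trans (le_of_eq ?_)
  rw [← abs_neg]; congr 1; ring

lemma hinge_convex {a b : ℝ} (ha : 0 ≤ a) (hb : 0 ≤ b) (hab : a + b = 1) (u v : ℝ) :
    hinge (a * u + b * v) ≤ a * hinge u + b * hinge v := by
  have h1 := mul_le_mul_of_nonneg_left (le_hinge u) ha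
  have h2 := mul_le_mul_of_nonneg_left (le_hinge v) hb
  have h3 := mul_nonneg ha (hinge_nonneg u)
  have h4 := mul_nonneg hb (hinge_nonneg v)
  exact max_le (by nlinarith) (by linarith)

lemma hingeRem_nonneg (u v : ℝ) : 0 ≤ hingeRem u v := by
  unfold hingeRem hinge
  by_cases hu : u ≤ 1
  · rw [indicator_of_mem (mem_Iic.2 hu), Pi.one_apply, max_eq_left (by linarith : (0 : ℝ) ≤ 1 - u)]
    linarith [le_max_left (1 - (u + v)) 0]
  · rw [indicator_of_notMem (by simpa using hu), max_eq_right (by linarith : 1 - u ≤ (0 : ℝ))]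
    linarith [le_max_right (1 - (u + v)) 0]

lemma le_hingeRem_of_pos {u v : ℝ} (h1 : 1 - v / 2 ≤ u) (h2 : u ≤ 1) : v / 2 ≤ hingeRem u v := by
  unfold hingeRem
  rw [indicator_of_mem (mem_Iic.2 h2), Pi.one_apply, hinge, hinge,
    max_eq_left (by linarith : (0 : ℝ) ≤ 1 - u)]
  linarith [le_max_right (1 - (u + v)) 0]

lemma le_hingeRem_of_neg {u v : ℝ} (h1 : 1 < u) (h2 : u ≤ 1 - v / 2) : -v / 2 ≤ hingeRem u v := by
  unfold hingeRem
  rw [indicator_of_notMem (by simpa using h1), hinge, hinge,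
    max_eq_right (by linarith : 1 - u ≤ (0 : ℝ))]
  linarith [le_max_left (1 - (u + v)) 0]

section Kernel

variable {K : ℝ → ℝ} {κl κ₂ h : ℝ}

lemma KernelAssumption.integrable (hK : KernelAssumption K κl κ₂) : Integrable K :=
  integrable_of_integral_eq_one hK.integral_eq_one

lemma smoothedHinge_eq (hh : 0 < h) (u : ℝ) :
    smoothedHinge K h u = ∫ t, hinge (u + h * t) * K t := by
  unfold smoothedHinge scaledKernel
  have h1 := integral_sub_right_eq_self (μ := (volume : Measure ℝ))
    (fun t => hinge (u + t) * (h⁻¹ * K (t / h))) u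
  have h2 := Measure.integral_comp_div (fun t => hinge (u + h * t) * (h⁻¹ * K t)) h
  simp only [add_sub_cancel, mul_div_cancel₀ _ hh.ne'] at h1 h2
  rw [h1, h2, abs_of_pos hh, smul_eq_mul, ← integral_const_mul]
  refine integral_congr_ae (ae_of_all _ fun t => ?_)
  field_simp

lemma integrable_hinge_mul (hK : KernelAssumption K κl κ₂) (hh : 0 < h) (u : ℝ) :
    Integrable fun t => hinge (u + h * t) * K t := by
  refine Integrable.mono' (g := fun t => (1 + |u|) * K t + h * (|t| * K t))
    ((hK.integrable.const_mul _).add (hK.integrable_one.const_mul _)) ?_ (ae_of_all _ fun t => ?_)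
  · exact ((continuous_hinge.comp (by fun_prop)).mul hK.differentiable.continuous).aestronglyMeasurable
  · rw [Real.norm_eq_abs, abs_mul, abs_of_nonneg (hinge_nonneg _), abs_of_nonneg (hK.nonneg t)]
    have : hinge (u + h * t) ≤ 1 + |u| + h * |t| := by
      refine max_le ?_ (by positivity)
      have := neg_abs_le u
      have := mul_le_mul_of_nonneg_left (neg_abs_le t) hh.le
      linarith
    calc _ ≤ (1 + |u| + h * |t|) * K t := mul_le_mul_of_nonneg_right this (hK.nonneg t)
      _ = _ := by ring

lemma abs_smoothedHinge_sub_le (hK : KernelAssumption K κl κ₂) (hh : 0 < h) (u v : ℝ) :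
    |smoothedHinge K h u - smoothedHinge K h v| ≤ |u - v| := by
  rw [smoothedHinge_eq hh, smoothedHinge_eq hh,
    ← integral_sub (integrable_hinge_mul hK hh u) (integrable_hinge_mul hK hh v)]
  rw [← Real.norm_eq_abs]
  calc _ ≤ ∫ t, |u - v| * K t := by
        refine norm_integral_le_of_norm_le (hK.integrable.const_mul _) (ae_of_all _ fun t => ?_)
        rw [← sub_mul, Real.norm_eq_abs, abs_mul, abs_of_nonneg (hK.nonneg t)]
        refine mul_le_mul_of_nonneg_right ?_ (hK.nonneg t)
        simpa using abs_hinge_sub_le (u + h * t) (v + h * t)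
    _ = |u - v| := by rw [integral_const_mul, hK.integral_eq_one, mul_one]

lemma continuous_smoothedHinge (hK : KernelAssumption K κl κ₂) (hh : 0 < h) :
    Continuous (smoothedHinge K h) := by
  refine (LipschitzWith.of_dist_le_mul (K := 1) fun u v => ?_).continuous
  simpa [Real.dist_eq] using abs_smoothedHinge_sub_le hK hh u v

lemma smoothedHinge_convex (hK : KernelAssumption K κl κ₂) (hh : 0 < h) {a b : ℝ} (ha : 0 ≤ a)
    (hb : 0 ≤ b) (hab : a + b = 1) (u v : ℝ) :
    smoothedHinge K h (a * u + b * v) ≤ a * smoothedHinge K h u + b * smoothedHinge K h v := by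
  rw [smoothedHinge_eq hh, smoothedHinge_eq hh, smoothedHinge_eq hh, ← integral_const_mul,
    ← integral_const_mul, ← integral_add ((integrable_hinge_mul hK hh u).const_mul a)
      ((integrable_hinge_mul hK hh v).const_mul b)]
  refine integral_mono (integrable_hinge_mul hK hh _)
    (((integrable_hinge_mul hK hh u).const_mul a).add
      ((integrable_hinge_mul hK hh v).const_mul b)) fun t => ?_
  have h1 : a * u + b * v + h * t = a * (u + h * t) + b * (v + h * t) := by
    linear_combination (-(h * t)) * hab
  have h2 := mul_le_mul_of_nonneg_right (hinge_convex ha hb hab (u + h * t) (v + h * t))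
    (hK.nonneg t)
  simp only [h1]
  linarith

lemma measurableSet_step (u : ℝ) : MeasurableSet {t : ℝ | u + h * t ≤ 1} :=
  measurableSet_le (by fun_prop) measurable_const

lemma smoothedStep_nonneg (hK : KernelAssumption K κl κ₂) (u : ℝ) : 0 ≤ smoothedStep K h u :=
  integral_nonneg fun t => hK.nonneg t

lemma smoothedStep_le_one (hK : KernelAssumption K κl κ₂) (u : ℝ) : smoothedStep K h u ≤ 1 := by
  rw [← hK.integral_eq_one]
  exact setIntegral_le_integral hK.integrable (ae_of_all _ hK.nonneg)

lemma measurable_smoothedStep (hK : KernelAssumption K κl κ₂) : Measurable (smoothedStep K h) := by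
  refine Antitone.measurable fun u v huv => ?_
  refine setIntegral_mono_set hK.integrable.integrableOn (ae_of_all _ hK.nonneg)
    (ae_of_all _ fun t (ht : v + h * t ≤ 1) => ?_)
  exact show u + h * t ≤ 1 by linarith

lemma smoothedStep_eq (u : ℝ) :
    smoothedStep K h u = ∫ t, (Iic (1 : ℝ)).indicator 1 (u + h * t) * K t := by
  rw [smoothedStep, ← integral_indicator (measurableSet_step u)]
  refine integral_congr_ae (ae_of_all _ fun t => ?_)
  by_cases ht : u + h * t ≤ 1 <;> simp [indicator, ht]

lemma integrable_step_mul (hK : KernelAssumption K κl κ₂) (u : ℝ) :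
    Integrable fun t => (Iic (1 : ℝ)).indicator (1 : ℝ → ℝ) (u + h * t) * K t := by
  have : (fun t => (Iic (1 : ℝ)).indicator (1 : ℝ → ℝ) (u + h * t) * K t) =
      {t | u + h * t ≤ 1}.indicator K := by
    ext t
    by_cases ht : u + h * t ≤ 1 <;> simp [indicator, ht]
  rw [this]
  exact hK.integrable.indicator (measurableSet_step u)

/-- The linearization error of the smoothed hinge loss is the kernel average of that of the
hinge loss. -/
lemma smoothedHinge_rem_eq (hK : KernelAssumption K κl κ₂) (hh : 0 < h) (u v : ℝ) :
    Integrable (fun t => hingeRem (u + h * t) v * K t) ∧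
    smoothedHinge K h (u + v) - smoothedHinge K h u + smoothedStep K h u * v =
      ∫ t, hingeRem (u + h * t) v * K t := by
  have h1 := integrable_hinge_mul hK hh (u + v)
  have h2 := integrable_hinge_mul hK hh u
  have h3 := (integrable_step_mul (h := h) hK u).mul_const v
  have he : (fun t => hingeRem (u + h * t) v * K t) = fun t =>
      (hinge (u + v + h * t) * K t - hinge (u + h * t) * K t) +
        (Iic (1 : ℝ)).indicator 1 (u + h * t) * K t * v := by
    ext t
    rw [hingeRem, add_right_comm u (h * t) v]; ring
  rw [he]
  refine ⟨(h1.sub h2).add h3, ?_⟩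
  rw [integral_add (by exact h1.sub h2) h3, integral_sub h1 h2, integral_mul_const, ← smoothedHinge_eq hh,
    ← smoothedHinge_eq hh, ← smoothedStep_eq]

lemma smoothedHinge_rem_nonneg (hK : KernelAssumption K κl κ₂) (hh : 0 < h) (u v : ℝ) :
    0 ≤ smoothedHinge K h (u + v) - smoothedHinge K h u + smoothedStep K h u * v := by
  rw [(smoothedHinge_rem_eq hK hh u v).2]
  exact integral_nonneg fun t => mul_nonneg (hingeRem_nonneg _ _) (hK.nonneg t)

/-- Local strong convexity: near the kink, the kernel sees the curvature of the hinge loss. -/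
lemma smoothedHinge_rem_ge (hK : KernelAssumption K κl κ₂) (hκl : 0 < κl) (hh : 0 < h) {u v : ℝ}
    (hu : |1 - u| ≤ h / 2) (hv : |v| ≤ h / 2) :
    κl * v ^ 2 / (4 * h) ≤
      smoothedHinge K h (u + v) - smoothedHinge K h u + smoothedStep K h u * v := by
  obtain ⟨hint, heq⟩ := smoothedHinge_rem_eq hK hh u v
  rw [heq]
  obtain ⟨hu1, hu2⟩ := abs_le.1 hu
  -- an interval of length `|v| / (2 h)` on which the error is at least `|v| / 2`
  obtain ⟨I, hI, hvol, hmem⟩ : ∃ I : Set ℝ, MeasurableSet I ∧ volume.real I = |v| / (2 * h) ∧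
      ∀ t ∈ I, |t| ≤ 1 ∧ |v| / 2 ≤ hingeRem (u + h * t) v := by
    rcases le_total 0 v with hv0 | hv0
    · rw [abs_of_nonneg hv0] at hv ⊢
      refine ⟨Icc ((1 - v / 2 - u) / h) ((1 - u) / h), measurableSet_Icc, ?_, fun t ht => ?_⟩
      · rw [Real.volume_real_Icc_of_le (by gcongr; linarith)]
        field_simp; ring
      · have h1 := (div_le_iff₀ hh).1 ht.1
        have h2 := (le_div_iff₀ hh).1 ht.2
        refine ⟨abs_le.2 ⟨?_, ?_⟩, le_hingeRem_of_pos (by linarith) (by linarith)⟩ <;> nlinarith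
    · rw [abs_of_nonpos hv0] at hv ⊢
      refine ⟨Ioc ((1 - u) / h) ((1 - u - v / 2) / h), measurableSet_Ioc, ?_, fun t ht => ?_⟩
      · rw [Real.volume_real_Ioc_of_le (div_le_div_of_nonneg_right (by linarith) hh.le)]
        field_simp; ring
      · have h1 := (div_lt_iff₀ hh).1 ht.1
        have h2 := (le_div_iff₀ hh).1 ht.2
        refine ⟨abs_le.2 ⟨?_, ?_⟩, le_hingeRem_of_neg (by linarith) (by linarith)⟩ <;> nlinarith
  have hfin : volume I ≠ ⊤ := by
    refine ne_top_of_le_ne_top ?_ (measure_mono (t := Icc (-1 : ℝ) 1) fun t ht => ?_)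
    · simp
    · exact abs_le.1 (hmem t ht).1
  calc κl * v ^ 2 / (4 * h) = ∫ _t in I, |v| / 2 * κl := by
        rw [setIntegral_const, hvol, smul_eq_mul, ← sq_abs v]; field_simp; ring
    _ ≤ ∫ t in I, hingeRem (u + h * t) v * K t := by
        refine setIntegral_mono_on (integrableOn_const hfin) hint.integrableOn hI fun t ht => ?_
        exact mul_le_mul (hmem t ht).2 (hK.lower t (hmem t ht).1) hκl.le (hingeRem_nonneg _ _)
    _ ≤ ∫ t, hingeRem (u + h * t) v * K t :=
        setIntegral_le_integral hint (ae_of_all _ fun t =>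
          mul_nonneg (hingeRem_nonneg _ _) (hK.nonneg t))

end Kernel

/-! ### Expansion of integrals over half-spaces in their level -/

lemma abs_intervalIntegral_sub_le {φ : ℝ → ℝ} {L : ℝ} (hφ : Differentiable ℝ φ)
    (hL : ∀ x, |deriv φ x| ≤ L) (u w : ℝ) :
    |(∫ x in u..w, φ x) - (w - u) * φ u| ≤ L * (w - u) ^ 2 := by
  have h1 : (∫ x in u..w, φ x) - (w - u) * φ u = ∫ x in u..w, (φ x - φ u) := by
    rw [intervalIntegral.integral_sub (hφ.continuous.intervalIntegrable _ _) (by simp)]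
    simp
  have h2 : ∀ x ∈ uIoc u w, ‖φ x - φ u‖ ≤ L * |w - u| := by
    intro x hx
    have h3 := Convex.norm_image_sub_le_of_norm_deriv_le (f := φ) (s := univ) (x := u) (y := x)
      (fun z _ => hφ z) (fun z _ => hL z) convex_univ (mem_univ _) (mem_univ _)
    refine h3.trans (mul_le_mul_of_nonneg_left ?_ ((abs_nonneg _).trans (hL 0)))
    rw [Real.norm_eq_abs]
    have hx' : x ∈ uIcc u w := uIoc_subset_uIcc hx
    exact abs_sub_left_of_mem_uIcc hx'
  have h4 := intervalIntegral.norm_integral_le_of_norm_le_const h2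
  rw [h1, ← Real.norm_eq_abs]
  refine h4.trans (le_of_eq ?_)
  rw [mul_assoc, abs_mul_abs_self, sq]

/-- Second order expansion, in the level `r`, of an integral over a half-line. -/
lemma abs_integral_halfLine_sub_le {φ : ℝ → ℝ} {L : ℝ} (hφ : Differentiable ℝ φ)
    (hint : Integrable φ) (hL : ∀ x, |deriv φ x| ≤ L) {a : ℝ} (ha : a ≠ 0) (q r : ℝ) :
    |(∫ x in {x | a * x + q ≤ r}, φ x) - (∫ x in {x | a * x + q ≤ 1}, φ x) -
      (r - 1) * (φ ((1 - q) / a) / |a|)| ≤ L / a ^ 2 * (r - 1) ^ 2 := by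
  wlog hpos : 0 < a generalizing a φ
  · have hneg : 0 < -a := by
      have := lt_of_le_of_ne (not_lt.1 hpos) ha
      linarith
    have hd : ∀ x, deriv (fun x => φ (-x)) x = -deriv φ (-x) := fun x => deriv_comp_neg φ x
    have := this (φ := fun x => φ (-x)) (hφ.comp differentiable_neg) hint.comp_neg
      (fun x => by rw [hd, abs_neg]; exact hL _) (neg_ne_zero.2 ha) hneg
    have hflip : ∀ s : ℝ, ∫ x in {x | -a * x + q ≤ s}, φ (-x) = ∫ x in {x | a * x + q ≤ s}, φ x := by
      intro s
      rw [← integral_indicator (measurableSet_le (by fun_prop) measurable_const),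
        ← integral_indicator (measurableSet_le (by fun_prop) measurable_const),
        ← integral_neg_eq_self ({x | a * x + q ≤ s}.indicator fun x => φ x)]
      refine integral_congr_ae (ae_of_all _ fun x => ?_)
      simp only [indicator, mem_ofPred_eq, mul_neg, neg_mul]
    rw [hflip, hflip, abs_neg, neg_sq, div_neg, neg_neg] at this
    exact this
  · have hset : ∀ s : ℝ, {x | a * x + q ≤ s} = Iic ((s - q) / a) := by
      intro s
      ext x
      simp only [mem_ofPred_eq, mem_Iic, le_div_iff₀ hpos]
      constructor <;> intro h <;> linarith
    rw [hset, hset, intervalIntegral.integral_Iic_sub_Iic hint.integrableOn hint.integrableOn,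
      abs_of_pos hpos]
    have := abs_intervalIntegral_sub_le hφ hL ((1 - q) / a) ((r - q) / a)
    have h1 : (r - q) / a - (1 - q) / a = (r - 1) / a := by ring
    rw [h1] at this
    convert this using 1
    · congr 2; ring
    · ring

/-! ### Fubini along the first feature -/

section Slices

variable {d : ℕ}

lemma measurable_cons : Measurable fun q : ℝ × (Fin d → ℝ) => (Fin.cons q.1 q.2 : Fin (d + 1) → ℝ) := by
  refine measurable_pi_lambda _ fun j => ?_
  refine Fin.cases ?_ (fun i => ?_) j
  · simp only [Fin.cons_zero]; exact measurable_fst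
  · simp only [Fin.cons_succ]; exact (measurable_pi_apply i).comp measurable_snd

lemma measurePreserving_cons : MeasurePreserving
    (fun q : ℝ × (Fin d → ℝ) => (Fin.cons q.1 q.2 : Fin (d + 1) → ℝ)) := by
  have := (volume_preserving_piFinSuccAbove (fun _ : Fin (d + 1) => ℝ) 0).symm
  convert this using 1
  ext q j
  simp [MeasurableEquiv.piFinSuccAbove, Fin.insertNthEquiv]

lemma integrable_comp_cons {F : (Fin (d + 1) → ℝ) → ℝ} (hF : Integrable F) :
    Integrable fun q : ℝ × (Fin d → ℝ) => F (Fin.cons q.1 q.2) :=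
  measurePreserving_cons.integrable_comp_of_integrable hF

lemma integral_cons {F : (Fin (d + 1) → ℝ) → ℝ} (hF : Integrable F) :
    ∫ x, F x = ∫ w : Fin d → ℝ, ∫ x : ℝ, F (Fin.cons x w) := by
  have h1 : ∫ q : ℝ × (Fin d → ℝ), F (Fin.cons q.1 q.2) = ∫ x, F x := by
    have := (volume_preserving_piFinSuccAbove (fun _ : Fin (d + 1) => ℝ) 0).symm.integral_comp'
      (g := F)
    rw [← this]
    refine integral_congr_ae (ae_of_all _ fun q => ?_)
    simp [MeasurableEquiv.piFinSuccAbove, Fin.insertNthEquiv]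
  rw [← h1]
  exact integral_prod_symm _ (integrable_comp_cons hF)

/-- The bounds on the conditional densities, multiplied by the marginal density. Where the marginal
density vanishes, so does `f`, and the bounds hold trivially. -/
lemma DensityAssumption.section_bounds {ν : Measure (Fin (d + 1) → ℝ)}
    {f : (Fin (d + 1) → ℝ) → ℝ} {Cf : ℝ} (hf : DensityAssumption ν f Cf) (hfi : Integrable f) :
    ∀ᵐ w : Fin d → ℝ, Differentiable ℝ (fun x : ℝ => f (Fin.cons x w)) ∧ 0 ≤ marginalDensity f w ∧
      ∀ x : ℝ, |f (Fin.cons x w)| ≤ Cf * marginalDensity f w ∧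
        |deriv (fun x : ℝ => f (Fin.cons x w)) x| ≤ Cf * marginalDensity f w ∧
        |x ^ 2 * f (Fin.cons x w)| ≤ Cf * marginalDensity f w ∧
        |x ^ 2 * deriv (fun x : ℝ => f (Fin.cons x w)) x| ≤ Cf * marginalDensity f w := by
  filter_upwards [hf.differentiable, hf.bounds, (integrable_comp_cons hfi).prod_left_ae]
    with w hdiff hbd hint
  have hm : 0 ≤ marginalDensity f w := integral_nonneg fun x => hf.nonneg _
  rcases hm.eq_or_lt with h0 | hpos
  · have hcont : Continuous fun x : ℝ => f (Fin.cons x w) :=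
      hf.continuous.comp (by fun_prop)
    have hz : (fun x : ℝ => f (Fin.cons x w)) = 0 := by
      refine (Continuous.ae_eq_iff_eq volume hcont continuous_zero).1 ?_
      exact (integral_eq_zero_iff_of_nonneg (fun x => hf.nonneg _) hint).1 h0.symm
    have hz' : ∀ x : ℝ, f (Fin.cons x w) = 0 := fun x => congrFun hz x
    refine ⟨by rw [hz]; exact differentiable_const 0, hm, fun x => ?_⟩
    rw [hz]
    simp [hz', ← h0, Pi.zero_def]
  · have heq : (fun x : ℝ => f (Fin.cons x w)) = fun x =>
        marginalDensity f w * condDensity f w x := by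
      ext x
      rw [condDensity, mul_div_cancel₀ _ hpos.ne']
    have heq' : ∀ x : ℝ, f (Fin.cons x w) = marginalDensity f w * condDensity f w x :=
      fun x => congrFun heq x
    refine ⟨by rw [heq]; exact (hdiff hpos).const_mul _, hm, fun x => ?_⟩
    obtain ⟨h1, h2, h3, -, h5⟩ := hbd hpos x
    have hder : deriv (fun x : ℝ => f (Fin.cons x w)) x =
        marginalDensity f w * deriv (condDensity f w) x := by
      rw [heq, deriv_const_mul _ (hdiff hpos x)]
    rw [hder, heq' x]
    refine ⟨?_, ?_, ?_, ?_⟩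
    · rw [abs_mul, abs_of_pos hpos, mul_comm]; gcongr
    · rw [abs_mul, abs_of_pos hpos, mul_comm]; gcongr
    · rw [mul_left_comm, abs_mul, abs_of_pos hpos, mul_comm]; gcongr
    · rw [mul_left_comm, abs_mul, abs_of_pos hpos, mul_comm]; gcongr

lemma aug_cons_dot (x : ℝ) (w : Fin d → ℝ) (β : Fin (d + 1 + 1) → ℝ) :
    aug (Fin.cons x w : Fin (d + 1) → ℝ) ⬝ᵥ β =
      β 1 * x + aug (Fin.cons 0 w : Fin (d + 1) → ℝ) ⬝ᵥ β := by
  simp only [dotProduct, aug, Fin.sum_univ_succ, Fin.cons_zero, Fin.cons_succ, zero_mul, zero_add,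
    Fin.succ_zero_eq_one]
  ring

lemma abs_quadratic_mul_le {A B C b x u T : ℝ} (hA : |A| ≤ b) (hB : |B| ≤ b) (hC : |C| ≤ b)
    (h0 : |u| ≤ T) (h2 : |x ^ 2 * u| ≤ T) : |(A * x ^ 2 + B * x + C) * u| ≤ 3 * b * T := by
  have hb : 0 ≤ b := (abs_nonneg _).trans hA
  have h1 : |x * u| ≤ T := by
    have : |x| ≤ (1 + x ^ 2) / 2 := by
      have := sq_nonneg (|x| - 1); rw [← sq_abs x]; nlinarith
    rw [abs_mul] at h2 ⊢
    rw [abs_of_nonneg (sq_nonneg x)] at h2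
    nlinarith [mul_le_mul_of_nonneg_right this (abs_nonneg u)]
  have e : (A * x ^ 2 + B * x + C) * u = A * (x ^ 2 * u) + B * (x * u) + C * u := by ring
  rw [e]
  have t1 : |A * (x ^ 2 * u)| ≤ b * T := by rw [abs_mul]; gcongr
  have t2 : |B * (x * u)| ≤ b * T := by rw [abs_mul]; gcongr
  have t3 : |C * u| ≤ b * T := by rw [abs_mul]; gcongr
  have := abs_add_le (A * (x ^ 2 * u) + B * (x * u)) (C * u)
  have := abs_add_le (A * (x ^ 2 * u)) (B * (x * u))
  linarith

/-- For a weight `Q` that is a quadratic polynomial in the first feature, the integral of `Q f` over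
a half-space whose normal has a nonzero first coefficient has a second order expansion in the level
of the half-space. Slicing along the first feature reduces this to integrals over half-lines. -/
lemma DensityAssumption.exists_expansion {ν : Measure (Fin (d + 1) → ℝ)}
    {f : (Fin (d + 1) → ℝ) → ℝ} {Cf : ℝ} (hf : DensityAssumption ν f Cf) (hfi : Integrable f)
    {β : Fin (d + 1 + 1) → ℝ} (hβ : β 1 ≠ 0) {y : ℝ} (hy : y = 1 ∨ y = -1)
    {Q : (Fin (d + 1) → ℝ) → ℝ} (hQm : Measurable Q) (hQ : Integrable fun x => Q x * f x)
    (A B C b : (Fin d → ℝ) → ℝ)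
    (hQe : ∀ x w, Q (Fin.cons x w) = A w * x ^ 2 + B w * x + C w)
    (hA : ∀ w, |A w| ≤ b w) (hB : ∀ w, |B w| ≤ b w) (hC : ∀ w, |C w| ≤ b w)
    (hb : Integrable fun x => b (Fin.tail x) * f x) :
    ∃ g : ℝ, ∀ r : ℝ, |(∫ x in {x | y * (aug x ⬝ᵥ β) ≤ r}, Q x * f x) -
      (∫ x in {x | y * (aug x ⬝ᵥ β) ≤ 1}, Q x * f x) - (r - 1) * g| ≤
      9 * Cf / β 1 ^ 2 * (∫ x, b (Fin.tail x) * f x) * (r - 1) ^ 2 := by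
  set a : ℝ := y * β 1 with ha
  have hy0 : y ≠ 0 := by rcases hy with h | h <;> rw [h] <;> norm_num
  have hy2 : y ^ 2 = 1 := by rcases hy with h | h <;> rw [h] <;> norm_num
  have ha0 : a ≠ 0 := mul_ne_zero hy0 hβ
  set q : (Fin d → ℝ) → ℝ := fun w => y * (aug (Fin.cons 0 w : Fin (d + 1) → ℝ) ⬝ᵥ β) with hq
  have hqm : Measurable q :=
    ((measurable_aug_dot β).comp (measurable_cons.comp (measurable_const.prodMk measurable_id))).const_mul y
  set m : (Fin d → ℝ) → ℝ := marginalDensity f with hm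
  set φ : (Fin d → ℝ) → ℝ → ℝ := fun w x => Q (Fin.cons x w) * f (Fin.cons x w) with hφ
  have hφe : ∀ w, φ w = fun x => (A w * x ^ 2 + B w * x + C w) * f (Fin.cons x w) := by
    intro w; ext x; simp only [hφ, hQe]
  -- the sections are differentiable and bounded together with their derivatives
  have hsec : ∀ᵐ w : Fin d → ℝ, Differentiable ℝ (φ w) ∧ (∀ x, |φ w x| ≤ 3 * b w * (Cf * m w)) ∧
      ∀ x, |deriv (φ w) x| ≤ 9 * Cf * (b w * m w) := by
    filter_upwards [hf.section_bounds hfi] with w hw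
    obtain ⟨hd, hm0, hbd⟩ := hw
    have hbw : 0 ≤ b w := (abs_nonneg _).trans (hA w)
    refine ⟨?_, fun x => ?_, fun x => ?_⟩
    · rw [hφe]; exact Differentiable.mul (by fun_prop) hd
    · rw [hφe]
      exact abs_quadratic_mul_le (hA w) (hB w) (hC w) (hbd x).1 (hbd x).2.2.1
    · have hder : deriv (φ w) x = (0 * x ^ 2 + 2 * A w * x + B w) * f (Fin.cons x w) +
          (A w * x ^ 2 + B w * x + C w) * deriv (fun x : ℝ => f (Fin.cons x w)) x := by
        rw [hφe]
        have hpoly : HasDerivAt (fun x : ℝ => A w * x ^ 2 + B w * x + C w)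
            (0 * x ^ 2 + 2 * A w * x + B w) x := by
          have := (((hasDerivAt_pow 2 x).const_mul (A w)).add
            ((hasDerivAt_id x).const_mul (B w))).add_const (C w)
          refine this.congr_deriv ?_
          push_cast; ring
        exact (hpoly.mul (hd x).hasDerivAt).deriv
      have h1 := abs_quadratic_mul_le (A := 0) (B := 2 * A w) (C := B w) (b := 2 * b w) (x := x)
        (u := f (Fin.cons x w)) (T := Cf * m w) (by simpa using hbw)
        (by rw [abs_mul, abs_two]; linarith [hA w]) (by linarith [hB w]) (hbd x).1 (hbd x).2.2.1
      have h2 := abs_quadratic_mul_le (hA w) (hB w) (hC w) (hbd x).2.1 (hbd x).2.2.2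
      rw [hder]
      refine (abs_add_le _ _).trans ?_
      linarith
  -- Fubini for the dominating function
  have hbm : Integrable fun w => b w * m w := by
    have := (integrable_comp_cons hb).integral_prod_right
    simp only [Fin.tail_cons, integral_const_mul] at this
    exact this
  have hbm' : ∫ x, b (Fin.tail x) * f x = ∫ w, b w * m w := by
    rw [integral_cons hb]
    simp only [Fin.tail_cons, integral_const_mul]
    rfl
  -- Fubini for the integrals over half-spaces
  have hS : ∀ r : ℝ, MeasurableSet {x : Fin (d + 1) → ℝ | y * (aug x ⬝ᵥ β) ≤ r} := fun r =>
    measurableSet_le ((measurable_aug_dot β).const_mul y) measurable_const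
  have hSs : ∀ (r : ℝ) (w : Fin d → ℝ), (∫ x : ℝ, {x : Fin (d + 1) → ℝ | y * (aug x ⬝ᵥ β) ≤ r}.indicator
      (fun x => Q x * f x) (Fin.cons x w)) = ∫ x in {x : ℝ | a * x + q w ≤ r}, φ w x := by
    intro r w
    rw [← integral_indicator (measurableSet_le (by fun_prop) measurable_const)]
    refine integral_congr_ae (ae_of_all _ fun x => ?_)
    have : y * (aug (Fin.cons x w : Fin (d + 1) → ℝ) ⬝ᵥ β) = a * x + q w := by
      rw [aug_cons_dot, ha, hq]; ring
    simp only [indicator, mem_ofPred_eq, this, hφ]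
  have hint : ∀ r : ℝ, Integrable
      ({x : Fin (d + 1) → ℝ | y * (aug x ⬝ᵥ β) ≤ r}.indicator fun x => Q x * f x) := fun r =>
    hQ.indicator (hS r)
  have hfub : ∀ r : ℝ, (∫ x in {x | y * (aug x ⬝ᵥ β) ≤ r}, Q x * f x) =
      ∫ w, ∫ x in {x : ℝ | a * x + q w ≤ r}, φ w x := by
    intro r
    rw [← integral_indicator (hS r), integral_cons (hint r)]
    simp only [hSs]
  have hfubi : ∀ r : ℝ, Integrable fun w => ∫ x in {x : ℝ | a * x + q w ≤ r}, φ w x := by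
    intro r
    have := (integrable_comp_cons (hint r)).integral_prod_right
    simpa only [hSs] using this
  have hgi : Integrable fun w => φ w ((1 - q w) / a) / |a| := by
    refine Integrable.mono' (hbm.const_mul (3 * Cf / |a|)) ?_ ?_
    · have h1 : Measurable fun w : Fin d → ℝ => (Fin.cons ((1 - q w) / a) w : Fin (d + 1) → ℝ) :=
        measurable_cons.comp (((measurable_const.sub hqm).div_const a).prodMk measurable_id)
      exact (((hQm.comp h1).mul (hf.continuous.measurable.comp h1)).div_const _).aestronglyMeasurable
    · filter_upwards [hsec] with w hw
      rw [Real.norm_eq_abs, abs_div, abs_abs]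
      refine (div_le_div_of_nonneg_right (hw.2.1 ((1 - q w) / a)) (abs_nonneg a)).trans (le_of_eq ?_)
      ring
  refine ⟨∫ w, φ w ((1 - q w) / a) / |a|, fun r => ?_⟩
  rw [hfub, hfub, ← integral_const_mul, ← integral_sub (hfubi r) (hfubi 1),
    ← integral_sub (by exact (hfubi r).sub (hfubi 1)) (hgi.const_mul _), ← Real.norm_eq_abs]
  have ha2 : a ^ 2 = β 1 ^ 2 := by rw [ha, mul_pow, hy2, one_mul]
  calc _ ≤ ∫ w, 9 * Cf / β 1 ^ 2 * (r - 1) ^ 2 * (b w * m w) := by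
        refine norm_integral_le_of_norm_le (hbm.const_mul _) ?_
        have hφi : ∀ᵐ w : Fin d → ℝ, Integrable (φ w) := (integrable_comp_cons hQ).prod_left_ae
        filter_upwards [hsec, hφi] with w hw hwi
        have := abs_integral_halfLine_sub_le hw.1 hwi hw.2.2 ha0 (q w) r
        rw [Real.norm_eq_abs]
        refine this.trans (le_of_eq ?_)
        rw [ha2]; ring
    _ = _ := by rw [integral_const_mul, hbm']; ring

end Slices

/-! ### Integrals over the two classes -/

section Classes

variable {d : ℕ} {P : Measure ((Fin (d + 1) → ℝ) × ℝ)}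

lemma measurableSet_label {p : ℕ} (y : ℝ) : MeasurableSet {z : (Fin p → ℝ) × ℝ | z.2 = y} :=
  measurable_snd (measurableSet_singleton y)

lemma integrable_of_density {ν : Measure (Fin (d + 1) → ℝ)} [IsFiniteMeasure ν]
    {f : (Fin (d + 1) → ℝ) → ℝ} {Cf : ℝ} (hf : DensityAssumption ν f Cf) : Integrable f := by
  refine ⟨hf.continuous.aestronglyMeasurable, ?_⟩
  rw [hasFiniteIntegral_iff_ofReal (ae_of_all _ hf.nonneg)]
  have h1 : ν univ < ⊤ := measure_lt_top ν univ
  rw [hf.law, withDensity_apply _ MeasurableSet.univ, Measure.restrict_univ] at h1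
  exact h1

lemma integral_classLaw {y : ℝ} {f : (Fin (d + 1) → ℝ) → ℝ} {Cf : ℝ}
    (hf : DensityAssumption (classLaw P y) f Cf) (G : (Fin (d + 1) → ℝ) → ℝ) :
    ∫ x, G x ∂classLaw P y = ∫ x, G x * f x := by
  rw [hf.law, integral_withDensity_eq_integral_toReal_smul
    hf.continuous.measurable.ennreal_ofReal (ae_of_all _ fun _ => ENNReal.ofReal_lt_top)]
  refine integral_congr_ae (ae_of_all _ fun x => ?_)
  simp [ENNReal.toReal_ofReal (hf.nonneg x), mul_comm]

lemma integrable_classLaw {y : ℝ} {f : (Fin (d + 1) → ℝ) → ℝ} {Cf : ℝ}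
    (hf : DensityAssumption (classLaw P y) f Cf) {G : (Fin (d + 1) → ℝ) → ℝ}
    (hG : Integrable fun x => G x * f x) : Integrable G (classLaw P y) := by
  rw [hf.law, integrable_withDensity_iff hf.continuous.measurable.ennreal_ofReal
    (ae_of_all _ fun _ => ENNReal.ofReal_lt_top)]
  refine hG.congr (ae_of_all _ fun x => ?_)
  simp [ENNReal.toReal_ofReal (hf.nonneg x)]

lemma ae_cond_eq (y : ℝ) (F : (Fin (d + 1) → ℝ) × ℝ → ℝ) :
    (fun z => F (z.1, y)) =ᵐ[cond P {z | z.2 = y}] F := by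
  filter_upwards [ae_cond_mem (measurableSet_label y)] with z hz
  have hz : z.2 = y := hz
  rw [← hz]

variable [IsProbabilityMeasure P]

instance (y : ℝ) : IsFiniteMeasure (classLaw P y) := by
  refine ⟨?_⟩
  rw [classLaw, Measure.map_apply measurable_fst MeasurableSet.univ, preimage_univ]
  by_cases h : P {z | z.2 = y} = 0
  · rw [cond_eq_zero_of_meas_eq_zero h]; simp
  · have := cond_isProbabilityMeasure h
    simp

lemma restrict_eq_smul_cond (y : ℝ) (h : P {z | z.2 = y} ≠ 0) :
    P.restrict {z | z.2 = y} = P {z | z.2 = y} • cond P {z | z.2 = y} := by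
  rw [ProbabilityTheory.cond, smul_smul, ENNReal.mul_inv_cancel h (measure_ne_top _ _), one_smul]

lemma integrableOn_label {y : ℝ} {f : (Fin (d + 1) → ℝ) → ℝ} {Cf : ℝ}
    (hf : DensityAssumption (classLaw P y) f Cf) {F : (Fin (d + 1) → ℝ) × ℝ → ℝ}
    (hF : Measurable F) (hi : Integrable fun x => F (x, y) * f x) :
    IntegrableOn F {z | z.2 = y} P := by
  by_cases h : P {z | z.2 = y} = 0
  · rw [IntegrableOn, Measure.restrict_eq_zero.2 h]; exact integrable_zero_measure
  · rw [IntegrableOn, restrict_eq_smul_cond y h]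
    refine Integrable.smul_measure ?_ (measure_ne_top _ _)
    have h1 := integrable_classLaw hf (G := fun x => F (x, y)) hi
    have hFy : Measurable fun x => F (x, y) := hF.comp (by fun_prop)
    rw [classLaw, integrable_map_measure hFy.aestronglyMeasurable (by fun_prop)] at h1
    exact h1.congr (ae_cond_eq y F)

lemma setIntegral_label {y : ℝ} {f : (Fin (d + 1) → ℝ) → ℝ} {Cf : ℝ}
    (hf : DensityAssumption (classLaw P y) f Cf) {F : (Fin (d + 1) → ℝ) × ℝ → ℝ}
    (hF : Measurable F) :
    ∫ z in {z | z.2 = y}, F z ∂P = P.real {z | z.2 = y} * ∫ x, F (x, y) * f x := by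
  by_cases h : P {z | z.2 = y} = 0
  · rw [Measure.restrict_eq_zero.2 h]; simp [Measure.real, h]
  · have hFy : Measurable fun x => F (x, y) := hF.comp (by fun_prop)
    rw [restrict_eq_smul_cond y h, integral_smul_measure, smul_eq_mul, Measure.real,
      ← integral_classLaw hf, classLaw, integral_map (by fun_prop) hFy.aestronglyMeasurable,
      integral_congr_ae (ae_cond_eq y F)]

variable {f g : (Fin (d + 1) → ℝ) → ℝ} {Cf : ℝ}

lemma integrable_of_classes (hy : ∀ᵐ z ∂P, z.2 = 1 ∨ z.2 = -1)
    (hf : DensityAssumption (classLaw P 1) f Cf) (hg : DensityAssumption (classLaw P (-1)) g Cf)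
    {F : (Fin (d + 1) → ℝ) × ℝ → ℝ} (hF : Measurable F)
    (h1 : Integrable fun x => F (x, 1) * f x) (h2 : Integrable fun x => F (x, -1) * g x) :
    Integrable F P := by
  have h := (integrableOn_label hf hF h1).union (integrableOn_label hg hF h2)
  rwa [IntegrableOn, Measure.restrict_eq_self_of_ae_mem] at h
  exact hy

lemma integral_eq_classes (hy : ∀ᵐ z ∂P, z.2 = 1 ∨ z.2 = -1)
    (hf : DensityAssumption (classLaw P 1) f Cf) (hg : DensityAssumption (classLaw P (-1)) g Cf)
    {F : (Fin (d + 1) → ℝ) × ℝ → ℝ} (hF : Measurable F) (hi : Integrable F P) :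
    ∫ z, F z ∂P = P.real {z | z.2 = 1} * (∫ x, F (x, 1) * f x) +
      P.real {z | z.2 = -1} * (∫ x, F (x, -1) * g x) := by
  have hd : Disjoint {z : (Fin (d + 1) → ℝ) × ℝ | z.2 = 1} {z | z.2 = -1} := by
    rw [Set.disjoint_left]
    intro z (hz : z.2 = 1) (hz' : z.2 = -1)
    rw [hz] at hz'; norm_num at hz'
  rw [← setIntegral_label hf hF, ← setIntegral_label hg hF,
    ← setIntegral_union hd (measurableSet_label _) hi.integrableOn hi.integrableOn,
    Measure.restrict_eq_self_of_ae_mem]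
  exact hy

lemma integrable_aug_sq_mul {ν : Measure (Fin (d + 1) → ℝ)} [IsFiniteMeasure ν]
    (hf : DensityAssumption ν f Cf) (j : Fin (d + 1 + 1)) :
    Integrable fun x => aug x j ^ 2 * f x := by
  refine Fin.cases ?_ (fun i => ?_) j
  · simpa [aug] using integrable_of_density hf
  · simpa [aug] using hf.second_moment i

lemma integrable_aug_mul_mul {ν : Measure (Fin (d + 1) → ℝ)} [IsFiniteMeasure ν]
    (hf : DensityAssumption ν f Cf) (j k : Fin (d + 1 + 1)) :
    Integrable fun x => aug x j * aug x k * f x := by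
  refine Integrable.mono' ((integrable_aug_sq_mul hf j).add (integrable_aug_sq_mul hf k)) ?_
    (ae_of_all _ fun x => ?_)
  · exact ((((measurable_pi_apply j).comp measurable_aug).mul
      ((measurable_pi_apply k).comp measurable_aug)).mul
      hf.continuous.measurable).aestronglyMeasurable
  · rw [Real.norm_eq_abs, abs_mul, abs_of_nonneg (hf.nonneg x), Pi.add_apply, ← add_mul]
    refine mul_le_mul_of_nonneg_right ?_ (hf.nonneg x)
    rw [abs_mul, ← sq_abs (aug x j), ← sq_abs (aug x k)]
    nlinarith [sq_nonneg (|aug x j| - |aug x k|), sq_nonneg (|aug x j|), sq_nonneg (|aug x k|)]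

lemma integrable_dot_sq_mul {ν : Measure (Fin (d + 1) → ℝ)} [IsFiniteMeasure ν]
    (hf : DensityAssumption ν f Cf) (v : Fin (d + 1 + 1) → ℝ) :
    Integrable fun x => (aug x ⬝ᵥ v) ^ 2 * f x := by
  simp_rw [← sum_sum_mul_eq_sq, Finset.sum_mul, mul_assoc (_ * _) (_ * _) (f _)]
  exact integrable_finsetSum _ fun j _ => integrable_finsetSum _ fun k _ =>
    (integrable_aug_mul_mul hf j k).const_mul _

lemma integrable_dot_mul {ν : Measure (Fin (d + 1) → ℝ)} [IsFiniteMeasure ν]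
    (hf : DensityAssumption ν f Cf) (v : Fin (d + 1 + 1) → ℝ) :
    Integrable fun x => (aug x ⬝ᵥ v) * f x := by
  have := fun j => integrable_aug_mul_mul hf j 0
  simp only [aug, Fin.cons_zero, mul_one] at this
  simp only [dotProduct, Finset.sum_mul]
  refine integrable_finsetSum _ fun j _ => ?_
  exact ((this j).const_mul (v j)).congr (ae_of_all _ fun x => by simp only [aug]; ring)

end Classes

/-! ### The population -/

/-- The distributional assumptions, with positive constants. -/
structure Model {d : ℕ} (P : Measure ((Fin (d + 1) → ℝ) × ℝ)) (f g : (Fin (d + 1) → ℝ) → ℝ)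
    (β : Fin (d + 1 + 1) → ℝ) (v₀ c₁ c₂ M Cf c C a₁ a₂ : ℝ) : Prop where
  c₁_pos : 0 < c₁
  c₂_pos : 0 < c₂
  c_pos : 0 < c
  Cf_pos : 0 < Cf
  v₀_pos : 0 < v₀
  a₁_pos : 0 < a₁
  label : ∀ᵐ z ∂P, z.2 = 1 ∨ z.2 = -1
  risk : IsRiskMinimizer P β
  density_pos : DensityAssumption (classLaw P 1) f Cf
  density_neg : DensityAssumption (classLaw P (-1)) g Cf
  design : DesignAssumption P v₀ c₁ c₂ M
  parameter : ParameterAssumption β c C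
  hessian : HessianAssumption P β a₁ a₂

namespace Model

variable {d : ℕ} {P : Measure ((Fin (d + 1) → ℝ) × ℝ)}
  {f g : (Fin (d + 1) → ℝ) → ℝ} {β : Fin (d + 1 + 1) → ℝ} {v₀ c₁ c₂ M Cf c C a₁ a₂ : ℝ}

lemma measurable_dot (v : Fin (d + 1 + 1) → ℝ) :
    Measurable fun z : (Fin (d + 1) → ℝ) × ℝ => aug z.1 ⬝ᵥ v :=
  (measurable_aug_dot v).comp measurable_fst

lemma first_coeff_ne_zero (H : Model P f g β v₀ c₁ c₂ M Cf c C a₁ a₂) : β 1 ≠ 0 := fun h0 => by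
  have := H.parameter.first_coeff
  rw [h0, abs_zero] at this
  linarith [H.c_pos]

variable [IsProbabilityMeasure P]

lemma integrable_aug_mul (H : Model P f g β v₀ c₁ c₂ M Cf c C a₁ a₂) (j k : Fin (d + 1 + 1)) :
    Integrable (fun z => aug z.1 j * aug z.1 k) P := by
  refine integrable_of_classes H.label H.density_pos H.density_neg ?_
    (integrable_aug_mul_mul H.density_pos j k) (integrable_aug_mul_mul H.density_neg j k)
  exact ((measurable_pi_apply j).comp (measurable_aug.comp measurable_fst)).mul
    ((measurable_pi_apply k).comp (measurable_aug.comp measurable_fst))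

lemma integrable_dot_sq (H : Model P f g β v₀ c₁ c₂ M Cf c C a₁ a₂) (v : Fin (d + 1 + 1) → ℝ) :
    Integrable (fun z => (aug z.1 ⬝ᵥ v) ^ 2) P :=
  integrable_of_classes H.label H.density_pos H.density_neg ((measurable_dot v).pow_const 2)
    (integrable_dot_sq_mul H.density_pos v) (integrable_dot_sq_mul H.density_neg v)

lemma integrable_dot (H : Model P f g β v₀ c₁ c₂ M Cf c C a₁ a₂) (v : Fin (d + 1 + 1) → ℝ) :
    Integrable (fun z => aug z.1 ⬝ᵥ v) P :=
  integrable_of_classes H.label H.density_pos H.density_neg (measurable_dot v)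
    (integrable_dot_mul H.density_pos v) (integrable_dot_mul H.density_neg v)

lemma integrable_label_dot (H : Model P f g β v₀ c₁ c₂ M Cf c C a₁ a₂) (v : Fin (d + 1 + 1) → ℝ) :
    Integrable (fun z => z.2 * (aug z.1 ⬝ᵥ v)) P := by
  refine (H.integrable_dot v).mono (measurable_margin v).aestronglyMeasurable ?_
  filter_upwards [H.label] with z hz
  rcases hz with h | h <;> simp [h]

lemma integral_dot_sq_le (H : Model P f g β v₀ c₁ c₂ M Cf c C a₁ a₂) (v : Fin (d + 1 + 1) → ℝ) :
    ∫ z, (aug z.1 ⬝ᵥ v) ^ 2 ∂P ≤ c₂ * l2Norm v ^ 2 :=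
  integral_aug_dot_sq_le H.design H.integrable_aug_mul v

lemma update_dot (x : Fin (d + 1) → ℝ) (v : Fin (d + 1 + 1) → ℝ) :
    aug (Fin.cons 0 (Fin.tail x) : Fin (d + 1) → ℝ) ⬝ᵥ v = aug x ⬝ᵥ Function.update v 1 0 := by
  simp only [dotProduct, aug, Fin.sum_univ_succ, Fin.cons_zero, Fin.cons_succ, Fin.tail]
  simp [Fin.ext_iff]

lemma l2Norm_update_le (v : Fin (d + 1 + 1) → ℝ) : l2Norm (Function.update v 1 0) ^ 2 ≤ l2Norm v ^ 2 := by
  rw [l2Norm_sq, l2Norm_sq, dotProduct, dotProduct]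
  refine Finset.sum_le_sum fun j _ => ?_
  by_cases hj : j = 1
  · subst hj; simp; exact mul_self_nonneg _
  · simp [hj]

/-- Expansion, in the level of the margin, of the integral of a weight which is, in each class, a
quadratic polynomial in the first feature whose coefficients are controlled by the other
features. -/
lemma exists_expansion (H : Model P f g β v₀ c₁ c₂ M Cf c C a₁ a₂) {v : Fin (d + 1 + 1) → ℝ}
    (hv : l2Norm v = 1) {W : (Fin (d + 1) → ℝ) × ℝ → ℝ} (hW : Measurable W) (hWi : Integrable W P)
    (hW1 : Integrable fun x => W (x, 1) * f x) (hW2 : Integrable fun x => W (x, -1) * g x)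
    (A B D : ℝ → (Fin d → ℝ) → ℝ)
    (hWe : ∀ y x w, W (Fin.cons x w, y) = A y w * x ^ 2 + B y w * x + D y w)
    (hb : ∀ y : ℝ, (y = 1 ∨ y = -1) → ∀ w,
      |A y w| ≤ 1 + (aug (Fin.cons 0 w : Fin (d + 1) → ℝ) ⬝ᵥ v) ^ 2 ∧
      |B y w| ≤ 1 + (aug (Fin.cons 0 w : Fin (d + 1) → ℝ) ⬝ᵥ v) ^ 2 ∧
      |D y w| ≤ 1 + (aug (Fin.cons 0 w : Fin (d + 1) → ℝ) ⬝ᵥ v) ^ 2) :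
    ∃ s : ℝ, ∀ r : ℝ, |(∫ z in {z | margin β z ≤ r}, W z ∂P) - (∫ z in {z | margin β z ≤ 1}, W z ∂P) -
      (r - 1) * s| ≤ 9 * Cf * (1 + c₂) / c ^ 2 * (r - 1) ^ 2 := by
  set u := Function.update v 1 0 with hu
  have hbi : ∀ {ν : Measure (Fin (d + 1) → ℝ)} [IsFiniteMeasure ν] {f : (Fin (d + 1) → ℝ) → ℝ}
      (_ : DensityAssumption ν f Cf), Integrable fun x =>
        (1 + (aug (Fin.cons 0 (Fin.tail x) : Fin (d + 1) → ℝ) ⬝ᵥ v) ^ 2) * f x := by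
    intro ν _ f hf
    simp_rw [update_dot, add_mul, one_mul]
    exact (integrable_of_density hf).add (integrable_dot_sq_mul hf _)
  obtain ⟨s1, hs1⟩ := H.density_pos.exists_expansion (integrable_of_density H.density_pos)
    H.first_coeff_ne_zero (Or.inl rfl) (Q := fun x => W (x, 1)) (hW.comp (by fun_prop)) hW1
    (A 1) (B 1) (D 1) (fun w => 1 + (aug (Fin.cons 0 w : Fin (d + 1) → ℝ) ⬝ᵥ v) ^ 2) (hWe 1)
    (fun w => (hb 1 (Or.inl rfl) w).1) (fun w => (hb 1 (Or.inl rfl) w).2.1)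
    (fun w => (hb 1 (Or.inl rfl) w).2.2) (hbi H.density_pos)
  obtain ⟨s2, hs2⟩ := H.density_neg.exists_expansion (integrable_of_density H.density_neg)
    H.first_coeff_ne_zero (Or.inr rfl) (Q := fun x => W (x, -1)) (hW.comp (by fun_prop)) hW2
    (A (-1)) (B (-1)) (D (-1)) (fun w => 1 + (aug (Fin.cons 0 w : Fin (d + 1) → ℝ) ⬝ᵥ v) ^ 2)
    (hWe (-1)) (fun w => (hb (-1) (Or.inr rfl) w).1) (fun w => (hb (-1) (Or.inr rfl) w).2.1)
    (fun w => (hb (-1) (Or.inr rfl) w).2.2) (hbi H.density_neg)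
  set p1 := P.real {z | z.2 = 1} with hp1
  set p2 := P.real {z | z.2 = -1} with hp2
  have hS : ∀ r : ℝ, MeasurableSet {z : (Fin (d + 1) → ℝ) × ℝ | margin β z ≤ r} := fun r =>
    measurableSet_le (measurable_margin β) measurable_const
  have hSx : ∀ y r : ℝ, MeasurableSet {x : Fin (d + 1) → ℝ | y * (aug x ⬝ᵥ β) ≤ r} := fun y r =>
    measurableSet_le ((measurable_aug_dot β).const_mul y) measurable_const
  have hsplit : ∀ r : ℝ, (∫ z in {z | margin β z ≤ r}, W z ∂P) =
      p1 * (∫ x in {x | 1 * (aug x ⬝ᵥ β) ≤ r}, W (x, 1) * f x) +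
      p2 * ∫ x in {x | -1 * (aug x ⬝ᵥ β) ≤ r}, W (x, -1) * g x := by
    intro r
    rw [← integral_indicator (hS r), integral_eq_classes H.label H.density_pos H.density_neg
      (hW.indicator (hS r)) (hWi.indicator (hS r)), ← integral_indicator (hSx 1 r),
      ← integral_indicator (hSx (-1) r)]
    congr 2
    · refine integral_congr_ae (ae_of_all _ fun x => ?_)
      by_cases hx : 1 * (aug x ⬝ᵥ β) ≤ r <;> simp only [indicator, mem_ofPred_eq, margin, hx] <;> simp
    · refine integral_congr_ae (ae_of_all _ fun x => ?_)
      by_cases hx : -1 * (aug x ⬝ᵥ β) ≤ r <;> simp only [indicator, mem_ofPred_eq, margin, hx] <;> simp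
  -- the total mass of the dominating functions
  have hmass : p1 * (∫ x, (1 + (aug (Fin.cons 0 (Fin.tail x) : Fin (d + 1) → ℝ) ⬝ᵥ v) ^ 2) * f x) +
      p2 * (∫ x, (1 + (aug (Fin.cons 0 (Fin.tail x) : Fin (d + 1) → ℝ) ⬝ᵥ v) ^ 2) * g x) ≤
      1 + c₂ := by
    have h1 := integral_eq_classes H.label H.density_pos H.density_neg
      (F := fun z => 1 + (aug z.1 ⬝ᵥ u) ^ 2) (((measurable_dot u).pow_const 2).const_add 1)
      ((integrable_const 1).add (H.integrable_dot_sq u))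
    simp_rw [update_dot, ← hu]
    rw [← h1, integral_add (integrable_const 1) (H.integrable_dot_sq u)]
    have h2 := H.integral_dot_sq_le u
    have h3 := l2Norm_update_le v
    rw [hv] at h3
    have h4 := mul_le_mul_of_nonneg_left h3 H.c₂_pos.le
    simp only [integral_const, probReal_univ, smul_eq_mul, mul_one]
    rw [← hu] at h4
    linarith
  refine ⟨p1 * s1 + p2 * s2, fun r => ?_⟩
  have e1 := mul_le_mul_of_nonneg_left (hs1 r) (measureReal_nonneg : 0 ≤ p1)
  have e2 := mul_le_mul_of_nonneg_left (hs2 r) (measureReal_nonneg : 0 ≤ p2)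
  rw [← abs_of_nonneg (measureReal_nonneg : 0 ≤ p1), ← abs_mul,
    abs_of_nonneg (measureReal_nonneg : 0 ≤ p1)] at e1
  rw [← abs_of_nonneg (measureReal_nonneg : 0 ≤ p2), ← abs_mul,
    abs_of_nonneg (measureReal_nonneg : 0 ≤ p2)] at e2
  rw [hsplit, hsplit]
  have hc2 : c ^ 2 ≤ β 1 ^ 2 := by
    rw [← sq_abs (β 1)]
    exact pow_le_pow_left₀ H.c_pos.le H.parameter.first_coeff 2
  have hCf : 9 * Cf / β 1 ^ 2 ≤ 9 * Cf / c ^ 2 := by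
    have := H.c_pos; have := H.Cf_pos
    gcongr
  have hCf0 : 0 ≤ 9 * Cf / β 1 ^ 2 := by have := H.Cf_pos; positivity
  have hc20 := H.c₂_pos
  calc _ ≤ _ := by
        refine le_trans (le_of_eq ?_) ((abs_add_le _ _).trans (add_le_add e1 e2))
        congr 1; ring
    _ = 9 * Cf / β 1 ^ 2 * (p1 * (∫ x, (1 + (aug (Fin.cons 0 (Fin.tail x) : Fin (d + 1) → ℝ) ⬝ᵥ v) ^ 2) * f x) +
      p2 * (∫ x, (1 + (aug (Fin.cons 0 (Fin.tail x) : Fin (d + 1) → ℝ) ⬝ᵥ v) ^ 2) * g x)) * (r - 1) ^ 2 := by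
        ring
    _ ≤ 9 * Cf / β 1 ^ 2 * (1 + c₂) * (r - 1) ^ 2 := by gcongr
    _ ≤ 9 * Cf / c ^ 2 * (1 + c₂) * (r - 1) ^ 2 := by gcongr
    _ = _ := by ring

end Model

/-! ### Curvature and optimality at the population level -/

lemma hasDerivAt_of_abs_sub_le_sq {F : ℝ → ℝ} {s L x : ℝ}
    (h : ∀ r, |F r - F x - (r - x) * s| ≤ L * (r - x) ^ 2) : HasDerivAt F s x := by
  rw [hasDerivAt_iff_isLittleO]
  refine Asymptotics.IsBigO.trans_isLittleO (g := fun r => ‖r - x‖ ^ 2) ?_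
    (Asymptotics.isLittleO_pow_sub_sub x one_lt_two)
  refine Asymptotics.IsBigO.of_bound L (Filter.Eventually.of_forall fun r => ?_)
  simpa using h r

lemma abs_apply_le_l2Norm {k : ℕ} (v : Fin k → ℝ) (j : Fin k) : |v j| ≤ l2Norm v := by
  have := PiLp.norm_apply_le (WithLp.toLp 2 v : EuclideanSpace ℝ (Fin k)) j
  simpa [l2Norm] using this

namespace Model

variable {d : ℕ} {P : Measure ((Fin (d + 1) → ℝ) × ℝ)} [IsProbabilityMeasure P]
  {f g : (Fin (d + 1) → ℝ) → ℝ} {β : Fin (d + 1 + 1) → ℝ} {v₀ c₁ c₂ M Cf c C a₁ a₂ : ℝ}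

lemma measurableSet_margin_le (β : Fin (d + 1 + 1) → ℝ) (r : ℝ) :
    MeasurableSet {z : (Fin (d + 1) → ℝ) × ℝ | margin β z ≤ r} :=
  measurableSet_le (measurable_margin β) measurable_const

lemma exists_quadratic_expansion (H : Model P f g β v₀ c₁ c₂ M Cf c C a₁ a₂)
    (v : Fin (d + 1 + 1) → ℝ) :
    ∃ s : ℝ, ∀ r : ℝ, |(∫ z in {z | margin β z ≤ r}, (aug z.1 ⬝ᵥ v) ^ 2 ∂P) -
      (∫ z in {z | margin β z ≤ 1}, (aug z.1 ⬝ᵥ v) ^ 2 ∂P) - (r - 1) * s| ≤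
      9 * Cf * (1 + c₂) / c ^ 2 * l2Norm v ^ 2 * (r - 1) ^ 2 := by
  by_cases hv0 : v = 0
  · subst hv0
    exact ⟨0, fun r => by simp [l2Norm]⟩
  have hn : 0 < l2Norm v := lt_of_le_of_ne (l2Norm_nonneg v) fun h => hv0 (l2Norm_eq_zero.1 h.symm)
  set u := (l2Norm v)⁻¹ • v with hu
  have hu1 : l2Norm u = 1 := by
    rw [hu, l2Norm_smul, abs_of_pos (inv_pos.2 hn), inv_mul_cancel₀ hn.ne']
  have hvu : ∀ x : Fin (d + 1) → ℝ, (aug x ⬝ᵥ v) ^ 2 = l2Norm v ^ 2 * (aug x ⬝ᵥ u) ^ 2 := by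
    intro x
    rw [hu, dotProduct_smul, smul_eq_mul]; field_simp
  have hu2 : |u 1| ≤ 1 := hu1 ▸ abs_apply_le_l2Norm u 1
  obtain ⟨s, hs⟩ := H.exists_expansion hu1 ((measurable_dot u).pow_const 2) (H.integrable_dot_sq u)
    (integrable_dot_sq_mul H.density_pos u) (integrable_dot_sq_mul H.density_neg u)
    (fun _ _ => u 1 ^ 2) (fun _ w => 2 * u 1 * (aug (Fin.cons 0 w : Fin (d + 1) → ℝ) ⬝ᵥ u))
    (fun _ w => (aug (Fin.cons 0 w : Fin (d + 1) → ℝ) ⬝ᵥ u) ^ 2)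
    (fun y x w => by rw [aug_cons_dot]; ring) (fun y _ w => by
      set q := aug (Fin.cons 0 w : Fin (d + 1) → ℝ) ⬝ᵥ u
      have h1 : u 1 ^ 2 ≤ 1 := (sq_le_one_iff_abs_le_one _).2 hu2
      refine ⟨?_, ?_, ?_⟩
      · rw [abs_of_nonneg (sq_nonneg _)]; linarith [sq_nonneg q]
      · rw [abs_le]; constructor <;> nlinarith [sq_nonneg (u 1 - q), sq_nonneg (u 1 + q)]
      · rw [abs_of_nonneg (sq_nonneg _)]; linarith)
  refine ⟨l2Norm v ^ 2 * s, fun r => ?_⟩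
  simp_rw [hvu, integral_const_mul]
  have := mul_le_mul_of_nonneg_left (hs r) (sq_nonneg (l2Norm v))
  rw [← abs_of_nonneg (sq_nonneg (l2Norm v)), ← abs_mul, abs_of_nonneg (sq_nonneg (l2Norm v))] at this
  refine le_trans (le_of_eq ?_) (this.trans (le_of_eq ?_))
  · congr 1; ring
  · ring

lemma exists_linear_expansion (H : Model P f g β v₀ c₁ c₂ M Cf c C a₁ a₂)
    (v : Fin (d + 1 + 1) → ℝ) :
    ∃ s : ℝ, ∀ r : ℝ, |(∫ z in {z | margin β z ≤ r}, z.2 * (aug z.1 ⬝ᵥ v) ∂P) -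
      (∫ z in {z | margin β z ≤ 1}, z.2 * (aug z.1 ⬝ᵥ v) ∂P) - (r - 1) * s| ≤
      9 * Cf * (1 + c₂) / c ^ 2 * l2Norm v * (r - 1) ^ 2 := by
  by_cases hv0 : v = 0
  · subst hv0
    exact ⟨0, fun r => by simp [l2Norm]⟩
  have hn : 0 < l2Norm v := lt_of_le_of_ne (l2Norm_nonneg v) fun h => hv0 (l2Norm_eq_zero.1 h.symm)
  set u := (l2Norm v)⁻¹ • v with hu
  have hu1 : l2Norm u = 1 := by
    rw [hu, l2Norm_smul, abs_of_pos (inv_pos.2 hn), inv_mul_cancel₀ hn.ne']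
  have hvu : ∀ z : (Fin (d + 1) → ℝ) × ℝ,
      z.2 * (aug z.1 ⬝ᵥ v) = l2Norm v * (z.2 * (aug z.1 ⬝ᵥ u)) := by
    intro z
    rw [hu, dotProduct_smul, smul_eq_mul]; field_simp
  have hu2 : |u 1| ≤ 1 := hu1 ▸ abs_apply_le_l2Norm u 1
  obtain ⟨s, hs⟩ := H.exists_expansion hu1 (measurable_margin u) (H.integrable_label_dot u)
    ((integrable_dot_mul H.density_pos u).congr (ae_of_all _ fun x => by simp [margin]))
    (((integrable_dot_mul H.density_neg u).const_mul (-1)).congr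
      (ae_of_all _ fun x => by simp [margin]))
    (fun _ _ => 0) (fun y _ => y * u 1)
    (fun y w => y * (aug (Fin.cons 0 w : Fin (d + 1) → ℝ) ⬝ᵥ u))
    (fun y x w => by rw [margin, aug_cons_dot]; ring) (fun y hy w => by
      set q := aug (Fin.cons 0 w : Fin (d + 1) → ℝ) ⬝ᵥ u
      have hy1 : |y| = 1 := by rcases hy with h | h <;> simp [h]
      rw [abs_mul, abs_mul, hy1, one_mul, one_mul, abs_zero]
      refine ⟨by positivity, by linarith [sq_nonneg q], ?_⟩
      rw [abs_le]; constructor <;> nlinarith [sq_nonneg (1 - q), sq_nonneg (1 + q)])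
  refine ⟨l2Norm v * s, fun r => ?_⟩
  simp_rw [hvu, integral_const_mul]
  have := mul_le_mul_of_nonneg_left (hs r) (l2Norm_nonneg v)
  rw [← abs_of_nonneg (l2Norm_nonneg v), ← abs_mul, abs_of_nonneg (l2Norm_nonneg v)] at this
  refine le_trans (le_of_eq ?_) (this.trans (le_of_eq ?_))
  · simp only [margin]; congr 1; ring
  · ring

/-- The entries of the Hessian are genuine derivatives: by polarization they are differences of
quadratic forms, which have a second order expansion. -/
lemma differentiableAt_entry (H : Model P f g β v₀ c₁ c₂ M Cf c C a₁ a₂) (j k : Fin (d + 1 + 1)) :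
    DifferentiableAt ℝ
      (fun r : ℝ => ∫ z in {z | margin β z ≤ r}, aug z.1 j * aug z.1 k ∂P) 1 := by
  have hq : ∀ v : Fin (d + 1 + 1) → ℝ, DifferentiableAt ℝ
      (fun r : ℝ => ∫ z in {z | margin β z ≤ r}, (aug z.1 ⬝ᵥ v) ^ 2 ∂P) 1 := fun v => by
    obtain ⟨s, hs⟩ := H.exists_quadratic_expansion v
    exact (hasDerivAt_of_abs_sub_le_sq hs).differentiableAt
  have := (((hq (Pi.single j 1 + Pi.single k 1)).sub (hq (Pi.single j 1))).sub
    (hq (Pi.single k 1))).const_mul (1 / 2)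
  refine this.congr_of_eventuallyEq (Filter.Eventually.of_forall fun r => ?_)
  have hi : ∀ v : Fin (d + 1 + 1) → ℝ, Integrable (fun z => (aug z.1 ⬝ᵥ v) ^ 2)
      (P.restrict {z | margin β z ≤ r}) := fun v => (H.integrable_dot_sq v).integrableOn
  simp only [Pi.sub_apply]
  rw [← integral_sub (hi _) (hi _), ← integral_sub (by exact (hi _).sub (hi _)) (hi _),
    ← integral_const_mul]
  refine integral_congr_ae (ae_of_all _ fun z => ?_)
  simp only [dotProduct_add, dotProduct_single, mul_one]
  ring

lemma hasDerivAt_quadratic (H : Model P f g β v₀ c₁ c₂ M Cf c C a₁ a₂) (v : Fin (d + 1 + 1) → ℝ) :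
    HasDerivAt (fun r : ℝ => ∫ z in {z | margin β z ≤ r}, (aug z.1 ⬝ᵥ v) ^ 2 ∂P)
      (v ⬝ᵥ diracHessian P β *ᵥ v) 1 := by
  have he : (fun r : ℝ => ∫ z in {z | margin β z ≤ r}, (aug z.1 ⬝ᵥ v) ^ 2 ∂P) = fun r =>
      ∑ j, ∑ k, v j * v k * ∫ z in {z | margin β z ≤ r}, aug z.1 j * aug z.1 k ∂P := by
    ext r
    simp_rw [← sum_sum_mul_eq_sq]
    have hi : ∀ j k, IntegrableOn (fun z => v j * v k * (aug z.1 j * aug z.1 k))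
      {z | margin β z ≤ r} P := fun j k => ((H.integrable_aug_mul j k).const_mul _).integrableOn
    rw [integral_finsetSum _ fun j _ => integrable_finsetSum _ fun k _ => hi j k]
    simp_rw [integral_finsetSum _ fun k (_ : k ∈ Finset.univ) => hi _ k, integral_const_mul]
  rw [he]
  have hd : v ⬝ᵥ diracHessian P β *ᵥ v = ∑ j, ∑ k, v j * v k *
      deriv (fun r : ℝ => ∫ z in {z | margin β z ≤ r}, aug z.1 j * aug z.1 k ∂P) 1 := by
    simp only [dotProduct, Matrix.mulVec, diracHessian, Matrix.of_apply, Finset.mul_sum]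
    refine Finset.sum_congr rfl fun j _ => Finset.sum_congr rfl fun k _ => by ring
  rw [hd]
  exact HasDerivAt.fun_sum fun j _ => HasDerivAt.fun_sum fun k _ =>
    ((H.differentiableAt_entry j k).hasDerivAt).const_mul _

lemma diracHessian_isHermitian (P : Measure ((Fin (d + 1) → ℝ) × ℝ)) (β : Fin (d + 1 + 1) → ℝ) :
    (diracHessian P β).IsHermitian := by
  ext j k
  simp [diracHessian, mul_comm]

/-- Curvature of the population risk: the margins within `η` of the kink carry at least the
expected share of each quadratic form. -/
lemma le_integral_dot_sq_band (H : Model P f g β v₀ c₁ c₂ M Cf c C a₁ a₂) (v : Fin (d + 1 + 1) → ℝ)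
    {η : ℝ} (hη : 0 < η) :
    (2 * a₁ * η - 2 * (9 * Cf * (1 + c₂) / c ^ 2) * η ^ 2) * l2Norm v ^ 2 ≤
      ∫ z in {z | |1 - margin β z| ≤ η}, (aug z.1 ⬝ᵥ v) ^ 2 ∂P := by
  obtain ⟨s, hs⟩ := H.exists_quadratic_expansion v
  have hsD : s = v ⬝ᵥ diracHessian P β *ᵥ v :=
    (hasDerivAt_of_abs_sub_le_sq hs).unique (H.hasDerivAt_quadratic v)
  have hs1 : a₁ * l2Norm v ^ 2 ≤ s := by
    rw [hsD, l2Norm_sq]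
    exact le_dotProduct_mulVec_of_spectrum (diracHessian_isHermitian P β)
      (fun x hx => (H.hessian hx).1) v
  have h1 := (abs_le.1 (hs (1 + η))).1
  have h2 := (abs_le.1 (hs (1 - η))).2
  have hi : ∀ S : Set ((Fin (d + 1) → ℝ) × ℝ), IntegrableOn (fun z => (aug z.1 ⬝ᵥ v) ^ 2) S P :=
    fun S => (H.integrable_dot_sq v).integrableOn
  have h3 : (∫ z in {z | margin β z ≤ 1 + η}, (aug z.1 ⬝ᵥ v) ^ 2 ∂P) ≤
      (∫ z in {z | margin β z ≤ 1 - η}, (aug z.1 ⬝ᵥ v) ^ 2 ∂P) +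
      ∫ z in {z | |1 - margin β z| ≤ η}, (aug z.1 ⬝ᵥ v) ^ 2 ∂P := by
    have hsub : {z : (Fin (d + 1) → ℝ) × ℝ | margin β z ≤ 1 + η} ⊆
        {z | margin β z ≤ 1 - η} ∪ {z | |1 - margin β z| ≤ η} := by
      intro z (hz : margin β z ≤ 1 + η)
      by_cases h : margin β z ≤ 1 - η
      · exact Or.inl h
      · have h := not_le.1 h
        exact Or.inr (show |1 - margin β z| ≤ η from abs_le.2 ⟨by linarith, by linarith⟩)
    refine (setIntegral_mono_set (hi _) (ae_of_all _ fun z => sq_nonneg _)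
      hsub.eventuallyLE).trans ?_
    rw [← integral_indicator, ← integral_indicator (measurableSet_margin_le β _),
      ← integral_indicator, ← integral_add]
    · refine integral_mono_of_nonneg (ae_of_all _ fun z => indicator_nonneg (fun _ _ => sq_nonneg _) _)
        ?_ (ae_of_all _ fun z => ?_)
      · exact ((H.integrable_dot_sq v).indicator (measurableSet_margin_le β _)).add
          ((H.integrable_dot_sq v).indicator (measurableSet_le
            (measurable_const.sub (measurable_margin β)).abs measurable_const))
      · have := sq_nonneg (aug z.1 ⬝ᵥ v)
        by_cases ha : margin β z ≤ 1 - η <;> by_cases hb : |1 - margin β z| ≤ η <;>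
          simp [indicator, ha, hb, this]
    · exact (H.integrable_dot_sq v).indicator (measurableSet_margin_le β _)
    · exact (H.integrable_dot_sq v).indicator (measurableSet_le
            (measurable_const.sub (measurable_margin β)).abs measurable_const)
    · exact measurableSet_le (measurable_const.sub (measurable_margin β)).abs measurable_const
    · exact (measurableSet_margin_le β _).union (measurableSet_le
        (measurable_const.sub (measurable_margin β)).abs measurable_const)
  have h4 := mul_le_mul_of_nonneg_left hs1 hη.le
  nlinarith

/-- The margin has no atom at the kink of the hinge loss. -/
lemma measure_margin_eq_one (H : Model P f g β v₀ c₁ c₂ M Cf c C a₁ a₂) :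
    P {z | margin β z = 1} = 0 := by
  obtain ⟨s, hs⟩ := H.exists_quadratic_expansion (Pi.single 0 1)
  have hcont := (hasDerivAt_of_abs_sub_le_sq hs).continuousAt
  have hone : ∀ z : (Fin (d + 1) → ℝ) × ℝ,
      (aug z.1 ⬝ᵥ (Pi.single 0 1 : Fin (d + 1 + 1) → ℝ)) ^ 2 = 1 := by
    intro z; simp [aug]
  simp only [hone, setIntegral_const, smul_eq_mul, mul_one] at hcont
  have hle : ∀ r < (1 : ℝ), P.real {z | margin β z ≤ r} ≤
      P.real {z | margin β z ≤ 1} - P.real {z | margin β z = 1} := by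
    intro r hr
    have hd : Disjoint {z : (Fin (d + 1) → ℝ) × ℝ | margin β z ≤ r} {z | margin β z = 1} := by
      rw [Set.disjoint_left]
      intro z (hz : margin β z ≤ r) (hz' : margin β z = 1)
      linarith
    rw [le_sub_iff_add_le, ← measureReal_union hd (measurable_margin β (measurableSet_singleton 1))]
    refine measureReal_mono ?_ (by finiteness)
    rintro z (hz | hz)
    · exact le_trans hz hr.le
    · exact le_of_eq hz
  have hlim := le_of_tendsto (hcont.tendsto.mono_left (nhdsWithin_le_nhds (s := Iio 1)))
    (Filter.eventually_of_mem self_mem_nhdsWithin hle)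
  have h0 : P.real {z | margin β z = 1} = 0 :=
    le_antisymm (by linarith) measureReal_nonneg
  exact (measureReal_eq_zero_iff (by finiteness)).1 h0

lemma margin_add_smul (β v : Fin (d + 1 + 1) → ℝ) (t : ℝ) (z : (Fin (d + 1) → ℝ) × ℝ) :
    margin (β + t • v) z = margin β z + t * (z.2 * (aug z.1 ⬝ᵥ v)) := by
  simp only [margin, dotProduct_add, dotProduct_smul, smul_eq_mul]; ring

lemma integrable_hinge_margin (H : Model P f g β v₀ c₁ c₂ M Cf c C a₁ a₂)
    (b : Fin (d + 1 + 1) → ℝ) : Integrable (fun z => hinge (margin b z)) P := by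
  refine Integrable.mono' ((integrable_const 1).add (H.integrable_label_dot b).abs)
    (continuous_hinge.measurable.comp (measurable_margin b)).aestronglyMeasurable
    (ae_of_all _ fun z => ?_)
  rw [Real.norm_eq_abs, abs_of_nonneg (hinge_nonneg _)]
  have := neg_abs_le (margin b z)
  exact max_le (by simp only [Pi.add_apply]; exact (by linarith : 1 - margin b z ≤ 1 + |margin b z|))
    (by simp only [Pi.add_apply]; positivity)

lemma hasDerivAt_hinge {u : ℝ} (hu : u ≠ 1) :
    HasDerivAt hinge (-(Iic (1 : ℝ)).indicator 1 u) u := by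
  rcases lt_or_gt_of_ne hu with h | h
  · have h1 : HasDerivAt (fun x : ℝ => 1 - x) (-1) u := by
      simpa using (hasDerivAt_id u).const_sub 1
    rw [indicator_of_mem (mem_Iic.2 h.le), Pi.one_apply]
    refine h1.congr_of_eventuallyEq ?_
    filter_upwards [Iio_mem_nhds h] with x hx
    exact max_eq_left (by linarith [mem_Iio.1 hx])
  · rw [indicator_of_notMem (by simpa using h), neg_zero]
    refine (hasDerivAt_const u (0 : ℝ)).congr_of_eventuallyEq ?_
    filter_upwards [Ioi_mem_nhds h] with x hx
    exact max_eq_right (by linarith [mem_Ioi.1 hx])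

/-- First order optimality of the risk minimizer. -/
lemma integral_score_eq_zero (H : Model P f g β v₀ c₁ c₂ M Cf c C a₁ a₂) (v : Fin (d + 1 + 1) → ℝ) :
    ∫ z in {z | margin β z ≤ 1}, z.2 * (aug z.1 ⬝ᵥ v) ∂P = 0 := by
  set w : (Fin (d + 1) → ℝ) × ℝ → ℝ := fun z => z.2 * (aug z.1 ⬝ᵥ v) with hw
  have hwm : Measurable w := measurable_margin v
  have hwi : Integrable w P := H.integrable_label_dot v
  have hmeas : ∀ t : ℝ, Measurable fun z => hinge (margin β z + t * w z) := fun t =>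
    continuous_hinge.measurable.comp ((measurable_margin β).add (hwm.const_mul t))
  have hder := (hasDerivAt_integral_of_dominated_loc_of_lip (μ := P) (s := univ) (x₀ := (0 : ℝ))
    (F := fun t z => hinge (margin β z + t * w z))
    (F' := fun z => -(Iic (1 : ℝ)).indicator 1 (margin β z) * w z) (bound := w)
    Filter.univ_mem (Filter.Eventually.of_forall fun t => (hmeas t).aestronglyMeasurable)
    (by simpa using H.integrable_hinge_margin β)
    (by
      refine Measurable.aestronglyMeasurable ?_
      exact ((measurable_const.indicator measurableSet_Iic).comp (measurable_margin β)).neg.mul hwm)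
    (ae_of_all _ fun z => by
      refine LipschitzOnWith.of_dist_le_mul fun t _ t' _ => ?_
      rw [Real.dist_eq, Real.dist_eq, Real.coe_nnabs]
      refine (abs_hinge_sub_le _ _).trans (le_of_eq ?_)
      rw [← abs_mul]; congr 1; ring) hwi
    (by
      have hne : ∀ᵐ z ∂P, margin β z ≠ 1 := by
        rw [ae_iff]; simpa using H.measure_margin_eq_one
      filter_upwards [hne] with z hz
      have h1 : HasDerivAt (fun t : ℝ => margin β z + t * w z) (w z) 0 := by
        simpa using ((hasDerivAt_id (0 : ℝ)).mul_const (w z)).const_add (margin β z)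
      have h2 : HasDerivAt hinge (-(Iic (1 : ℝ)).indicator 1 (margin β z))
          (margin β z + 0 * w z) := by simpa using hasDerivAt_hinge hz
      exact h2.comp (0 : ℝ) h1)).2
  have hmin : IsLocalMin (fun t : ℝ => ∫ z, hinge (margin β z + t * w z) ∂P) 0 := by
    refine Filter.Eventually.of_forall fun t => ?_
    have := H.risk (mem_univ (β + t • v))
    simp only [mem_ofPred_eq, margin_add_smul] at this
    simpa using this
  have h0 := hmin.hasDerivAt_eq_zero hder
  rw [← integral_indicator (measurableSet_margin_le β 1), ← neg_eq_zero, ← integral_neg, ← h0]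
  refine integral_congr_ae (ae_of_all _ fun z => ?_)
  by_cases hz : margin β z ≤ 1 <;> simp [indicator, hz, hw]

/-- The smoothing bias of the score is quadratic in the bandwidth: the kernel averages, over the
level of the margin, a function that vanishes at level one and has a second order expansion there,
and the linear term averages out. -/
lemma abs_integral_smoothed_score_le (H : Model P f g β v₀ c₁ c₂ M Cf c C a₁ a₂) {K : ℝ → ℝ}
    {κl κ₂ : ℝ} (hK : KernelAssumption K κl κ₂) {h : ℝ} (v : Fin (d + 1 + 1) → ℝ) :
    |∫ z, smoothedStep K h (margin β z) * (z.2 * (aug z.1 ⬝ᵥ v)) ∂P| ≤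
      9 * Cf * (1 + c₂) / c ^ 2 * κ₂ * h ^ 2 * l2Norm v := by
  obtain ⟨s, hs⟩ := H.exists_linear_expansion v
  set w : (Fin (d + 1) → ℝ) × ℝ → ℝ := fun z => z.2 * (aug z.1 ⬝ᵥ v) with hw
  have hwm : Measurable w := measurable_margin v
  have hwi : Integrable w P := H.integrable_label_dot v
  set L := 9 * Cf * (1 + c₂) / c ^ 2 with hL
  set G : ℝ → ℝ := fun r => ∫ z in {z | margin β z ≤ r}, w z ∂P with hG
  have hG1 : G 1 = 0 := H.integral_score_eq_zero v
  have hKm : Measurable K := hK.differentiable.continuous.measurable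
  have hprod : Integrable (fun q : ((Fin (d + 1) → ℝ) × ℝ) × ℝ =>
      (Iic (1 : ℝ)).indicator 1 (margin β q.1 + h * q.2) * K q.2 * w q.1) (P.prod volume) := by
    have h1 : Integrable (fun q : ((Fin (d + 1) → ℝ) × ℝ) × ℝ => w q.1 * K q.2) (P.prod volume) :=
      hwi.mul_prod hK.integrable
    refine h1.mono ?_ (ae_of_all _ fun q => ?_)
    · refine Measurable.aestronglyMeasurable ?_
      have hm : Measurable fun q : ((Fin (d + 1) → ℝ) × ℝ) × ℝ => margin β q.1 + h * q.2 :=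
        ((measurable_margin β).comp measurable_fst).add (measurable_snd.const_mul h)
      exact (((measurable_const.indicator measurableSet_Iic).comp hm).mul
        (hKm.comp measurable_snd)).mul (hwm.comp measurable_fst)
    · by_cases hq : margin β q.1 + h * q.2 ≤ 1
      · rw [indicator_of_mem (mem_Iic.2 hq), Pi.one_apply, one_mul, mul_comm]
      · rw [indicator_of_notMem (by simpa using hq), zero_mul, zero_mul, norm_zero]
        exact norm_nonneg _
  have hinner : ∀ t : ℝ, ∫ z, (Iic (1 : ℝ)).indicator 1 (margin β z + h * t) * K t * w z ∂P =
      K t * G (1 - h * t) := by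
    intro t
    rw [hG]
    simp only
    rw [← integral_indicator (measurableSet_margin_le β _), ← integral_const_mul]
    refine integral_congr_ae (ae_of_all _ fun z => ?_)
    by_cases hz : margin β z ≤ 1 - h * t
    · have hz' : margin β z + h * t ≤ 1 := by linarith
      simp [indicator, hz, hz']
    · have hz' : ¬ margin β z + h * t ≤ 1 := fun h' => hz (by linarith)
      simp [indicator, hz, hz']
  have hswap : ∫ z, smoothedStep K h (margin β z) * w z ∂P = ∫ t, K t * G (1 - h * t) := by
    simp_rw [smoothedStep_eq, ← integral_mul_const]
    rw [integral_integral_swap hprod]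
    simp_rw [hinner]
  have hGi : Integrable fun t => K t * G (1 - h * t) := by
    have := hprod.integral_prod_right
    simpa only [hinner] using this
  have hti : Integrable fun t => t * K t := by
    refine hK.integrable_one.mono (by fun_prop) (ae_of_all _ fun t => ?_)
    simp
  have hcentre : ∫ t, K t * G (1 - h * t) = ∫ t, (K t * G (1 - h * t) + h * s * (t * K t)) := by
    rw [integral_add hGi (hti.const_mul _), integral_const_mul, hK.first_moment_eq_zero]; simp
  have hn := l2Norm_nonneg v
  have hL0 : 0 ≤ L := by
    have := H.Cf_pos; have := H.c₂_pos; have := H.c_pos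
    positivity
  rw [hswap, hcentre, ← Real.norm_eq_abs]
  calc _ ≤ ∫ t, L * l2Norm v * h ^ 2 * (|t| ^ 2 * K t) := by
        refine norm_integral_le_of_norm_le (hK.integrable_two.const_mul _) (ae_of_all _ fun t => ?_)
        have h1 := hs (1 - h * t)
        have h2 : G (1 - h * t) - G 1 - (1 - h * t - 1) * s = G (1 - h * t) + h * t * s := by
          rw [hG1]; ring
        change |G (1 - h * t) - G 1 - (1 - h * t - 1) * s| ≤ _ at h1
        rw [h2] at h1
        have h3 : K t * G (1 - h * t) + h * s * (t * K t) = K t * (G (1 - h * t) + h * t * s) := by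
          ring
        rw [h3, Real.norm_eq_abs, abs_mul, abs_of_nonneg (hK.nonneg t)]
        refine (mul_le_mul_of_nonneg_left h1 (hK.nonneg t)).trans (le_of_eq ?_)
        rw [sq_abs]; ring
    _ = L * l2Norm v * h ^ 2 * ∫ t, |t| ^ 2 * K t := integral_const_mul _ _
    _ ≤ L * l2Norm v * h ^ 2 * κ₂ := by
        have := hK.second_moment_le
        gcongr
    _ = _ := by ring

end Model

/-! ### Uniform deviations of empirical processes -/

lemma continuous_of_abs_sub_le {m : ℕ} {F : (Fin m → ℝ) → ℝ} (a : Fin m → ℝ)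
    (h : ∀ v w, |F v - F w| ≤ ∑ j, a j * |v j - w j|) : Continuous F := by
  refine continuous_iff_continuousAt.2 fun w => ?_
  refine tendsto_iff_dist_tendsto_zero.2 (squeeze_zero (t₀ := nhds w)
    (g := fun v => ∑ j, a j * |v j - w j|) (fun _ => dist_nonneg) (fun v => ?_) ?_)
  · rw [Real.dist_eq]; exact h v w
  · have : Continuous fun v : Fin m → ℝ => ∑ j, a j * |v j - w j| := by fun_prop
    simpa using this.tendsto w

lemma abs_dotProduct_sub_le {m : ℕ} (x v w : Fin m → ℝ) :
    |x ⬝ᵥ v - x ⬝ᵥ w| ≤ ∑ j, |x j| * |v j - w j| := by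
  rw [← dotProduct_sub, dotProduct]
  refine (Finset.abs_sum_le_sum_abs _ _).trans (le_of_eq ?_)
  simp [abs_mul]

section Deviation

variable {Z : Type*} [MeasurableSpace Z] {P : Measure Z} [IsProbabilityMeasure P] {m n : ℕ}
  {X : Z → Fin (m + 1) → ℝ} {Φ : (Fin (m + 1) → ℝ) → Z → ℝ} {σ R τ : ℝ}

/-- Chernoff bound for finitely many centred averages of contractions of linear forms. -/
lemma measure_exists_deviation_le {ι : Type*} [Finite ι] [Nonempty ι] (hX : Measurable X)
    (hσ : 0 < σ) (hR : 0 < R) (hn : 0 < n)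
    (hcosh : ∀ j t, ∫⁻ z, ENNReal.ofReal (Real.cosh (t * X z j)) ∂P ≤
      ENNReal.ofReal (Real.exp (4 * σ ^ 2 * t ^ 2)))
    (hΦm : ∀ v, Measurable (Φ v)) (hΦi : ∀ v, Integrable (Φ v) P)
    (hΦ : ∀ v z, |Φ v z| ≤ |X z ⬝ᵥ v|) (hΦ' : ∀ v w z, |Φ v z - Φ w z| ≤ |X z ⬝ᵥ v - X z ⬝ᵥ w|)
    (hτ : 0 < τ) (u : ι → Fin (m + 1) → ℝ) (hu : ∀ k, l1Norm (u k) ≤ R) :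
    Measure.pi (fun _ : Fin n => P)
      {z | ∃ k, τ < (∫ z', Φ (u k) z' ∂P) - (n : ℝ)⁻¹ * ∑ i, Φ (u k) (z i)} ≤
      ENNReal.ofReal (2 * (m + 1) * Real.exp (-(n * τ ^ 2 / (64 * σ ^ 2 * R ^ 2)))) := by
  have hn' : (0 : ℝ) < n := Nat.cast_pos.2 hn
  -- the optimal exponent
  set t : ℝ := τ / (32 * σ ^ 2 * R ^ 2) with ht
  have ht0 : 0 < t := by positivity
  have key := lintegral_exp_iSup_sum_centered_le P (n := n) hX (fun k z => t * Φ (u k) z)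
    (fun k => t • u k) (fun k => (hΦi _).const_mul t) (fun k => (hΦm _).const_mul t)
    (fun k z => by
      rw [dotProduct_smul, smul_eq_mul, abs_mul, abs_mul]
      exact mul_le_mul_of_nonneg_left (hΦ _ z) (abs_nonneg t))
    (fun k l z => by
      rw [dotProduct_smul, dotProduct_smul, smul_eq_mul, smul_eq_mul, ← mul_sub, ← mul_sub, abs_mul,
        abs_mul]
      exact mul_le_mul_of_nonneg_left (hΦ' _ _ z) (abs_nonneg t))
    (R := t * R) (B := 4 * σ ^ 2 * (2 * (t * R)) ^ 2)
    (fun k => by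
      rw [l1Norm_smul, abs_of_pos ht0]
      exact mul_le_mul_of_nonneg_left (hu k) ht0.le) (fun j => hcosh j _)
  have hmeas : Measurable fun z : Fin n → Z =>
      ENNReal.ofReal (Real.exp (⨆ k, ∑ i, (∫ z', t * Φ (u k) z' ∂P - t * Φ (u k) (z i)))) := by
    refine (Real.measurable_exp.comp (Measurable.iSup fun k => ?_)).ennreal_ofReal
    exact Finset.measurable_sum _ fun i _ => measurable_const.sub
      (((hΦm _).comp (measurable_pi_apply i)).const_mul t)
  have markov := mul_meas_ge_le_lintegral (μ := Measure.pi (fun _ : Fin n => P)) hmeas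
    (ENNReal.ofReal (Real.exp (t * n * τ)))
  have hsub : {z : Fin n → Z | ∃ k, τ < (∫ z', Φ (u k) z' ∂P) - (n : ℝ)⁻¹ * ∑ i, Φ (u k) (z i)} ⊆
      {z | ENNReal.ofReal (Real.exp (t * n * τ)) ≤ ENNReal.ofReal (Real.exp
        (⨆ k, ∑ i, (∫ z', t * Φ (u k) z' ∂P - t * Φ (u k) (z i))))} := by
    rintro z ⟨k, hk⟩
    refine ENNReal.ofReal_le_ofReal (Real.exp_le_exp.2 (le_trans ?_ (le_iSup_of_finite
      (fun k => ∑ i, (∫ z', t * Φ (u k) z' ∂P - t * Φ (u k) (z i))) k)))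
    simp only [integral_const_mul, Finset.sum_sub_distrib, Finset.sum_const, Finset.card_univ,
      Fintype.card_fin, nsmul_eq_mul, ← Finset.mul_sum]
    have h1 := mul_le_mul_of_nonneg_left hk.le (by positivity : 0 ≤ t * n)
    refine h1.trans (le_of_eq ?_)
    field_simp
  have hle := (mul_le_mul_of_nonneg_left (measure_mono (μ := Measure.pi (fun _ : Fin n => P)) hsub)
    (zero_le (a := ENNReal.ofReal (Real.exp (t * n * τ))))).trans (markov.trans key)
  have hfin : ENNReal.ofReal (Real.exp (t * n * τ)) ≠ 0 := by
    simpa using Real.exp_pos _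
  rw [mul_comm, ← ENNReal.le_div_iff_mul_le (Or.inl hfin) (Or.inl ENNReal.ofReal_ne_top),
    ← ENNReal.ofReal_div_of_pos (Real.exp_pos _), mul_div_assoc, ← Real.exp_sub] at hle
  refine hle.trans (le_of_eq ?_)
  congr 3
  rw [ht]; field_simp; ring

/-- Uniform one-sided deviation bound over a set of vectors of bounded `l₁` norm. By continuity a
countable dense subset suffices, and its finite pieces exhaust it. -/
lemma exists_uniform_deviation (hX : Measurable X) (hXi : ∀ j, Integrable (fun z => X z j) P)
    (hσ : 0 < σ) (hR : 0 < R) (hn : 0 < n)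
    (hcosh : ∀ j t, ∫⁻ z, ENNReal.ofReal (Real.cosh (t * X z j)) ∂P ≤
      ENNReal.ofReal (Real.exp (4 * σ ^ 2 * t ^ 2)))
    (hΦm : ∀ v, Measurable (Φ v))
    (hΦ : ∀ v z, |Φ v z| ≤ |X z ⬝ᵥ v|) (hΦ' : ∀ v w z, |Φ v z - Φ w z| ≤ |X z ⬝ᵥ v - X z ⬝ᵥ w|)
    (hτ : 0 < τ) (T : Set (Fin (m + 1) → ℝ)) (hT : ∀ v ∈ T, l1Norm v ≤ R) :
    ∃ G : Set (Fin n → Z), MeasurableSet G ∧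
      (∀ z ∈ G, ∀ v ∈ T, (∫ z', Φ v z' ∂P) - (n : ℝ)⁻¹ * ∑ i, Φ v (z i) ≤ τ) ∧
      Measure.pi (fun _ : Fin n => P) Gᶜ ≤
        ENNReal.ofReal (2 * (m + 1) * Real.exp (-(n * τ ^ 2 / (64 * σ ^ 2 * R ^ 2)))) := by
  have hΦi : ∀ v, Integrable (Φ v) P := fun v => by
    refine Integrable.mono' (g := fun z => |X z ⬝ᵥ v|) ?_ (hΦm v).aestronglyMeasurable
      (ae_of_all _ fun z => hΦ v z)
    exact Integrable.abs (integrable_finsetSum _ fun j _ => (hXi j).mul_const _)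
  set S : (Fin (m + 1) → ℝ) → (Fin n → Z) → ℝ := fun v z =>
    (∫ z', Φ v z' ∂P) - (n : ℝ)⁻¹ * ∑ i, Φ v (z i) with hS
  have hSm : ∀ v, Measurable (S v) := fun v => measurable_const.sub
    ((Finset.measurable_sum _ fun i _ => (hΦm v).comp (measurable_pi_apply i)).const_mul _)
  have hScont : ∀ z, Continuous fun v => S v z := by
    intro z
    refine Continuous.sub ?_ (continuous_const.mul (continuous_finsetSum _ fun i _ => ?_))
    · refine continuous_of_abs_sub_le (fun j => ∫ z, |X z j| ∂P) fun v w => ?_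
      rw [← integral_sub (hΦi v) (hΦi w), ← Real.norm_eq_abs]
      refine (norm_integral_le_of_norm_le (g := fun z => ∑ j, |X z j| * |v j - w j|) ?_
        (ae_of_all _ fun z => (hΦ' v w z).trans (abs_dotProduct_sub_le _ _ _))).trans (le_of_eq ?_)
      · exact integrable_finsetSum _ fun j _ => (hXi j).abs.mul_const _
      · rw [integral_finsetSum _ fun j _ => (hXi j).abs.mul_const _]
        simp_rw [integral_mul_const]
    · exact continuous_of_abs_sub_le (fun j => |X (z i) j|) fun v w =>
        (hΦ' v w (z i)).trans (abs_dotProduct_sub_le _ _ _)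
  obtain ⟨D, hDT, hDc, hTD⟩ :=
    (TopologicalSpace.IsSeparable.of_separableSpace T).exists_countable_dense_subset
  rcases D.eq_empty_or_nonempty with rfl | hne
  · refine ⟨univ, MeasurableSet.univ, fun z _ v hv => ?_, by simp⟩
    simpa using hTD hv
  obtain ⟨u, rfl⟩ := hDc.exists_eq_range hne
  refine ⟨{z | ∀ k, S (u k) z ≤ τ}, ?_, fun z hz v hv => ?_, ?_⟩
  · simp only [ofPred_forall]
    exact MeasurableSet.iInter fun k => measurableSet_le (hSm _) measurable_const
  · have hclosed : IsClosed {v | S v z ≤ τ} := isClosed_le (hScont z) continuous_const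
    have hsub : range u ⊆ {v | S v z ≤ τ} := by
      rintro _ ⟨k, rfl⟩; exact hz k
    exact hclosed.closure_subset_iff.2 hsub (hTD hv)
  · have hcompl : {z | ∀ k, S (u k) z ≤ τ}ᶜ =
        ⋃ N : ℕ, {z | ∃ k : Fin (N + 1), τ < S (u k) z} := by
      ext z
      simp only [mem_compl_iff, mem_ofPred_eq, not_forall, not_le, mem_iUnion]
      constructor
      · rintro ⟨k, hk⟩; exact ⟨k, ⟨k, Nat.lt_succ_self k⟩, hk⟩
      · rintro ⟨N, k, hk⟩; exact ⟨k, hk⟩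
    rw [hcompl, Monotone.measure_iUnion]
    · refine iSup_le fun N => ?_
      exact measure_exists_deviation_le hX hσ hR hn hcosh hΦm hΦi hΦ hΦ' hτ
        (fun k : Fin (N + 1) => u k) fun k => hT _ (hDT (mem_range_self _))
    · rintro N N' hNN' z ⟨k, hk⟩
      exact ⟨⟨k, k.2.trans_le (Nat.succ_le_succ hNN')⟩, hk⟩

end Deviation

/-! ### The truncated quadratic -/

/-- A Lipschitz function that equals `u ^ 2` for `|u| ≤ b / 2` and vanishes for `|u| ≥ b`. -/
noncomputable def truncSq (b u : ℝ) : ℝ := max 0 (min |u| (b - |u|)) ^ 2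

lemma truncSq_nonneg (b u : ℝ) : 0 ≤ truncSq b u := sq_nonneg _

lemma truncSq_le_sq (b u : ℝ) : truncSq b u ≤ u ^ 2 := by
  unfold truncSq
  rw [← sq_abs u]
  exact pow_le_pow_left₀ (le_max_left _ _) (max_le (abs_nonneg u) (min_le_left _ _)) 2

lemma truncSq_eq_zero {b u : ℝ} (h : b < |u|) : truncSq b u = 0 := by
  unfold truncSq
  rw [max_eq_left ((min_le_right _ _).trans (by linarith))]; ring

lemma truncBase_le {b : ℝ} (hb : 0 ≤ b) (u : ℝ) : max 0 (min |u| (b - |u|)) ≤ b / 2 := by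
  refine max_le (by linarith) ?_
  rcases le_total |u| (b / 2) with h | h
  · exact (min_le_left _ _).trans h
  · exact (min_le_right _ _).trans (by linarith)

lemma abs_truncSq_sub_le {b : ℝ} (hb : 0 ≤ b) (u w : ℝ) :
    |truncSq b u - truncSq b w| ≤ b * |u - w| := by
  unfold truncSq
  set x := max 0 (min |u| (b - |u|)) with hx
  set y := max 0 (min |w| (b - |w|)) with hy
  have hxy : |x - y| ≤ |u - w| := by
    refine (abs_max_sub_max_le_max _ _ _ _).trans (max_le (by simp) ?_)
    refine (abs_min_sub_min_le_max _ _ _ _).trans (max_le (abs_abs_sub_abs_le_abs_sub u w) ?_)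
    have : b - |u| - (b - |w|) = |w| - |u| := by ring
    rw [this, abs_sub_comm u w]
    exact abs_abs_sub_abs_le_abs_sub w u
  have hx0 : 0 ≤ x := le_max_left _ _
  have hy0 : 0 ≤ y := le_max_left _ _
  have hx1 := truncBase_le hb u
  have hy1 := truncBase_le hb w
  rw [sq_sub_sq, abs_mul, abs_of_nonneg (by positivity)]
  exact mul_le_mul (by linarith) hxy (abs_nonneg _) hb

lemma sq_sub_le_truncSq {b : ℝ} (hb : 0 < b) (u : ℝ) : u ^ 2 - 4 / b ^ 2 * u ^ 4 ≤ truncSq b u := by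
  rcases le_total |u| (b / 2) with h | h
  · unfold truncSq
    rw [min_eq_left (by linarith), max_eq_right (abs_nonneg u), sq_abs]
    have : 0 ≤ 4 / b ^ 2 * u ^ 4 := by positivity
    linarith
  · have h1 : b ^ 2 ≤ 4 * u ^ 2 := by
      have := pow_le_pow_left₀ (by positivity) h 2
      rw [sq_abs] at this; linarith
    have h2 : u ^ 2 ≤ 4 / b ^ 2 * u ^ 4 := by
      rw [div_mul_eq_mul_div, le_div_iff₀ (by positivity)]
      nlinarith [sq_nonneg u]
    linarith [truncSq_nonneg b u]

lemma continuous_truncSq (b : ℝ) : Continuous (truncSq b) := by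
  unfold truncSq; fun_prop

/-! ### Sample events -/

/-- The truncated quadratic form in the direction `v` of an observation with margin near the kink.
Up to the factor `κₗ / 4`, it bounds from below what the smoothed hinge loss of this observation
gains over its linearization. -/
noncomputable def bandCurv {p : ℕ} (β : Fin (p + 1) → ℝ) (h : ℝ) (v : Fin (p + 1) → ℝ)
    (z : (Fin p → ℝ) × ℝ) : ℝ :=
  {z | |1 - margin β z| ≤ h / 2}.indicator (fun z => h⁻¹ * truncSq (h / 2) (margin v z)) z

namespace Model

variable {d : ℕ} {P : Measure ((Fin (d + 1) → ℝ) × ℝ)} [IsProbabilityMeasure P]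
  {f g : (Fin (d + 1) → ℝ) → ℝ} {β : Fin (d + 1 + 1) → ℝ} {v₀ c₁ c₂ M Cf c C a₁ a₂ : ℝ}

lemma smul_dot (z : (Fin (d + 1) → ℝ) × ℝ) (v : Fin (d + 1 + 1) → ℝ) :
    (z.2 • aug z.1) ⬝ᵥ v = margin v z := by
  rw [smul_dotProduct, smul_eq_mul, margin]

lemma measurable_labelled : Measurable fun z : (Fin (d + 1) → ℝ) × ℝ => z.2 • aug z.1 := by
  refine measurable_pi_lambda _ fun j => ?_
  exact measurable_snd.mul ((measurable_pi_apply j).comp (measurable_aug.comp measurable_fst))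

lemma labelled_apply (z : (Fin (d + 1) → ℝ) × ℝ) (j : Fin (d + 1 + 1)) :
    (z.2 • aug z.1) j = margin (Pi.single j 1) z := by
  simp [margin]

lemma subGaussian_dot (H : Model P f g β v₀ c₁ c₂ M Cf c C a₁ a₂) {v : Fin (d + 1 + 1) → ℝ}
    (hv : v ≠ 0) (t : ℝ) (ht : 0 < t) :
    P.real {z | v₀ * √c₂ * l2Norm v * t ≤ |aug z.1 ⬝ᵥ v|} ≤ 2 * Real.exp (-t ^ 2 / 2) :=
  subGaussian_aug_dot H.c₁_pos H.v₀_pos H.design H.integrable_aug_mul v hv t ht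

lemma integrable_labelled (H : Model P f g β v₀ c₁ c₂ M Cf c C a₁ a₂) (j : Fin (d + 1 + 1)) :
    Integrable (fun z => (z.2 • aug z.1) j) P := by
  simp_rw [labelled_apply]
  exact H.integrable_label_dot _

lemma lintegral_cosh_labelled_le (H : Model P f g β v₀ c₁ c₂ M Cf c C a₁ a₂)
    (j : Fin (d + 1 + 1)) (t : ℝ) :
    ∫⁻ z, ENNReal.ofReal (Real.cosh (t * (z.2 • aug z.1) j)) ∂P ≤
      ENNReal.ofReal (Real.exp (4 * (v₀ * √c₂) ^ 2 * t ^ 2)) := by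
  have hσ : 0 < v₀ * √c₂ := mul_pos H.v₀_pos (Real.sqrt_pos.2 H.c₂_pos)
  have hne : (Pi.single j 1 : Fin (d + 1 + 1) → ℝ) ≠ 0 := by simp
  have hn : l2Norm (Pi.single j 1 : Fin (d + 1 + 1) → ℝ) = 1 := by
    rw [← sq_eq_sq₀ (l2Norm_nonneg _) zero_le_one, l2Norm_sq]; simp
  have := lintegral_cosh_le (P := P) (measurable_dot (Pi.single j 1)) hσ (fun t ht => by
    simpa [hn] using H.subGaussian_dot hne t ht) t
  refine le_trans (le_of_eq (lintegral_congr_ae ?_)) this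
  filter_upwards [H.label] with z hz
  rw [labelled_apply, margin]
  rcases hz with h | h
  · rw [h, one_mul]
  · rw [h, ← Real.cosh_neg]; congr 2; ring

lemma integral_dot_pow_four_le (H : Model P f g β v₀ c₁ c₂ M Cf c C a₁ a₂)
    (v : Fin (d + 1 + 1) → ℝ) :
    Integrable (fun z => (aug z.1 ⬝ᵥ v) ^ 4) P ∧
    ∫ z, (aug z.1 ⬝ᵥ v) ^ 4 ∂P ≤ 96 * (v₀ * √c₂) ^ 4 * l2Norm v ^ 4 := by
  by_cases hv : v = 0
  · subst hv
    simp [l2Norm]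
  have hn : 0 < l2Norm v := lt_of_le_of_ne (l2Norm_nonneg v) fun h => hv (l2Norm_eq_zero.1 h.symm)
  have hσ : 0 < v₀ * √c₂ * l2Norm v := mul_pos (mul_pos H.v₀_pos (Real.sqrt_pos.2 H.c₂_pos)) hn
  refine ⟨integrable_pow_four (measurable_dot v) hσ (H.subGaussian_dot hv), ?_⟩
  refine (integral_pow_four_le (measurable_dot v) hσ (H.subGaussian_dot hv)).trans (le_of_eq ?_)
  ring

lemma measurableSet_band (β : Fin (d + 1 + 1) → ℝ) (η : ℝ) :
    MeasurableSet {z : (Fin (d + 1) → ℝ) × ℝ | |1 - margin β z| ≤ η} :=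
  measurableSet_le (measurable_const.sub (measurable_margin β)).abs measurable_const

lemma measurable_bandCurv (β v : Fin (d + 1 + 1) → ℝ) (h : ℝ) : Measurable (bandCurv β h v) := by
  refine Measurable.indicator ?_ (measurableSet_band β (h / 2))
  exact ((continuous_truncSq _).measurable.comp (measurable_margin v)).const_mul _

lemma abs_bandCurv_sub_le (β v w : Fin (d + 1 + 1) → ℝ) {h : ℝ} (hh : 0 < h)
    (z : (Fin (d + 1) → ℝ) × ℝ) :
    |bandCurv β h v z - bandCurv β h w z| ≤ |margin v z - margin w z| := by
  unfold bandCurv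
  by_cases hz : |1 - margin β z| ≤ h / 2
  · simp only [indicator, mem_ofPred_eq, hz, if_true]
    rw [← mul_sub, abs_mul, abs_of_pos (inv_pos.2 hh)]
    have := mul_le_mul_of_nonneg_left (abs_truncSq_sub_le (b := h / 2) (by positivity)
      (margin v z) (margin w z)) (inv_pos.2 hh).le
    refine this.trans ?_
    have e : h⁻¹ * (h / 2 * |margin v z - margin w z|) = |margin v z - margin w z| / 2 := by
      field_simp
    rw [e]; linarith [abs_nonneg (margin v z - margin w z)]
  · simp [indicator, hz]

lemma abs_bandCurv_le (β v : Fin (d + 1 + 1) → ℝ) {h : ℝ} (hh : 0 < h)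
    (z : (Fin (d + 1) → ℝ) × ℝ) : |bandCurv β h v z| ≤ |margin v z| := by
  have h0 : bandCurv β h 0 z = 0 := by
    have : truncSq (h / 2) 0 = 0 := by simp [truncSq, min_eq_left (by positivity : 0 ≤ h / 2)]
    simp [bandCurv, margin, this, indicator]
  simpa [h0, margin] using abs_bandCurv_sub_le β v 0 hh z

/-- Lower bound of the expected curvature: the curvature of the population risk, less the effect of
the bandwidth and of the truncation. -/
lemma le_integral_bandCurv (H : Model P f g β v₀ c₁ c₂ M Cf c C a₁ a₂) (v : Fin (d + 1 + 1) → ℝ)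
    {h : ℝ} (hh : 0 < h) :
    (a₁ - 9 * Cf * (1 + c₂) / c ^ 2 * h) * l2Norm v ^ 2 -
      1536 * (v₀ * √c₂) ^ 4 * l2Norm v ^ 4 / h ^ 3 ≤ ∫ z, bandCurv β h v z ∂P := by
  obtain ⟨h4i, h4⟩ := H.integral_dot_pow_four_le v
  have hb := H.le_integral_dot_sq_band v (η := h / 2) (by positivity)
  have hL0 : 0 ≤ 9 * Cf * (1 + c₂) / c ^ 2 := by
    have := H.Cf_pos; have := H.c₂_pos; have := H.c_pos
    positivity
  have hint : Integrable (bandCurv β h v) P := by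
    refine Integrable.mono' (H.integrable_label_dot v).abs
      (measurable_bandCurv β v h).aestronglyMeasurable (ae_of_all _ fun z => ?_)
    exact abs_bandCurv_le β v hh z
  have hband : Integrable ({z | |1 - margin β z| ≤ h / 2}.indicator
      fun z => (aug z.1 ⬝ᵥ v) ^ 2) P := (H.integrable_dot_sq v).indicator (measurableSet_band β _)
  have hle : ∫ z, (h⁻¹ * {z | |1 - margin β z| ≤ h / 2}.indicator
      (fun z => (aug z.1 ⬝ᵥ v) ^ 2) z - 16 / h ^ 3 * (aug z.1 ⬝ᵥ v) ^ 4) ∂P ≤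
      ∫ z, bandCurv β h v z ∂P := by
    refine integral_mono_ae ((hband.const_mul _).sub (h4i.const_mul _)) hint ?_
    filter_upwards [H.label] with z hz
    have hsq : margin v z ^ 2 = (aug z.1 ⬝ᵥ v) ^ 2 := by
      rw [margin, mul_pow]; rcases hz with h | h <;> rw [h] <;> ring
    have h4 : margin v z ^ 4 = (aug z.1 ⬝ᵥ v) ^ 4 := by
      calc margin v z ^ 4 = (margin v z ^ 2) ^ 2 := by ring
        _ = _ := by rw [hsq]; ring
    by_cases hz : |1 - margin β z| ≤ h / 2
    · simp only [bandCurv, indicator, mem_ofPred_eq, hz, if_true]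
      have := mul_le_mul_of_nonneg_left (sq_sub_le_truncSq (b := h / 2) (by positivity)
        (margin v z)) (inv_pos.2 hh).le
      rw [hsq, h4] at this
      refine le_trans (le_of_eq ?_) this
      field_simp; ring
    · simp only [bandCurv, indicator, mem_ofPred_eq, hz, if_false]
      have : 0 ≤ 16 / h ^ 3 * (aug z.1 ⬝ᵥ v) ^ 4 := by positivity
      linarith
  rw [integral_sub (hband.const_mul _) (h4i.const_mul _), integral_const_mul, integral_const_mul,
    integral_indicator (measurableSet_band β _)] at hle
  refine le_trans ?_ hle
  have e1 := mul_le_mul_of_nonneg_left hb (inv_pos.2 hh).le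
  have e2 := mul_le_mul_of_nonneg_left h4 (by positivity : 0 ≤ 16 / h ^ 3)
  have e3 : h⁻¹ * ((2 * a₁ * (h / 2) - 2 * (9 * Cf * (1 + c₂) / c ^ 2) * (h / 2) ^ 2) *
      l2Norm v ^ 2) = (a₁ - 9 * Cf * (1 + c₂) / c ^ 2 * h / 2) * l2Norm v ^ 2 := by
    field_simp
  have e4 : 16 / h ^ 3 * (96 * (v₀ * √c₂) ^ 4 * l2Norm v ^ 4) =
      1536 * (v₀ * √c₂) ^ 4 * l2Norm v ^ 4 / h ^ 3 := by ring
  have e5 : (a₁ - 9 * Cf * (1 + c₂) / c ^ 2 * h) * l2Norm v ^ 2 ≤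
      (a₁ - 9 * Cf * (1 + c₂) / c ^ 2 * h / 2) * l2Norm v ^ 2 := by
    refine mul_le_mul_of_nonneg_right ?_ (sq_nonneg _)
    nlinarith [mul_nonneg hL0 hh.le]
  rw [e3] at e1
  rw [e4] at e2
  linarith

/-- The score event: the empirical score at the risk minimizer is close to its mean in every
coordinate. -/
lemma exists_score_event (H : Model P f g β v₀ c₁ c₂ M Cf c C a₁ a₂) {K : ℝ → ℝ} {κl κ₂ : ℝ}
    (hK : KernelAssumption K κl κ₂) {h τ : ℝ} (hτ : 0 < τ) {n : ℕ} (hn : 0 < n) :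
    ∃ G : Set (Fin n → (Fin (d + 1) → ℝ) × ℝ), MeasurableSet G ∧
      (∀ z ∈ G, ∀ v, |(∫ z', smoothedStep K h (margin β z') * margin v z' ∂P) -
        (n : ℝ)⁻¹ * ∑ i, smoothedStep K h (margin β (z i)) * margin v (z i)| ≤ τ * l1Norm v) ∧
      Measure.pi (fun _ : Fin n => P) Gᶜ ≤ ENNReal.ofReal
        (2 * ((d + 1 : ℕ) + 1) * Real.exp (-(n * τ ^ 2 / (64 * (v₀ * √c₂) ^ 2)))) := by
  have hσ : 0 < v₀ * √c₂ := mul_pos H.v₀_pos (Real.sqrt_pos.2 H.c₂_pos)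
  have hstep : ∀ u, |smoothedStep K h u| ≤ 1 := fun u => by
    rw [abs_of_nonneg (smoothedStep_nonneg hK u)]; exact smoothedStep_le_one hK u
  have hmeas : ∀ v, Measurable fun z : (Fin (d + 1) → ℝ) × ℝ =>
      smoothedStep K h (margin β z) * margin v z := fun v =>
    ((measurable_smoothedStep hK).comp (measurable_margin β)).mul (measurable_margin v)
  obtain ⟨G, hGm, hG, hGp⟩ := exists_uniform_deviation (P := P) (n := n)
    (X := fun z : (Fin (d + 1) → ℝ) × ℝ => z.2 • aug z.1)
    (Φ := fun v z => smoothedStep K h (margin β z) * margin v z) (σ := v₀ * √c₂) (R := 1) (τ := τ)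
    measurable_labelled H.integrable_labelled hσ one_pos hn H.lintegral_cosh_labelled_le hmeas
    (fun v z => by
      rw [smul_dot, abs_mul]
      exact mul_le_of_le_one_left (abs_nonneg _) (hstep _))
    (fun v w z => by
      rw [smul_dot, smul_dot, ← mul_sub, abs_mul]
      exact mul_le_of_le_one_left (abs_nonneg _) (hstep _))
    hτ {v | l1Norm v ≤ 1} (fun v hv => hv)
  refine ⟨G, hGm, fun z hz v => ?_, by simpa using hGp⟩
  rcases (l1Norm_nonneg v).eq_or_lt with h0 | hpos
  · have hv : v = 0 := by
      ext j
      have := (Finset.sum_eq_zero_iff_of_nonneg (fun j _ => abs_nonneg (v j))).1 h0.symm j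
        (Finset.mem_univ j)
      simpa using this
    subst hv
    simp [margin, l1Norm]
  · have hscale : ∀ a : ℝ, ∀ z : (Fin (d + 1) → ℝ) × ℝ, smoothedStep K h (margin β z) *
        margin (a • v) z = a * (smoothedStep K h (margin β z) * margin v z) := fun a z => by
      simp only [margin, dotProduct_smul, smul_eq_mul]; ring
    have hmem : ∀ a : ℝ, |a| = (l1Norm v)⁻¹ → l1Norm (a • v) ≤ 1 := fun a ha => by
      rw [l1Norm_smul, ha, inv_mul_cancel₀ hpos.ne']
    have h1 := hG z hz _ (hmem (l1Norm v)⁻¹ (abs_of_pos (inv_pos.2 hpos)))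
    have h2 := hG z hz _ (hmem (-(l1Norm v)⁻¹) (by rw [abs_neg, abs_of_pos (inv_pos.2 hpos)]))
    simp only [hscale, integral_const_mul, ← Finset.mul_sum] at h1 h2
    set A := ∫ z', smoothedStep K h (margin β z') * margin v z' ∂P
    set B := ∑ i, smoothedStep K h (margin β (z i)) * margin v (z i)
    have h1' := mul_le_mul_of_nonneg_left h1 hpos.le
    have h2' := mul_le_mul_of_nonneg_left h2 hpos.le
    have e1 : l1Norm v * ((l1Norm v)⁻¹ * A - (n : ℝ)⁻¹ * ((l1Norm v)⁻¹ * B)) =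
        A - (n : ℝ)⁻¹ * B := by field_simp
    have e2 : l1Norm v * (-(l1Norm v)⁻¹ * A - (n : ℝ)⁻¹ * (-(l1Norm v)⁻¹ * B)) =
        -(A - (n : ℝ)⁻¹ * B) := by field_simp; ring
    rw [e1] at h1'
    rw [e2] at h2'
    exact abs_le.2 ⟨by linarith, by linarith⟩

/-- The curvature event: uniformly over directions with bounded `l₁` norm, the empirical curvature
is at least its mean less `τ`. -/
lemma exists_curvature_event (H : Model P f g β v₀ c₁ c₂ M Cf c C a₁ a₂) {h τ R : ℝ} (hh : 0 < h)
    (hτ : 0 < τ) (hR : 0 < R) {n : ℕ} (hn : 0 < n) :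
    ∃ G : Set (Fin n → (Fin (d + 1) → ℝ) × ℝ), MeasurableSet G ∧
      (∀ z ∈ G, ∀ v, l1Norm v ≤ R → (∫ z', bandCurv β h v z' ∂P) -
        (n : ℝ)⁻¹ * ∑ i, bandCurv β h v (z i) ≤ τ) ∧
      Measure.pi (fun _ : Fin n => P) Gᶜ ≤ ENNReal.ofReal
        (2 * ((d + 1 : ℕ) + 1) * Real.exp (-(n * τ ^ 2 / (64 * (v₀ * √c₂) ^ 2 * R ^ 2)))) :=
  exists_uniform_deviation (P := P) (n := n)
    (X := fun z : (Fin (d + 1) → ℝ) × ℝ => z.2 • aug z.1)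
    (Φ := bandCurv β h) (σ := v₀ * √c₂) (R := R) (τ := τ)
    measurable_labelled H.integrable_labelled (mul_pos H.v₀_pos (Real.sqrt_pos.2 H.c₂_pos)) hR hn
    H.lintegral_cosh_labelled_le (fun v => measurable_bandCurv β v h)
    (fun v z => by rw [smul_dot]; exact abs_bandCurv_le β v hh z)
    (fun v w z => by rw [smul_dot, smul_dot]; exact abs_bandCurv_sub_le β v w hh z)
    hτ {v | l1Norm v ≤ R} (fun v hv => hv)

end Model

/-! ### Deterministic analysis of the penalized objective -/

section Objective

variable {p n : ℕ} {K : ℝ → ℝ} {κl κ₂ h lam : ℝ} {D : Fin n → (Fin p → ℝ) × ℝ}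
  {β : Fin (p + 1) → ℝ}

/-- The penalized empirical loss. -/
noncomputable def objective (K : ℝ → ℝ) (h lam : ℝ) (D : Fin n → (Fin p → ℝ) × ℝ)
    (b : Fin (p + 1) → ℝ) : ℝ := empiricalLoss K h D b + lam * l1Norm (Fin.tail b)

lemma isSmoothedLasso_iff {b : Fin (p + 1) → ℝ} :
    IsSmoothedLasso K h lam D b ↔ ∀ b', objective K h lam D b ≤ objective K h lam D b' := by
  simp [IsSmoothedLasso, isMinOn_iff, objective]

lemma margin_add (b v : Fin (p + 1) → ℝ) (z : (Fin p → ℝ) × ℝ) :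
    margin (b + v) z = margin b z + margin v z := by
  simp only [margin, dotProduct_add]; ring

lemma margin_combo (s t : ℝ) (b v : Fin (p + 1) → ℝ) (z : (Fin p → ℝ) × ℝ) :
    margin (s • b + t • v) z = s * margin b z + t * margin v z := by
  simp only [margin, dotProduct_add, dotProduct_smul, smul_eq_mul]; ring

lemma empiricalLoss_convex (hK : KernelAssumption K κl κ₂) (hh : 0 < h) {s t : ℝ} (hs : 0 ≤ s)
    (ht : 0 ≤ t) (hst : s + t = 1) (b v : Fin (p + 1) → ℝ) :
    empiricalLoss K h D (s • b + t • v) ≤ s * empiricalLoss K h D b + t * empiricalLoss K h D v := by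
  have h1 : ∑ i, smoothedHinge K h (margin (s • b + t • v) (D i)) ≤
      ∑ i, (s * smoothedHinge K h (margin b (D i)) + t * smoothedHinge K h (margin v (D i))) :=
    Finset.sum_le_sum fun i _ => by
      rw [margin_combo]; exact smoothedHinge_convex hK hh hs ht hst _ _
  rw [Finset.sum_add_distrib, ← Finset.mul_sum, ← Finset.mul_sum] at h1
  have h2 := mul_le_mul_of_nonneg_left h1 (by positivity : 0 ≤ (n : ℝ)⁻¹)
  simp only [empiricalLoss]
  linarith

lemma l1Norm_tail_convex {s t : ℝ} (hs : 0 ≤ s) (ht : 0 ≤ t) (b v : Fin (p + 1) → ℝ) :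
    l1Norm (Fin.tail (s • b + t • v)) ≤ s * l1Norm (Fin.tail b) + t * l1Norm (Fin.tail v) := by
  simp only [l1Norm, Finset.mul_sum, ← Finset.sum_add_distrib]
  refine Finset.sum_le_sum fun i _ => ?_
  refine (abs_add_le _ _).trans (le_of_eq ?_)
  simp only [Fin.tail, Pi.smul_apply, smul_eq_mul, abs_mul, abs_of_nonneg hs, abs_of_nonneg ht]

lemma objective_convex (hK : KernelAssumption K κl κ₂) (hh : 0 < h) (hlam : 0 ≤ lam) {s t : ℝ}
    (hs : 0 ≤ s) (ht : 0 ≤ t) (hst : s + t = 1) (b v : Fin (p + 1) → ℝ) :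
    objective K h lam D (s • b + t • v) ≤ s * objective K h lam D b + t * objective K h lam D v := by
  have h1 := empiricalLoss_convex (D := D) hK hh hs ht hst b v
  have h2 := mul_le_mul_of_nonneg_left (l1Norm_tail_convex hs ht b v) hlam
  simp only [objective]
  linarith

lemma continuous_objective (hK : KernelAssumption K κl κ₂) (hh : 0 < h) :
    Continuous (objective K h lam D) := by
  unfold objective empiricalLoss
  refine (continuous_const.mul (continuous_finsetSum _ fun i _ =>
    (continuous_smoothedHinge hK hh).comp ?_)).add (continuous_const.mul ?_)
  · unfold margin dotProduct; fun_prop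
  · unfold l1Norm Fin.tail; fun_prop

/-- Linearization of the empirical loss, with a quadratic gain. -/
lemma empiricalLoss_gap (hK : KernelAssumption K κl κ₂) (hκl : 0 < κl) (hh : 0 < h)
    (β v : Fin (p + 1) → ℝ) :
    κl / 4 * ((n : ℝ)⁻¹ * ∑ i, bandCurv β h v (D i)) -
        (n : ℝ)⁻¹ * ∑ i, smoothedStep K h (margin β (D i)) * margin v (D i) ≤
      empiricalLoss K h D (β + v) - empiricalLoss K h D β := by
  have point : ∀ z : (Fin p → ℝ) × ℝ, κl / 4 * bandCurv β h v z -
      smoothedStep K h (margin β z) * margin v z ≤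
      smoothedHinge K h (margin (β + v) z) - smoothedHinge K h (margin β z) := by
    intro z
    rw [margin_add]
    have h0 := smoothedHinge_rem_nonneg hK hh (margin β z) (margin v z)
    by_cases hz : |1 - margin β z| ≤ h / 2
    · have hbc : bandCurv β h v z = h⁻¹ * truncSq (h / 2) (margin v z) := by
        simp [bandCurv, indicator, hz]
      rcases le_or_gt |margin v z| (h / 2) with hv | hv
      · have h1 := smoothedHinge_rem_ge hK hκl hh hz hv
        have h2 := truncSq_le_sq (h / 2) (margin v z)
        have h3 : κl / 4 * (h⁻¹ * truncSq (h / 2) (margin v z)) ≤ κl * margin v z ^ 2 / (4 * h) := by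
          calc _ ≤ κl / 4 * (h⁻¹ * margin v z ^ 2) := by gcongr
            _ = _ := by field_simp
        rw [hbc]; linarith
      · rw [hbc, truncSq_eq_zero hv]; linarith
    · have hbc : bandCurv β h v z = 0 := by simp [bandCurv, indicator, hz]
      rw [hbc]; linarith
  have h1 := Finset.sum_le_sum fun i (_ : i ∈ Finset.univ) => point (D i)
  simp only [Finset.sum_sub_distrib, ← Finset.mul_sum] at h1
  have h2 := mul_le_mul_of_nonneg_left h1 (by positivity : 0 ≤ (n : ℝ)⁻¹)
  simp only [empiricalLoss]
  linarith

/-- The penalty at `β + v` exceeds that at `β` by the `l₁` norm of `v`, up to the coordinates in the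
support of `β`; the unpenalized intercept is counted with the support. -/
lemma l1Norm_tail_gap (β v : Fin (p + 1) → ℝ) {s : ℕ} (hs : l0Norm β = s) (hs1 : 1 ≤ s) :
    l1Norm v - 3 * (√s * l2Norm v) ≤ l1Norm (Fin.tail (β + v)) - l1Norm (Fin.tail β) := by
  classical
  set S : Finset (Fin (p + 1)) := insert 0 (Finset.univ.filter fun j => β j ≠ 0) with hS
  have hcard : (S.card : ℝ) ≤ 2 * s := by
    have h1 : (Finset.univ.filter fun j => β j ≠ 0).card = s := by
      rw [← hs, l0Norm, ← Set.ncard_coe_finset]; congr 1; ext j; simp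
    have h2 := Finset.card_insert_le (0 : Fin (p + 1)) (Finset.univ.filter fun j => β j ≠ 0)
    rw [h1] at h2
    have h3 : S.card ≤ 2 * s := by rw [hS]; omega
    exact_mod_cast h3
  have hCS : 2 * ∑ j ∈ S, |v j| ≤ 3 * (√s * l2Norm v) := by
    have h1 := sq_sum_le_card_mul_sum_sq (s := S) (f := fun j => |v j|)
    have h2 : ∑ j ∈ S, |v j| ^ 2 ≤ l2Norm v ^ 2 := by
      rw [l2Norm_sq, dotProduct]
      simp only [sq_abs]
      refine (Finset.sum_le_sum_of_subset_of_nonneg (Finset.subset_univ S)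
        fun j _ _ => sq_nonneg (v j)).trans (le_of_eq ?_)
      simp [sq]
    have h3 : (2 * ∑ j ∈ S, |v j|) ^ 2 ≤ (3 * (√s * l2Norm v)) ^ 2 := by
      have h4 : (√(s : ℝ)) ^ 2 = s := Real.sq_sqrt (Nat.cast_nonneg s)
      have h5 : (S.card : ℝ) * ∑ j ∈ S, |v j| ^ 2 ≤ 2 * s * l2Norm v ^ 2 :=
        mul_le_mul hcard h2 (Finset.sum_nonneg fun _ _ => sq_nonneg _) (by positivity)
      have h6 : 0 ≤ (s : ℝ) * l2Norm v ^ 2 := by positivity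
      rw [mul_pow, mul_pow, mul_pow, h4]
      nlinarith
    exact abs_le_of_sq_le_sq' h3 (by have := l2Norm_nonneg v; positivity) |>.2
  have hpoint : ∀ i : Fin p, |v i.succ| - 2 * (if i.succ ∈ S then |v i.succ| else 0) ≤
      |β i.succ + v i.succ| - |β i.succ| := by
    intro i
    by_cases hi : β i.succ = 0
    · have : i.succ ∉ S := by simp [hS, hi, Fin.succ_ne_zero]
      simp [this, hi]
    · have : i.succ ∈ S := by simp [hS, hi]
      rw [if_pos this]
      have := abs_sub_abs_le_abs_sub (β i.succ) (-v i.succ)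
      rw [abs_neg, sub_neg_eq_add] at this
      linarith
  have hsum := Finset.sum_le_sum fun i (_ : i ∈ Finset.univ) => hpoint i
  have h0 : (0 : Fin (p + 1)) ∈ S := by simp [hS]
  have hS' : ∑ j ∈ S, |v j| = |v 0| + ∑ i : Fin p, if i.succ ∈ S then |v i.succ| else 0 := by
    rw [← Finset.univ_inter S, ← Finset.sum_ite_mem, Fin.sum_univ_succ]
    simp [h0]
  simp only [Finset.sum_sub_distrib, ← Finset.mul_sum] at hsum
  have hl1 : l1Norm v = |v 0| + ∑ i : Fin p, |v i.succ| := by rw [l1Norm, Fin.sum_univ_succ]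
  have ht : l1Norm (Fin.tail (β + v)) = ∑ i : Fin p, |β i.succ + v i.succ| := rfl
  have ht' : l1Norm (Fin.tail β) = ∑ i : Fin p, |β i.succ| := rfl
  rw [ht, ht', hl1]
  linarith [abs_nonneg (v 0)]

lemma objective_gap (hK : KernelAssumption K κl κ₂) (hκl : 0 < κl) (hh : 0 < h) (hlam : 0 < lam)
    {s : ℕ} (hs : l0Norm β = s) (hs1 : 1 ≤ s)
    (hscore : ∀ v, (n : ℝ)⁻¹ * ∑ i, smoothedStep K h (margin β (D i)) * margin v (D i) ≤
      lam / 2 * l1Norm v + √s * lam * l2Norm v) (v : Fin (p + 1) → ℝ) :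
    κl / 4 * ((n : ℝ)⁻¹ * ∑ i, bandCurv β h v (D i)) + lam / 2 * l1Norm v -
      4 * (√s * lam * l2Norm v) ≤ objective K h lam D (β + v) - objective K h lam D β := by
  have h1 := empiricalLoss_gap (D := D) hK hκl hh β v
  have h2 := mul_le_mul_of_nonneg_left (l1Norm_tail_gap β v hs hs1) hlam.le
  have h3 := hscore v
  simp only [objective]
  nlinarith

/-- Whoever does at least as well as `β` differs from it by a vector of the cone. -/
lemma l1Norm_le_of_objective_le (hK : KernelAssumption K κl κ₂) (hκl : 0 < κl) (hh : 0 < h)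
    (hlam : 0 < lam) {s : ℕ} (hs : l0Norm β = s) (hs1 : 1 ≤ s)
    (hscore : ∀ v, (n : ℝ)⁻¹ * ∑ i, smoothedStep K h (margin β (D i)) * margin v (D i) ≤
      lam / 2 * l1Norm v + √s * lam * l2Norm v) {v : Fin (p + 1) → ℝ}
    (hv : objective K h lam D (β + v) ≤ objective K h lam D β) :
    l1Norm v ≤ 8 * √s * l2Norm v := by
  have h1 := objective_gap hK hκl hh hlam hs hs1 hscore v
  have h2 : 0 ≤ κl / 4 * ((n : ℝ)⁻¹ * ∑ i, bandCurv β h v (D i)) := by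
    refine mul_nonneg (by positivity) (mul_nonneg (by positivity) (Finset.sum_nonneg fun i _ => ?_))
    exact indicator_nonneg (fun z _ => mul_nonneg (inv_pos.2 hh).le (truncSq_nonneg _ _)) _
  have h3 : lam * l1Norm v ≤ lam * (8 * √s * l2Norm v) := by linarith
  exact le_of_mul_le_mul_left h3 hlam

/-- Existence of a minimizer and the error bounds, from the score bound and the curvature on one
sphere. By convexity it is enough that the objective exceeds its value at `β` on that sphere. -/
lemma exists_lasso_and_bounds (hK : KernelAssumption K κl κ₂) (hκl : 0 < κl) (hh : 0 < h)
    (hlam : 0 < lam) {s : ℕ} (hs : l0Norm β = s) (hs1 : 1 ≤ s) {a r : ℝ} (ha : 0 < a)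
    (hr : r = 40 / (κl * a) * √s * lam)
    (hscore : ∀ v, (n : ℝ)⁻¹ * ∑ i, smoothedStep K h (margin β (D i)) * margin v (D i) ≤
      lam / 2 * l1Norm v + √s * lam * l2Norm v)
    (hcurv : ∀ v, l2Norm v = r → l1Norm v ≤ 8 * √s * r →
      a / 2 * r ^ 2 ≤ (n : ℝ)⁻¹ * ∑ i, bandCurv β h v (D i)) :
    (∃ b, IsSmoothedLasso K h lam D b) ∧ ∀ b, IsSmoothedLasso K h lam D b →
      l2Norm (b - β) ≤ r ∧ l1Norm (b - β) ≤ 8 * √s * r := by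
  have hs0 : (0 : ℝ) < √s := Real.sqrt_pos.2 (by exact_mod_cast hs1)
  have hr0 : 0 < r := by rw [hr]; positivity
  have sphere : ∀ v, l2Norm v = r → objective K h lam D β < objective K h lam D (β + v) := by
    intro v hv
    by_contra hcon
    have hle := not_lt.1 hcon
    have hcone := l1Norm_le_of_objective_le hK hκl hh hlam hs hs1 hscore hle
    rw [hv] at hcone
    have h1 := objective_gap hK hκl hh hlam hs hs1 hscore v
    have h2 := mul_le_mul_of_nonneg_left (hcurv v hv hcone) (by positivity : 0 ≤ κl / 4)
    have h3 : 0 ≤ lam / 2 * l1Norm v := mul_nonneg (by positivity) (l1Norm_nonneg v)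
    have h4 : κl / 4 * (a / 2 * r ^ 2) = 5 * (√s * lam * r) := by
      rw [sq, ← mul_assoc (a / 2)]
      nth_rewrite 1 [hr]
      field_simp; ring
    have h5 : 0 < √s * lam * r := by positivity
    rw [hv] at h1
    linarith
  have outside : ∀ v, r < l2Norm v → objective K h lam D β < objective K h lam D (β + v) := by
    intro v hv
    have hv0 : 0 < l2Norm v := hr0.trans hv
    set t := r / l2Norm v with ht
    have ht0 : 0 < t := by positivity
    have ht1 : t < 1 := (div_lt_one hv0).2 hv
    have hsph : l2Norm (t • v) = r := by
      rw [l2Norm_smul, abs_of_pos ht0, ht, div_mul_cancel₀ _ hv0.ne']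
    have h1 := sphere _ hsph
    have h2 := objective_convex (D := D) hK hh hlam.le (sub_nonneg.2 ht1.le) ht0.le
      (by ring : 1 - t + t = 1) β (β + v)
    have h3 : (1 - t) • β + t • (β + v) = β + t • v := by
      ext j; simp only [Pi.add_apply, Pi.smul_apply, smul_eq_mul]; ring
    rw [h3] at h2
    nlinarith
  constructor
  · set B : Set (Fin (p + 1) → ℝ) := {b | l2Norm (b - β) ≤ r} with hB
    have hclosed : IsClosed B := isClosed_le (continuous_l2Norm.comp (by fun_prop)) continuous_const
    have hcompact : IsCompact B := by
      refine (isCompact_closedBall β r).of_isClosed_subset hclosed fun b hb => ?_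
      rw [Metric.mem_closedBall, dist_pi_le_iff hr0.le]
      intro j
      rw [Real.dist_eq]
      exact (abs_apply_le_l2Norm (b - β) j).trans hb
    have hβB : β ∈ B := by
      have : l2Norm (β - β) = 0 := by rw [sub_self, l2Norm_eq_zero]
      exact this.le.trans hr0.le
    obtain ⟨b, hbB, hb⟩ := hcompact.exists_isMinOn ⟨β, hβB⟩
      (continuous_objective (D := D) (lam := lam) hK hh).continuousOn
    refine ⟨b, isSmoothedLasso_iff.2 fun b' => ?_⟩
    by_cases hb' : b' ∈ B
    · exact hb hb'
    · have h1 := outside (b' - β) (not_le.1 hb')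
      rw [add_sub_cancel] at h1
      exact (hb hβB).trans h1.le
  · intro b hb
    have hle := isSmoothedLasso_iff.1 hb β
    rw [← add_sub_cancel β b] at hle
    have hl2 : l2Norm (b - β) ≤ r := by
      by_contra hcon
      exact absurd hle (not_le.2 (outside _ (not_le.1 hcon)))
    refine ⟨hl2, (l1Norm_le_of_objective_le hK hκl hh hlam hs hs1 hscore hle).trans ?_⟩
    gcongr

end Objective

/-! ### Probability of the events and choice of the constants -/

/-- The failure probability of each of the two events. -/
lemma two_mul_exp_le {p : ℕ} (hp : 4 ≤ p) {x : ℝ} (hx : 3 * Real.log p ≤ x) :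
    2 * ((p : ℝ) + 1) * Real.exp (-x) ≤ 2 * (p + 1) / p ^ 3 := by
  have hp0 : (0 : ℝ) < p := by positivity
  have h1 : Real.exp (-x) ≤ ((p : ℝ) ^ 3)⁻¹ := by
    rw [Real.exp_neg]
    refine inv_anti₀ (by positivity) ?_
    calc (p : ℝ) ^ 3 = Real.exp (3 * Real.log p) := by
          rw [mul_comm, Real.exp_mul, Real.exp_log hp0]; norm_cast
      _ ≤ Real.exp x := Real.exp_le_exp.2 hx
  rw [div_eq_mul_inv]
  gcongr

lemma exists_event {Ω Z : Type*} [MeasurableSpace Ω] [MeasurableSpace Z] (μ : Measure Ω)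
    [IsProbabilityMeasure μ] (P : Measure Z) [IsProbabilityMeasure P] {p n : ℕ} (hp : 4 ≤ p)
    (D : Fin n → Ω → Z)
    (hD : ∀ i, Measurable (D i)) (hind : iIndepFun D μ) (hlaw : ∀ i, μ.map (D i) = P)
    {G₁ G₂ : Set (Fin n → Z)} (hG₁ : MeasurableSet G₁) (hG₂ : MeasurableSet G₂)
    (h₁ : Measure.pi (fun _ : Fin n => P) G₁ᶜ ≤ ENNReal.ofReal (2 * (p + 1) / p ^ 3))
    (h₂ : Measure.pi (fun _ : Fin n => P) G₂ᶜ ≤ ENNReal.ofReal (2 * (p + 1) / p ^ 3)) :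
    ∃ G : Set Ω, MeasurableSet G ∧ 1 - 4 / (p : ℝ) < μ.real G ∧
      ∀ ω ∈ G, (fun i => D i ω) ∈ G₁ ∧ (fun i => D i ω) ∈ G₂ := by
  have hF : Measurable fun ω i => D i ω := measurable_pi_lambda _ hD
  have hmap : μ.map (fun ω i => D i ω) = Measure.pi (fun _ : Fin n => P) := by
    rw [(iIndepFun_iff_map_fun_eq_pi_map fun i => (hD i).aemeasurable).1 hind]
    simp only [hlaw]
  set Q := Measure.pi (fun _ : Fin n => P) with hQ
  have hp0 : (0 : ℝ) < p := by positivity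
  have hp4 : (4 : ℝ) ≤ p := by exact_mod_cast hp
  refine ⟨(fun ω i => D i ω) ⁻¹' (G₁ ∩ G₂), hF (hG₁.inter hG₂), ?_, fun ω hω => hω⟩
  have e1 : μ.real ((fun ω i => D i ω) ⁻¹' (G₁ ∩ G₂)) = Q.real (G₁ ∩ G₂) := by
    rw [← hmap, map_measureReal_apply hF (hG₁.inter hG₂)]
  have e2 : Q.real (G₁ ∩ G₂)ᶜ ≤ 2 * (p + 1) / p ^ 3 + 2 * (p + 1) / p ^ 3 := by
    rw [compl_inter]
    refine (measureReal_union_le _ _).trans (add_le_add ?_ ?_)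
    · exact ENNReal.toReal_le_of_le_ofReal (by positivity) h₁
    · exact ENNReal.toReal_le_of_le_ofReal (by positivity) h₂
  rw [probReal_compl_eq_one_sub (hG₁.inter hG₂)] at e2
  have e3 : 2 * ((p : ℝ) + 1) / p ^ 3 + 2 * (p + 1) / p ^ 3 < 4 / p := by
    rw [← add_div, div_lt_div_iff₀ (by positivity) hp0]
    nlinarith [mul_pos hp0 hp0, mul_pos (mul_pos hp0 hp0) hp0]
  rw [e1]
  linarith

/-- All statements about one population and one sample size, under explicit conditions on the
constants. -/
lemma Model.exists_good_event {d : ℕ} {P : Measure ((Fin (d + 1) → ℝ) × ℝ)} [IsProbabilityMeasure P]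
    {f g : (Fin (d + 1) → ℝ) → ℝ} {β : Fin (d + 1 + 1) → ℝ} {v₀ c₁ c₂ M Cf c C a₁ a₂ : ℝ}
    (H : Model P f g β v₀ c₁ c₂ M Cf c C a₁ a₂) {K : ℝ → ℝ} {κl κ₂ h lam r : ℝ} {n s : ℕ}
    (hK : KernelAssumption K κl κ₂) (hκl : 0 < κl) (hp : 4 ≤ d + 1) (hs : l0Norm β = s)
    (hs1 : 1 ≤ s) (hn : 0 < n) (hh : 0 < h) (hlam : 0 < lam)
    (hr : r = 40 / (κl * a₁) * √s * lam)
    (hbias : 9 * Cf * (1 + c₂) / c ^ 2 * κ₂ * h ^ 2 ≤ √s * lam)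
    (hnoise : 3 * Real.log (d + 1 : ℕ) ≤ n * (lam / 2) ^ 2 / (64 * (v₀ * √c₂) ^ 2))
    (hnoise' : 3 * Real.log (d + 1 : ℕ) ≤
      n * (a₁ / 4 * r ^ 2) ^ 2 / (64 * (v₀ * √c₂) ^ 2 * (8 * √s * r) ^ 2))
    (hband : 9 * Cf * (1 + c₂) / c ^ 2 * h ≤ a₁ / 8)
    (htrunc : 1536 * (v₀ * √c₂) ^ 4 * r ^ 4 / h ^ 3 ≤ a₁ / 8 * r ^ 2)
    {Ω : Type*} [MeasurableSpace Ω] (μ : Measure Ω) [IsProbabilityMeasure μ]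
    (D : Fin n → Ω → (Fin (d + 1) → ℝ) × ℝ) (hD : ∀ i, Measurable (D i)) (hind : iIndepFun D μ)
    (hlaw : ∀ i, μ.map (D i) = P) :
    ∃ G : Set Ω, MeasurableSet G ∧ 1 - 4 / ((d + 1 : ℕ) : ℝ) < μ.real G ∧ ∀ ω ∈ G,
      (∃ b, IsSmoothedLasso K h lam (fun i => D i ω) b) ∧
      ∀ b, IsSmoothedLasso K h lam (fun i => D i ω) b →
        l2Norm (b - β) ≤ r ∧ l1Norm (b - β) ≤ 8 * √s * r := by
  have hs0 : (0 : ℝ) < √s := Real.sqrt_pos.2 (by exact_mod_cast hs1)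
  have ha := H.a₁_pos
  have hr0 : 0 < r := by rw [hr]; positivity
  obtain ⟨G₁, hG₁m, hG₁, hG₁p⟩ := H.exists_score_event hK (h := h) (τ := lam / 2) (by positivity) hn
  obtain ⟨G₂, hG₂m, hG₂, hG₂p⟩ := H.exists_curvature_event hh (τ := a₁ / 4 * r ^ 2)
    (R := 8 * √s * r) (by positivity) (by positivity) hn
  obtain ⟨G, hGm, hGp, hG⟩ := exists_event μ P hp D hD hind hlaw hG₁m hG₂m
    (hG₁p.trans (ENNReal.ofReal_le_ofReal (two_mul_exp_le hp hnoise)))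
    (hG₂p.trans (ENNReal.ofReal_le_ofReal (two_mul_exp_le hp hnoise')))
  refine ⟨G, hGm, hGp, fun ω hω => ?_⟩
  obtain ⟨hω₁, hω₂⟩ := hG ω hω
  refine exists_lasso_and_bounds hK hκl hh hlam hs hs1 ha hr (fun v => ?_) fun v hv hv1 => ?_
  · have h1 := (abs_le.1 (hG₁ _ hω₁ v)).1
    have h2 := (abs_le.1 (H.abs_integral_smoothed_score_le hK (h := h) v)).2
    have h3 := mul_le_mul_of_nonneg_right hbias (l2Norm_nonneg v)
    change ∫ z, smoothedStep K h (margin β z) * margin v z ∂P ≤ _ at h2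
    linarith
  · have h1 := hG₂ _ hω₂ v hv1
    have h2 := H.le_integral_bandCurv v hh
    rw [hv] at h2
    have h3 := mul_le_mul_of_nonneg_right hband (sq_nonneg r)
    linarith

end SmoothedSVM

theorem theorem1 (c₁ c₂ Cf c κ₂ κl a₁ a₂ : ℝ) (hc₁ : 0 < c₁) (hc₂ : 0 < c₂) (hCf : 0 < Cf)
    (hc : 0 < c) (hκ₂ : 0 < κ₂) (hκl : 0 < κl) (ha₁ : 0 < a₁) (ha₂ : 0 < a₂) :
    -- the constants of the error bounds
    ∃ C₁ : ℝ, 0 < C₁ ∧ ∃ C₂ : ℝ, 0 < C₂ ∧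
    -- the kernel, the remaining constants of the assumptions, the constants of the bandwidth
    ∀ K : ℝ → ℝ, SmoothedSVM.KernelAssumption K κl κ₂ →
    ∀ v₀ M C b₁ b₂ : ℝ, 0 < v₀ → 0 < M → 0 < C → 0 < b₁ → b₁ ≤ b₂ →
    -- the constants of the penalty level, and the constant of the sample size condition
    ∃ A₀ : ℝ, 0 < A₀ ∧ ∀ A₁ A₂ : ℝ, A₀ ≤ A₁ → A₁ ≤ A₂ →
    ∃ N₀ : ℝ, 0 < N₀ ∧
    ∀ (d p n s : ℕ), p = d + 1 →
    ∀ (P : Measure ((Fin (d + 1) → ℝ) × ℝ)) [IsProbabilityMeasure P]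
      (f g : (Fin (d + 1) → ℝ) → ℝ) (βstar : Fin (d + 1 + 1) → ℝ),
    (∀ᵐ z ∂P, z.2 = 1 ∨ z.2 = -1) →
    SmoothedSVM.IsRiskMinimizer P βstar →
    SmoothedSVM.l0Norm βstar = s →
    SmoothedSVM.DensityAssumption (SmoothedSVM.classLaw P 1) f Cf →
    SmoothedSVM.DensityAssumption (SmoothedSVM.classLaw P (-1)) g Cf →
    SmoothedSVM.DesignAssumption P v₀ c₁ c₂ M →
    SmoothedSVM.ParameterAssumption βstar c C →
    SmoothedSVM.HessianAssumption P βstar a₁ a₂ →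
    -- sample size, penalty level and bandwidth
    N₀ * (s * Real.log p) ≤ n →
    ∀ lam h : ℝ,
    A₁ * √(Real.log p / n) ≤ lam → lam ≤ A₂ * √(Real.log p / n) →
    b₁ * (s * Real.log p / n) ^ (1 / 4 : ℝ) ≤ h → h ≤ b₂ * (s * Real.log p / n) ^ (1 / 4 : ℝ) →
    -- an independent sample of size `n` from `P`
    ∀ {Ω : Type*} [MeasurableSpace Ω] (μ : Measure Ω) [IsProbabilityMeasure μ]
      (D : Fin n → Ω → (Fin (d + 1) → ℝ) × ℝ),
    (∀ i, Measurable (D i)) → iIndepFun D μ → (∀ i, μ.map (D i) = P) →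
    ∃ G : Set Ω, MeasurableSet G ∧ 1 - 4 / (p : ℝ) < μ.real G ∧ ∀ ω ∈ G,
      (∃ βhat, SmoothedSVM.IsSmoothedLasso K h lam (fun i => D i ω) βhat) ∧
      ∀ βhat, SmoothedSVM.IsSmoothedLasso K h lam (fun i => D i ω) βhat →
        SmoothedSVM.l2Norm (βhat - βstar) ≤ C₂ * (s : ℝ) ^ (1 / 2 : ℝ) * lam ∧
        SmoothedSVM.l1Norm (βhat - βstar) ≤ C₁ * s * lam := by
  set C₂ : ℝ := 40 / (κl * a₁) with hC₂
  have hC₂0 : 0 < C₂ := by positivity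
  refine ⟨8 * C₂, by positivity, C₂, hC₂0, ?_⟩
  intro K hK v₀ M C b₁ b₂ hv₀ _ _ hb₁ hb
  have hb₂ : 0 < b₂ := hb₁.trans_le hb
  set L : ℝ := 9 * Cf * (1 + c₂) / c ^ 2 with hL
  have hL0 : 0 < L := by positivity
  set σ : ℝ := v₀ * √c₂ with hσ
  have hσ0 : 0 < σ := mul_pos hv₀ (Real.sqrt_pos.2 hc₂)
  -- the penalty dominates the smoothing bias, the noise of the score, and the noise of the curvature
  refine ⟨L * κ₂ * b₂ ^ 2 + 28 * σ + 12 * σ * κl, by positivity, ?_⟩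
  intro A₁ A₂ hA₁ hA₂
  have hA₁0 : 0 < A₁ := lt_of_lt_of_le (by positivity) hA₁
  have hA₂0 : 0 < A₂ := hA₁0.trans_le hA₂
  have hAb : L * κ₂ * b₂ ^ 2 ≤ A₁ := by
    have : 0 ≤ 28 * σ + 12 * σ * κl := by positivity
    linarith
  have hAσ : 28 * σ ≤ A₁ := by
    have : 0 ≤ L * κ₂ * b₂ ^ 2 + 12 * σ * κl := by positivity
    linarith
  have hAκ : 12 * σ * κl ≤ A₁ := by
    have : 0 ≤ L * κ₂ * b₂ ^ 2 + 28 * σ := by positivity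
    linarith
  -- for `(s log p / n) ^ (1 / 4) ≤ δ`, the errors in the mean curvature from the band width and from
  -- the truncation are at most `a₁ / 8 * r ^ 2` each
  set q : ℝ := L * b₂ + 1536 * σ ^ 4 * C₂ ^ 2 * A₂ ^ 2 / b₁ ^ 3 with hq
  have hq0 : 0 < q := by positivity
  set δ : ℝ := a₁ / 8 / q with hδ
  have hδ0 : 0 < δ := by positivity
  refine ⟨(δ ^ 4)⁻¹, by positivity, ?_⟩
  intro d p n s hpd P _ f g β hlabel hrisk hs hf hg hdesign hparam hhess hN lam h hlam₁ hlam₂ hh₁ hh₂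
    Ω _ μ _ D hD hind hlaw
  subst hpd
  by_cases hp : d + 1 < 4
  · -- for fewer than four features the probability bound is void
    refine ⟨∅, MeasurableSet.empty, ?_, fun ω hω => absurd hω (notMem_empty ω)⟩
    rw [measureReal_empty, sub_neg, lt_div_iff₀ (by positivity)]
    have : ((d + 1 : ℕ) : ℝ) < 4 := by exact_mod_cast hp
    linarith
  have hp : 4 ≤ d + 1 := not_lt.1 hp
  have H : SmoothedSVM.Model P f g β v₀ c₁ c₂ M Cf c C a₁ a₂ :=
    ⟨hc₁, hc₂, hc, hCf, hv₀, ha₁, hlabel, hrisk, hf, hg, hdesign, hparam, hhess⟩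
  have hs1 : 1 ≤ s := by
    rw [← hs, SmoothedSVM.l0Norm, Nat.one_le_iff_ne_zero, ← Nat.pos_iff_ne_zero,
      Set.ncard_pos (Set.toFinite _)]
    exact ⟨1, H.first_coeff_ne_zero⟩
  have hsR : (1 : ℝ) ≤ s := by exact_mod_cast hs1
  set ℓ : ℝ := Real.log (d + 1 : ℕ) with hℓ
  have hℓ0 : 0 < ℓ := Real.log_pos (by exact_mod_cast (by omega : 1 < d + 1))
  have hnR : (0 : ℝ) < n := lt_of_lt_of_le (by positivity) hN
  have hn : 0 < n := by exact_mod_cast hnR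
  set ρ : ℝ := s * ℓ / n with hρ
  have hρ0 : 0 < ρ := by positivity
  set ε : ℝ := ρ ^ (1 / 4 : ℝ) with hε
  have hε0 : 0 < ε := Real.rpow_pos_of_pos hρ0 _
  have hε4 : ε ^ 4 = ρ := by
    rw [hε, ← Real.rpow_natCast, ← Real.rpow_mul hρ0.le]; norm_num
  have hεδ : ε ≤ δ := by
    have h1 : ρ ≤ δ ^ 4 := by
      rw [hρ, div_le_iff₀ hnR]
      rw [inv_mul_le_iff₀ (by positivity)] at hN
      exact hN
    rw [← hε4] at h1
    exact le_of_pow_le_pow_left₀ (by norm_num) hδ0.le h1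
  set w : ℝ := √(ℓ / n) with hw
  have hw0 : 0 < w := Real.sqrt_pos.2 (by positivity)
  have hw2 : w ^ 2 = ℓ / n := Real.sq_sqrt (by positivity)
  have hs2 : √(s : ℝ) ^ 2 = s := Real.sq_sqrt (Nat.cast_nonneg s)
  have hs0 : 0 < √(s : ℝ) := Real.sqrt_pos.2 (by linarith)
  have hε2 : ε ^ 2 = √s * w := by
    have h1 : (ε ^ 2) ^ 2 = (√s * w) ^ 2 := by
      rw [← pow_mul, hε4, mul_pow, hs2, hw2, hρ]; ring
    exact (sq_eq_sq₀ (by positivity) (by positivity)).1 h1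
  have hlam0 : 0 < lam := lt_of_lt_of_le (by positivity) hlam₁
  have hh0 : 0 < h := lt_of_lt_of_le (by positivity) hh₁
  set r : ℝ := C₂ * √s * lam with hr
  have hr0 : 0 < r := by positivity
  have hnlam : A₁ ^ 2 * ℓ ≤ n * lam ^ 2 := by
    have h1 := pow_le_pow_left₀ (by positivity) hlam₁ 2
    rw [mul_pow, hw2] at h1
    calc A₁ ^ 2 * ℓ = n * (A₁ ^ 2 * (ℓ / n)) := by field_simp
      _ ≤ _ := by gcongr
  have hbias : L * κ₂ * h ^ 2 ≤ √s * lam := by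
    calc L * κ₂ * h ^ 2 ≤ L * κ₂ * (b₂ * ε) ^ 2 := by gcongr
      _ = (L * κ₂ * b₂ ^ 2) * (√s * w) := by rw [mul_pow, hε2]; ring
      _ ≤ A₁ * (√s * w) := by gcongr
      _ = √s * (A₁ * w) := by ring
      _ ≤ √s * lam := by gcongr
  have hnoise : 3 * ℓ ≤ n * (lam / 2) ^ 2 / (64 * σ ^ 2) := by
    rw [le_div_iff₀ (by positivity)]
    have h1 : (28 * σ) ^ 2 ≤ A₁ ^ 2 := pow_le_pow_left₀ (by positivity) hAσ 2
    have h2 := mul_le_mul_of_nonneg_right h1 hℓ0.le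
    have h3 : 0 ≤ σ ^ 2 * ℓ := by positivity
    linarith
  have hnoise' : 3 * ℓ ≤ n * (a₁ / 4 * r ^ 2) ^ 2 / (64 * σ ^ 2 * (8 * √s * r) ^ 2) := by
    have e : n * (a₁ / 4 * r ^ 2) ^ 2 / (64 * σ ^ 2 * (8 * √s * r) ^ 2) =
        1600 * (n * lam ^ 2) / (65536 * σ ^ 2 * κl ^ 2) := by
      rw [hr, hC₂]; field_simp; ring
    rw [e, le_div_iff₀ (by positivity)]
    have h1 : (12 * σ * κl) ^ 2 ≤ A₁ ^ 2 := pow_le_pow_left₀ (by positivity) hAκ 2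
    have h2 := mul_le_mul_of_nonneg_right h1 hℓ0.le
    have h3 : 0 ≤ σ ^ 2 * κl ^ 2 * ℓ := by positivity
    linarith
  have hband : L * h ≤ a₁ / 8 := by
    calc L * h ≤ L * (b₂ * δ) := by gcongr; exact hh₂.trans (by gcongr)
      _ = (L * b₂) * δ := by ring
      _ ≤ q * δ := by
          gcongr
          rw [hq]
          exact le_add_of_nonneg_right (by positivity)
      _ = a₁ / 8 := by rw [hδ]; field_simp
  have htrunc : 1536 * σ ^ 4 * r ^ 4 / h ^ 3 ≤ a₁ / 8 * r ^ 2 := by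
    have h1 : r ^ 2 ≤ C₂ ^ 2 * A₂ ^ 2 * ε ^ 4 := by
      calc r ^ 2 ≤ (C₂ * √s * (A₂ * w)) ^ 2 := by rw [hr]; gcongr
        _ = C₂ ^ 2 * A₂ ^ 2 * (√s * w) ^ 2 := by ring
        _ = _ := by rw [← hε2]; ring
    have h2 : (b₁ * ε) ^ 3 ≤ h ^ 3 := pow_le_pow_left₀ (by positivity) hh₁ 3
    calc 1536 * σ ^ 4 * r ^ 4 / h ^ 3 ≤ 1536 * σ ^ 4 * r ^ 4 / (b₁ * ε) ^ 3 := by gcongr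
      _ = 1536 * σ ^ 4 * r ^ 2 * r ^ 2 / (b₁ * ε) ^ 3 := by ring
      _ ≤ 1536 * σ ^ 4 * (C₂ ^ 2 * A₂ ^ 2 * ε ^ 4) * r ^ 2 / (b₁ * ε) ^ 3 := by gcongr
      _ = (1536 * σ ^ 4 * C₂ ^ 2 * A₂ ^ 2 / b₁ ^ 3) * ε * r ^ 2 := by field_simp
      _ ≤ q * δ * r ^ 2 := by
          gcongr
          rw [hq]
          exact le_add_of_nonneg_left (by positivity)
      _ = a₁ / 8 * r ^ 2 := by rw [hδ]; field_simp
  obtain ⟨G, hGm, hGp, hG⟩ := H.exists_good_event hK hκl hp hs hs1 hn hh0 hlam0 hr hbias hnoise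
    hnoise' hband htrunc μ D hD hind hlaw
  refine ⟨G, hGm, hGp, fun ω hω => ⟨(hG ω hω).1, fun b hb => ?_⟩⟩
  obtain ⟨h1, h2⟩ := (hG ω hω).2 b hb
  refine ⟨by rwa [← Real.sqrt_eq_rpow], h2.trans (le_of_eq ?_)⟩
  rw [hr]
  linear_combination 8 * C₂ * lam * hs2
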